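/- **Setting.** Let $\rho>0$, let $A,\Gamma,Q\in\mathbb R^{n\times n}$, $B\in\mathbb R^{n\times r}$, $R\in\mathbb R^{r\times r}$ symmetric with $R>0$, and $\eta,\bar x_0\in\mathbb R^n$. Let $C_{\rho/2}$ be the set of continuous $g:[0,\infty)\to\mathbb R^n$ with $\int_0^\infty e^{-\rho t}\|g(t)\|^2dt<\infty$, and let $\sigma\in C_{\rho/2}$. With no mean-field coupling in the dynamics and no forcing ($G=0$, $f=0$), agent $i$ ($1\le i\le N$) evolves by $$dx_i=(Ax_i+Bu_i)\,dt+\sigma\,dW_i ,$$ where the $W_i$ are independent standard Brownian motions and the initial states $x_i(0)$ are mutually independent, square integrable, of common mean $\bar x_0$, and independent of the $W_i$. Its cost is $\mathbb E\int_0^\infty e^{-\rho t}\{\|x_i-\Gamma x^{(N)}-\eta\|_Q^2+\|u_i\|_R^2\}dt$, with $x^{(N)}=\frac1N\sum_jx_j$. Admissible decentralized controls $u_i$ are adapted to $\sigma(x_i(s),s\le t)$ and satisfy $\mathbb E\int_0^\infty e^{-\rho t}\|u_i\|^2dt<\infty$. A set of control laws is a *representation* of another one if both are admissible, both generate the same unique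 state trajectory, and both have the same open-loop value on this trajectory. Assume that $Q\ge0$, $(A-\frac\rho2I,B)$ is stabilizable and $(A-\frac\rho2I,\sqrt Q)$ is detectable. Let $P\ge0$ solve $$\rho P=A^TP+PA-PBR^{-1}B^TP+Q,$$ put $\bar A=A-BR^{-1}B^TP$, and let $\bar P$ be a stabilizing solution of the nonsymmetric equation $$\rho\bar P=A^T\bar P+\bar PA-\bar PBR^{-1}B^T\bar P+Q(I-\Gamma),$$ that is, $A-BR^{-1}B^T\bar P-\frac\rho2I$ is Hurwitz. Consider the decentralized game strategies $$\hat u_i=-R^{-1}B^T[P\hat x_i+(\bar P-P)\bar x+\hat s],\qquad \bar x,\hat s\in C_{\rho/2},$$ $$\rho\hat s=\dot{\hat s}+(A^T-\bar PBR^{-1}B^T)\hat s-Q\eta,\qquad \dot{\bar x}=A\bar x-BR^{-1}B^T(\bar P\bar x+\hat s),\quad \bar x(0)=\bar x_0, \tag{1}$$ where $\hat x_i$ is the resulting closed-loop state, and the fixed-point-based feedback strategies $$u_i^*=-R^{-1}B^T(Px_i+s^*),\qquad \bar x^*,s^*\in C_{\rho/2},$$ $$\rho s^*=\dot s^*+\bar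 A^Ts^*-Q(\Gamma\bar x^*+\eta),\qquad \dot{\bar x}^*=\bar A\bar x^*-BR^{-1}B^Ts^*,\quad \bar x^*(0)=\bar x_0. \tag{2}$$ **Proposition.** Let $K^*=\bar P-P$. 1. $\rho K^*=K^*\bar A+\bar A^TK^*-K^*BR^{-1}B^TK^*-Q\Gamma$. 2. A pair $(\bar x^*,s^*)$ solves (2) in $C_{\rho/2}$ if and only if $(\bar x^*,\psi)$ with $\psi=s^*-K^*\bar x^*$ solves (1) in $C_{\rho/2}$. 3. If $(\bar x,\hat s)$ solves (1), $(\bar x^*,s^*)$ solves (2), and $\psi=\hat s$ on $[0,\infty)$, then $\bar x^*=\bar x$ and $\{\hat u_1,\dots,\hat u_N\}$ is a representation of $\{u_1^*,\dots,u_N^*\}$, both when the $\hat u_i$ are read as feedback laws and when they are read as the open-loop controls evaluated along $\hat x_i$. 4. If the matrix $$M_3=\begin{bmatrix}A-\frac\rho2I&BR^{-1}B^T\\ Q(I-\Gamma)&-A^T+\frac\rho2I\end{bmatrix}$$ has $n$ eigenvalues with negative and $n$ with positive real part (counted with multiplicity), then (1) and (2) are each uniquely solvable in $C_{\rho/2}$.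 Hence $\bar x^*=\bar x$ and $\psi=\hat s$ always hold, and $\{\hat u_1,\dots,\hat u_N\}$ is a representation of $\{u_1^*,\dots,u_N^*\}$. -/

import Mathlib

open MeasureTheory ProbabilityTheory Filter Set
open scoped NNReal ENNReal Topology Matrix

namespace MeanFieldLQ

noncomputable section

/-- The data of the discounted linear-quadratic mean field game.  Agent `i` evolves by
`dx_i = [A x_i + B u_i + G x^(N) + f] dt + σ dW_i` with `E x_i(0) = xbar0`, and pays
`E ∫₀^∞ e^{-ρ t} (‖x_i - Γ x^(N) - η‖²_Q + ‖u_i‖²_R) dt`, where `x^(N)` is the average of the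
states. -/
structure Model (n r : ℕ) where
  A : Matrix (Fin n) (Fin n) ℝ
  B : Matrix (Fin n) (Fin r) ℝ
  G : Matrix (Fin n) (Fin n) ℝ
  Γ : Matrix (Fin n) (Fin n) ℝ
  Q : Matrix (Fin n) (Fin n) ℝ
  R : Matrix (Fin r) (Fin r) ℝ
  η : Fin n → ℝ
  ρ : ℝ
  f : ℝ → Fin n → ℝ
  σ : ℝ → Fin n → ℝ
  xbar0 : Fin n → ℝ

/-! ### Matrices -/

/-- All complex eigenvalues have negative real part. -/
def Hurwitz {n : ℕ} (M : Matrix (Fin n) (Fin n) ℝ) : Prop :=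
  ∀ z ∈ spectrum ℂ (M.map Complex.ofReal), z.re < 0

/-- The pair `(A, B)` is stabilizable. -/
def Stabilizable {n r : ℕ} (A : Matrix (Fin n) (Fin n) ℝ) (B : Matrix (Fin n) (Fin r) ℝ) : Prop :=
  ∃ F : Matrix (Fin r) (Fin n) ℝ, Hurwitz (A + B * F)

/-- The pair `(A, C)` is detectable. -/
def Detectable {n m : ℕ} (A : Matrix (Fin n) (Fin n) ℝ) (C : Matrix (Fin m) (Fin n) ℝ) : Prop :=
  ∃ L : Matrix (Fin n) (Fin m) ℝ, Hurwitz (A + L * C)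

open Classical in
/-- Counted with algebraic multiplicity, `M` has `k` eigenvalues with negative real part and `l`
eigenvalues with positive real part. -/
def HasSplitSpectrum {ι : Type*} [Fintype ι] [DecidableEq ι] (M : Matrix ι ι ℝ) (k l : ℕ) : Prop :=
  Multiset.card ((M.map Complex.ofReal).charpoly.roots.filter fun z => z.re < 0) = k ∧
  Multiset.card ((M.map Complex.ofReal).charpoly.roots.filter fun z => 0 < z.re) = l

namespace Model

variable {n r : ℕ} (𝓜 : Model n r)

/-- `B R⁻¹ Bᵀ`. -/
def S : Matrix (Fin n) (Fin n) ℝ := 𝓜.B * 𝓜.R⁻¹ * 𝓜.Bᵀ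

/-- The shifted matrix `A - (ρ/2) I`. -/
def shiftedA : Matrix (Fin n) (Fin n) ℝ := 𝓜.A - (𝓜.ρ / 2) • 1

/-- `(A - (ρ/2) I, B)` is stabilizable, `Q ≥ 0`, and `(A - (ρ/2) I, √Q)` is detectable, where `√Q`
is the positive semidefinite square root. -/
def StabilizableDetectable : Prop :=
  Stabilizable 𝓜.shiftedA 𝓜.B ∧ 𝓜.Q.PosSemidef ∧
    ∃ C : Matrix (Fin n) (Fin n) ℝ, C.PosSemidef ∧ C * C = 𝓜.Q ∧ Detectable 𝓜.shiftedA C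

/-- The symmetric algebraic Riccati equation
`ρ P = Aᵀ P + P A - P B R⁻¹ Bᵀ P + Q`. -/
def Riccati (P : Matrix (Fin n) (Fin n) ℝ) : Prop :=
  𝓜.ρ • P = 𝓜.Aᵀ * P + P * 𝓜.A - P * 𝓜.S * P + 𝓜.Q

/-- The nonsymmetric algebraic Riccati equation
`ρ P̄ = Aᵀ P̄ + P̄ A - P̄ B R⁻¹ Bᵀ P̄ + Q (I - Γ)`. -/
def GameRiccati (Pbar : Matrix (Fin n) (Fin n) ℝ) : Prop :=
  𝓜.ρ • Pbar = 𝓜.Aᵀ * Pbar + Pbar * 𝓜.A - Pbar * 𝓜.S * Pbar + 𝓜.Q * (1 - 𝓜.Γ)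

/-- A stabilizing solution of the nonsymmetric Riccati equation:
`A - B R⁻¹ Bᵀ P̄ - (ρ/2) I` is Hurwitz. -/
def IsStabilizingGameSolution (Pbar : Matrix (Fin n) (Fin n) ℝ) : Prop :=
  𝓜.GameRiccati Pbar ∧ Hurwitz (𝓜.shiftedA - 𝓜.S * Pbar)

/-- `Ā = A - B R⁻¹ Bᵀ P`. -/
def Abar (P : Matrix (Fin n) (Fin n) ℝ) : Matrix (Fin n) (Fin n) ℝ := 𝓜.A - 𝓜.S * P

/-- The matrix `[[A - (ρ/2) I, B R⁻¹ Bᵀ], [Q (I - Γ), -Aᵀ + (ρ/2) I]]` attached to the nonsymmetric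
Riccati equation. -/
def M3 : Matrix (Fin n ⊕ Fin n) (Fin n ⊕ Fin n) ℝ :=
  Matrix.fromBlocks 𝓜.shiftedA 𝓜.S (𝓜.Q * (1 - 𝓜.Γ)) (-𝓜.shiftedAᵀ)

/-! ### The deterministic equations -/

/-- `g ∈ C_{ρ/2}([0, ∞), ℝⁿ)`: `g` is continuous on `[0, ∞)` and `∫₀^∞ e^{-ρ t} ‖g t‖² dt < ∞`
(`‖·‖` the Euclidean norm). -/
def InC (g : ℝ → Fin n → ℝ) : Prop :=
  ContinuousOn g (Ici 0) ∧ IntegrableOn (fun t => Real.exp (-𝓜.ρ * t) * (g t ⬝ᵥ g t)) (Ici 0)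

/-- `x̄, ŝ ∈ C_{ρ/2}` solve, on `[0, ∞)`,
`ρ ŝ = ŝ' + (Aᵀ - P̄ B R⁻¹ Bᵀ) ŝ + P̄ f - Q η` and
`x̄' = A x̄ - B R⁻¹ Bᵀ (P̄ x̄ + ŝ) + f`, `x̄(0) = x̄₀`. -/
def DecoupledSystem (Pbar : Matrix (Fin n) (Fin n) ℝ) (xbar shat : ℝ → Fin n → ℝ) : Prop :=
  𝓜.InC xbar ∧ 𝓜.InC shat ∧ xbar 0 = 𝓜.xbar0 ∧
  ∀ t : ℝ, 0 ≤ t →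
    HasDerivWithinAt shat
      (𝓜.ρ • shat t - (𝓜.Aᵀ - Pbar * 𝓜.S) *ᵥ shat t - Pbar *ᵥ 𝓜.f t + 𝓜.Q *ᵥ 𝓜.η)
      (Ici 0) t ∧
    HasDerivWithinAt xbar
      (𝓜.A *ᵥ xbar t - 𝓜.S *ᵥ (Pbar *ᵥ xbar t + shat t) + 𝓜.f t) (Ici 0) t

/-- `x̄*, s* ∈ C_{ρ/2}` solve the fixed-point equation on `[0, ∞)`:
`ρ s* = (s*)' + Āᵀ s* - Q (Γ x̄* + η)` and `(x̄*)' = Ā x̄* - B R⁻¹ Bᵀ s*`, `x̄*(0) = x̄₀`. -/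
def FixedPointSystem (P : Matrix (Fin n) (Fin n) ℝ) (xstar sstar : ℝ → Fin n → ℝ) : Prop :=
  𝓜.InC xstar ∧ 𝓜.InC sstar ∧ xstar 0 = 𝓜.xbar0 ∧
  ∀ t : ℝ, 0 ≤ t →
    HasDerivWithinAt sstar
      (𝓜.ρ • sstar t - (𝓜.Abar P)ᵀ *ᵥ sstar t + 𝓜.Q *ᵥ (𝓜.Γ *ᵥ xstar t + 𝓜.η)) (Ici 0) t ∧
    HasDerivWithinAt xstar (𝓜.Abar P *ᵥ xstar t - 𝓜.S *ᵥ sstar t) (Ici 0) t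

end Model

/-! ### The stochastic system -/

/-- The stochastic data: independent standard Brownian motions `W_i` and mutually independent,
square integrable initial states `x_i(0)` with common mean `xbar0`, the initial states being
independent of the Brownian motions. -/
structure IsNoiseData {n N : ℕ} (xbar0 : Fin n → ℝ) {Ω : Type*} [MeasurableSpace Ω]
    (μ : Measure Ω) (W : Fin N → ℝ≥0 → Ω → ℝ) (x0 : Fin N → Ω → Fin n → ℝ) : Prop where
  measurable_W : ∀ i t, Measurable (W i t)
  brownian : ∀ i, IsBrownianReal (W i) μ
  indep_W : iIndepFun (fun i ω t => W i t ω) μ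
  measurable_x0 : ∀ i, Measurable (x0 i)
  memLp_x0 : ∀ i, MemLp (x0 i) 2 μ
  mean_x0 : ∀ i, ∫ ω, x0 i ω ∂μ = xbar0
  indep_x0 : iIndepFun x0 μ
  indep_x0_W : IndepFun (fun ω i => x0 i ω) (fun ω i t => W i t ω) μ

/-- The left-endpoint sum over the uniform partition of `[0, t]` into `m` pieces that approximates
`∫₀ᵗ σ dw`. -/
def wienerSum {n : ℕ} {Ω : Type*} (σ : ℝ → Fin n → ℝ) (w : ℝ≥0 → Ω → ℝ) (t : ℝ≥0) (m : ℕ)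
    (ω : Ω) : Fin n → ℝ :=
  ∑ k ∈ Finset.range m,
    (w (t * ((k + 1 : ℕ) / m)) ω - w (t * ((k : ℕ) / m)) ω) • σ ((t * ((k : ℕ) / m) : ℝ≥0) : ℝ)

/-- `M t = ∫₀ᵗ σ dw` for every `t`, the Wiener integral of a continuous deterministic
`σ : [0, ∞) → ℝⁿ`, as the `L²` limit of left-endpoint sums. -/
def IsWienerIntegral {n : ℕ} {Ω : Type*} [MeasurableSpace Ω] (μ : Measure Ω)
    (σ : ℝ → Fin n → ℝ) (w : ℝ≥0 → Ω → ℝ) (M : ℝ≥0 → Ω → Fin n → ℝ) : Prop :=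
  ∀ t, Tendsto (fun m : ℕ => eLpNorm (fun ω => wienerSum σ w t m ω - M t ω) 2 μ) atTop (𝓝 0)

/-- The σ-algebra generated by all initial states and by all Brownian motions up to time `t`. -/
abbrev noiseSigma {n N : ℕ} {Ω : Type*} (W : Fin N → ℝ≥0 → Ω → ℝ) (x0 : Fin N → Ω → Fin n → ℝ)
    (t : ℝ≥0) : MeasurableSpace Ω :=
  ⨆ i, (MeasurableSpace.comap (x0 i) inferInstance ⊔
    ⨆ s : Iic t, MeasurableSpace.comap (W i s) inferInstance)

/-- A control law of one agent: the control used at time `t` when the agent is in state `x`.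
Feedback laws do not depend on `ω`; open-loop controls do not depend on `x`. -/
abbrev ControlLaw (Ω : Type*) (n r : ℕ) := Ω → ℝ≥0 → (Fin n → ℝ) → (Fin r → ℝ)

namespace Model

variable {n r N : ℕ} (𝓜 : Model n r) {Ω : Type*} [MeasurableSpace Ω]

/-- The drift `A x_i + B u_i + G x^(N) + f` of agent `i` at time `t`. -/
def drift (u : Fin N → ControlLaw Ω n r) (x : Fin N → ℝ≥0 → Ω → Fin n → ℝ) (i : Fin N) (ω : Ω)
    (t : ℝ≥0) : Fin n → ℝ :=
  𝓜.A *ᵥ x i t ω + 𝓜.B *ᵥ u i ω t (x i t ω) + 𝓜.G *ᵥ ((N : ℝ)⁻¹ • ∑ j, x j t ω) + 𝓜.f t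

/-- `x` is a state trajectory generated by the control laws `u`: a continuous process, adapted to
the completion of the filtration of the noise, with
`x_i(t) = x_i(0) + ∫₀ᵗ (A x_i + B u_i + G x^(N) + f) ds + ∫₀ᵗ σ dW_i`. -/
def IsTrajectory (μ : Measure Ω) (W : Fin N → ℝ≥0 → Ω → ℝ) (x0 : Fin N → Ω → Fin n → ℝ)
    (u : Fin N → ControlLaw Ω n r) (x : Fin N → ℝ≥0 → Ω → Fin n → ℝ) : Prop :=
  (∀ i t, AEStronglyMeasurable[noiseSigma W x0 t] (x i t) μ) ∧
  (∀ i, ∀ᵐ ω ∂μ, Continuous fun t => x i t ω) ∧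
  ∃ M : Fin N → ℝ≥0 → Ω → Fin n → ℝ, (∀ i, IsWienerIntegral μ 𝓜.σ (W i) (M i)) ∧
    ∀ i, ∀ᵐ ω ∂μ, ∀ t : ℝ≥0,
      IntervalIntegrable (fun s : ℝ => 𝓜.drift u x i ω s.toNNReal) volume 0 t ∧
      x i t ω = x0 i ω + (∫ s in (0 : ℝ)..t, 𝓜.drift u x i ω s.toNNReal) + M i t ω

/-- Membership in the decentralized control set along the trajectory `x`: the control `u_i(t)` is
adapted to `σ(x_i(s), s ≤ t)`, and `E ∫₀^∞ e^{-ρ t} ‖u_i(t)‖² dt < ∞`. -/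
def IsAdmissible (μ : Measure Ω) (u : Fin N → ControlLaw Ω n r)
    (x : Fin N → ℝ≥0 → Ω → Fin n → ℝ) : Prop :=
  ∀ i,
    (∀ t, Measurable[⨆ s : Iic t, MeasurableSpace.comap (x i s) inferInstance]
      fun ω => u i ω t (x i t ω)) ∧
    (∫⁻ ω, (∫⁻ t in Ioi (0 : ℝ), ENNReal.ofReal (Real.exp (-𝓜.ρ * t) *
      (u i ω t.toNNReal (x i t.toNNReal ω) ⬝ᵥ u i ω t.toNNReal (x i t.toNNReal ω)))) ∂μ) < ∞

/-- The set of control laws `u` is a representation of the set `v`: both are admissible, they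
generate the same unique (up to indistinguishability) state trajectory, and they have the same
open-loop value on this trajectory. -/
def IsRepresentation (μ : Measure Ω) (W : Fin N → ℝ≥0 → Ω → ℝ) (x0 : Fin N → Ω → Fin n → ℝ)
    (u v : Fin N → ControlLaw Ω n r) : Prop :=
  ∃ x : Fin N → ℝ≥0 → Ω → Fin n → ℝ,
    (𝓜.IsTrajectory μ W x0 u x ∧
      ∀ y, 𝓜.IsTrajectory μ W x0 u y → ∀ᵐ ω ∂μ, ∀ i t, y i t ω = x i t ω) ∧
    (𝓜.IsTrajectory μ W x0 v x ∧
      ∀ y, 𝓜.IsTrajectory μ W x0 v y → ∀ᵐ ω ∂μ, ∀ i t, y i t ω = x i t ω) ∧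
    𝓜.IsAdmissible μ u x ∧ 𝓜.IsAdmissible μ v x ∧
    ∀ᵐ ω ∂μ, ∀ i t, u i ω t (x i t ω) = v i ω t (x i t ω)

/-- The law `x ↦ -R⁻¹ Bᵀ [P x + (P̄ - P) x̄(t) + ŝ(t)]` of every agent. -/
def hatLaw (Ω : Type*) (N : ℕ) (P Pbar : Matrix (Fin n) (Fin n) ℝ) (xbar shat : ℝ → Fin n → ℝ) :
    Fin N → ControlLaw Ω n r :=
  fun _ _ t x => -((𝓜.R⁻¹ * 𝓜.Bᵀ) *ᵥ (P *ᵥ x + (Pbar - P) *ᵥ xbar t + shat t))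

/-- The feedback law `x ↦ -R⁻¹ Bᵀ (P x + s*(t))` of every agent. -/
def starLaw (Ω : Type*) (N : ℕ) (P : Matrix (Fin n) (Fin n) ℝ) (sstar : ℝ → Fin n → ℝ) :
    Fin N → ControlLaw Ω n r :=
  fun _ _ t x => -((𝓜.R⁻¹ * 𝓜.Bᵀ) *ᵥ (P *ᵥ x + sstar t))

end Model

/-- The open-loop controls that record the values of the laws `u` along the given processes `x`. -/
def openLoop {n r N : ℕ} {Ω : Type*} (u : Fin N → ControlLaw Ω n r)
    (x : Fin N → ℝ≥0 → Ω → Fin n → ℝ) : Fin N → ControlLaw Ω n r :=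
  fun i ω t _ => u i ω t (x i t ω)

/-- The laws `u` represent the laws `v`, both when `u` is read as a set of feedback laws and when
it is read as the set of open-loop controls `u_i(t, x_i(t))` along any trajectory `x` that
`u` generates. -/
def Model.Represents {n r N : ℕ} (𝓜 : Model n r) {Ω : Type*} [MeasurableSpace Ω] (μ : Measure Ω)
    (W : Fin N → ℝ≥0 → Ω → ℝ) (x0 : Fin N → Ω → Fin n → ℝ) (u v : Fin N → ControlLaw Ω n r) :
    Prop :=
  𝓜.IsRepresentation μ W x0 u v ∧
  ∀ x, 𝓜.IsTrajectory μ W x0 u x → 𝓜.IsRepresentation μ W x0 (openLoop u x) v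

end

end MeanFieldLQ

namespace MeanFieldLQ

/-! The key is the substitution `s* = K* x̄ + ψ` with `K* = P̄ - P`. Subtracting the two Riccati
equations gives the equation of `K*` (`riccati_sub`), and that equation is what cancels the terms in
`x̄` from `ψ' = (s*)' - K* x̄'`. Since `P x̄ + s* = P̄ x̄ + ψ`, the state equations agree too, so
the two deterministic systems are equivalent (`decoupledSystem_iff`). If the offsets correspond, the
two states solve the same linear equation and coincide, and then both strategies are the same
function of `(t, x)` (`hatLaw_eq_starLaw`). What remains is that one feedback law represents itself,
as a feedback law and as an open-loop control (`represents_starLaw`).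

Uniqueness of trajectories holds because the noise cancels in a difference, leaving a homogeneous
linear integral equation. Existence is pathwise: after subtracting a continuous version of `∫ σ dW`
the equation is an ordinary one. That version is the almost sure limit of dyadic step sums, by
Kolmogorov's maximal inequality and Borel–Cantelli. Admissibility needs discounted square integrable
states. Detectability makes `Ā - (ρ/2) I` Hurwitz (`hurwitz_Abar`), a Lyapunov function turns this
into a discounted `L²` bound, and the noise is compared with its moving average over unit time, so
that only increments over times at most one enter; the Wiener isometry bounds these by `σ`.

For the spectral criterion, the Riccati equation of `P̄` makes `M3` block triangular with blocks `A
- (ρ/2) I - S P̄` and `-H`, where `H = Aᵀ - (ρ/2) I - P̄ S`. The first block is stable, so the `n`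
unstable eigenvalues all belong to `-H`, and `H` is Hurwitz (`hurwitz_of_hasSplitSpectrum`).
Differences of offsets then solve an antistable equation, which has only the zero solution in
`C_{ρ/2}`; a constant offset gives existence. -/

theorem mem_spectrum_iff_exists_mulVec {ι K : Type*} [Fintype ι] [DecidableEq ι] [Field K]
    {N : Matrix ι ι K} {z : K} : z ∈ spectrum K N ↔ ∃ v, v ≠ 0 ∧ N *ᵥ v = z • v := by
  rw [spectrum.mem_iff, Matrix.isUnit_iff_isUnit_det, isUnit_iff_ne_zero, not_not,
    ← Matrix.exists_mulVec_eq_zero_iff]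
  refine exists_congr fun v => and_congr_right fun _ => ?_
  rw [Matrix.sub_mulVec, sub_eq_zero, Matrix.algebraMap_eq_diagonal, eq_comm]
  have : Matrix.diagonal (algebraMap K (ι → K) z) *ᵥ v = z • v := by
    ext i; simp [Matrix.mulVec_diagonal]
  rw [this]

/-! ### Lyapunov functions of Hurwitz matrices. -/

section Decay

attribute [local instance] Matrix.linftyOpNormedRing Matrix.linftyOpNormedAlgebra

/-- Gelfand's formula: the spectral radius lies below some `q < 1`, so eventually `‖N ^ k‖ ≤ q ^ k`.
The entrywise form keeps the operator norm, a local instance, out of later statements. -/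
theorem exists_norm_pow_entry_le {n : ℕ} (N : Matrix (Fin n) (Fin n) ℂ)
    (h : ∀ z ∈ spectrum ℂ N, ‖z‖ < 1) :
    ∃ q : ℝ, 0 ≤ q ∧ q < 1 ∧ ∀ᶠ k : ℕ in atTop, ∀ i j, ‖(N ^ k) i j‖ ≤ q ^ k := by
  rcases isEmpty_or_nonempty (Fin n) with hn | hn
  · exact ⟨0, le_rfl, one_pos, Eventually.of_forall fun k i => (hn.false i).elim⟩
  have h1 : spectralRadius ℂ N < (1 : ℝ≥0) :=
    spectrum.spectralRadius_lt_of_forall_lt N fun z hz => by exact_mod_cast h z hz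
  obtain ⟨q, hq1, hq2⟩ := ENNReal.lt_iff_exists_nnreal_btwn.1 h1
  refine ⟨q, q.2, by exact_mod_cast hq2, ?_⟩
  filter_upwards [(spectrum.pow_nnnorm_pow_one_div_tendsto_nhds_spectralRadius N).eventually_lt_const
    hq1, eventually_gt_atTop 0] with k hk hk0 i j
  have hk' : ‖N ^ k‖₊ ≤ q ^ k := by
    have h2 : ((‖N ^ k‖₊ : ℝ≥0∞) ^ (1 / k : ℝ)) ^ (k : ℝ) ≤ (q : ℝ≥0∞) ^ (k : ℝ) := by gcongr
    rw [← ENNReal.rpow_mul, one_div, inv_mul_cancel₀ (by positivity), ENNReal.rpow_one,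
      ENNReal.rpow_natCast] at h2
    exact_mod_cast h2
  have h3 : ‖(N ^ k) i j‖₊ ≤ ‖N ^ k‖₊ := by
    rw [Matrix.linfty_opNNNorm_def]
    exact (Finset.single_le_sum (f := fun j => ‖(N ^ k) i j‖₊) (fun _ _ => zero_le)
      (Finset.mem_univ j)).trans (Finset.le_sup (f := fun i => ∑ j, ‖(N ^ k) i j‖₊)
        (Finset.mem_univ i))
  exact_mod_cast h3.trans hk'

end Decay

theorem map_ofReal_pow {n : ℕ} (C : Matrix (Fin n) (Fin n) ℝ) (k : ℕ) :
    (C.map Complex.ofReal) ^ k = (C ^ k).map Complex.ofReal :=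
  ((Complex.ofRealHom.mapMatrix (m := Fin n)).map_pow C k).symm

/-- The discrete Lyapunov (Stein) equation of a Schur stable matrix. -/
theorem exists_stein {n : ℕ} (C : Matrix (Fin n) (Fin n) ℝ)
    (h : ∀ z ∈ spectrum ℂ (C.map Complex.ofReal), ‖z‖ < 1) :
    ∃ X : Matrix (Fin n) (Fin n) ℝ, Xᵀ = X ∧ X = 1 + Cᵀ * X * C ∧ ∀ v, v ⬝ᵥ v ≤ v ⬝ᵥ X *ᵥ v := by
  obtain ⟨q, hq0, hq1, hq⟩ := exists_norm_pow_entry_le _ h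
  have hq' : ∀ᶠ k : ℕ in atTop, ∀ i j, |(C ^ k) i j| ≤ q ^ k := by
    filter_upwards [hq] with k hk i j
    simpa [map_ofReal_pow] using hk i j
  -- The solution is `X = ∑ (C ^ k)ᵀ C ^ k`; an entry of the `k`th term is a sum of `n` products,
  -- each eventually at most `q ^ k * q ^ k`.
  have hsum : Summable fun k : ℕ => (C ^ k)ᵀ * C ^ k := by
    refine Pi.summable.2 fun i => Pi.summable.2 fun j => ?_
    refine Summable.of_norm_bounded_eventually_nat (g := fun k => n * (q ^ 2) ^ k)
      ((summable_geometric_of_lt_one (by positivity) (by nlinarith)).mul_left _) ?_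
    filter_upwards [hq'] with k hk
    rw [Matrix.mul_apply]
    refine (norm_sum_le _ _).trans ?_
    refine (Finset.sum_le_card_nsmul _ _ ((q ^ 2) ^ k) fun l _ => ?_).trans (by simp)
    rw [Matrix.transpose_apply, norm_mul, ← pow_mul, mul_comm 2, pow_mul, sq]
    exact mul_le_mul (hk _ _) (hk _ _) (abs_nonneg _) (by positivity)
  have hquad : ∀ v, 0 ≤ v ⬝ᵥ (∑' k : ℕ, (C ^ k)ᵀ * C ^ k) *ᵥ v := by
    intro v
    have hcont : Continuous fun Y : Matrix (Fin n) (Fin n) ℝ => v ⬝ᵥ Y *ᵥ v := by fun_prop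
    refine ge_of_tendsto' ((hcont.tendsto _).comp hsum.hasSum) fun s => ?_
    simp only [Function.comp_apply, Matrix.sum_mulVec, dotProduct_sum]
    refine Finset.sum_nonneg fun k _ => ?_
    rw [← Matrix.mulVec_mulVec, Matrix.dotProduct_mulVec, Matrix.vecMul_transpose]
    exact Finset.sum_nonneg fun i _ => mul_self_nonneg _
  have heq : (∑' k : ℕ, (C ^ k)ᵀ * C ^ k) = 1 + Cᵀ * (∑' k : ℕ, (C ^ k)ᵀ * C ^ k) * C := by
    conv_lhs => rw [hsum.tsum_eq_zero_add]
    have h1 : ∀ k : ℕ, (C ^ (k + 1))ᵀ * C ^ (k + 1) = Cᵀ * ((C ^ k)ᵀ * C ^ k) * C := by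
      intro k
      rw [pow_succ, Matrix.transpose_mul]
      simp only [Matrix.mul_assoc]
    simp only [h1, pow_zero, Matrix.transpose_one, mul_one]
    rw [(hsum.mul_left Cᵀ).tsum_mul_right, hsum.tsum_mul_left]
  refine ⟨_, ?_, heq, fun v => ?_⟩
  · rw [Matrix.transpose_tsum]
    simp
  · conv_rhs => rw [heq]
    have := hquad (C *ᵥ v)
    rw [Matrix.add_mulVec, Matrix.one_mulVec, dotProduct_add, ← Matrix.mulVec_mulVec,
      ← Matrix.mulVec_mulVec, Matrix.dotProduct_mulVec v Cᵀ, Matrix.vecMul_transpose]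
    linarith


theorem exists_mulVec_dotProduct_le {ι κ : Type*} [Fintype ι] [Fintype κ] (M : Matrix ι κ ℝ) :
    ∃ K : ℝ, 0 < K ∧ ∀ v, (M *ᵥ v) ⬝ᵥ (M *ᵥ v) ≤ K * (v ⬝ᵥ v) := by
  refine ⟨∑ i, ∑ j, M i j ^ 2 + 1, by positivity, fun v => ?_⟩
  have hv : 0 ≤ v ⬝ᵥ v := Finset.sum_nonneg fun i _ => mul_self_nonneg _
  have : (M *ᵥ v) ⬝ᵥ (M *ᵥ v) ≤ (∑ i, ∑ j, M i j ^ 2) * (v ⬝ᵥ v) := by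
    rw [Finset.sum_mul]
    refine Finset.sum_le_sum fun i _ => ?_
    have := Finset.sum_mul_sq_le_sq_mul_sq Finset.univ (M i) v
    simp only [Matrix.mulVec, dotProduct] at this ⊢
    simpa [sq] using this
  linarith

theorem isUnit_det_one_sub_of_hurwitz {n : ℕ} {M : Matrix (Fin n) (Fin n) ℝ} (hM : Hurwitz M)
    {c : ℝ} (hc : 0 ≤ c) : IsUnit (c • 1 - M).det := by
  rw [isUnit_iff_ne_zero]
  intro h0
  obtain ⟨v, hv, hv0⟩ := Matrix.exists_mulVec_eq_zero_iff.2 h0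
  rw [Matrix.sub_mulVec, Matrix.smul_mulVec, Matrix.one_mulVec, sub_eq_zero] at hv0
  have := hM c (mem_spectrum_iff_exists_mulVec.2 ⟨fun i => (v i : ℂ), ?_, ?_⟩)
  · simp at this; linarith
  · intro h
    exact hv (funext fun i => by simpa using congrFun h i)
  · ext i
    have h1 := congrFun hv0 i
    simp only [Matrix.mulVec, dotProduct, Matrix.map_apply, Pi.smul_apply, smul_eq_mul] at h1 ⊢
    rw [← Complex.ofReal_mul, h1]
    push_cast
    rfl

/-- An eigenvector `w = (1 - M) v` of the Cayley transform for `z` satisfies `(z + 1) M v = (z - 1)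
v`. Here `z = -1` would force `v = 0`, so `(z - 1) / (z + 1)` is an eigenvalue of `M`, and its real
part has the sign of `|z|² - 1`. -/
theorem norm_lt_one_of_mem_spectrum_cayley {n : ℕ} {M : Matrix (Fin n) (Fin n) ℝ}
    (hM : Hurwitz M) {z : ℂ}
    (hz : z ∈ spectrum ℂ (((1 + M) * (1 - M)⁻¹).map Complex.ofReal)) : ‖z‖ < 1 := by
  have hD : IsUnit (1 - M).det := by simpa using isUnit_det_one_sub_of_hurwitz hM zero_le_one
  obtain ⟨w, hw, hzw⟩ := mem_spectrum_iff_exists_mulVec.1 hz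
  set φ : Matrix (Fin n) (Fin n) ℝ →+* Matrix (Fin n) (Fin n) ℂ := Complex.ofRealHom.mapMatrix
  change φ ((1 + M) * (1 - M)⁻¹) *ᵥ w = z • w at hzw
  rw [map_mul, ← Matrix.mulVec_mulVec, map_add, map_one] at hzw
  set v := φ (1 - M)⁻¹ *ᵥ w with hv
  have hwv : w = v - φ M *ᵥ v := by
    have : φ (1 - M) *ᵥ v = w := by
      rw [hv, Matrix.mulVec_mulVec, ← map_mul, Matrix.mul_nonsing_inv _ hD, map_one,
        Matrix.one_mulVec]
    rw [← this, map_sub, map_one, Matrix.sub_mulVec, Matrix.one_mulVec]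
  have hv0 : v ≠ 0 := by
    intro h; rw [h] at hwv; simp at hwv; exact hw hwv
  rw [hwv, Matrix.add_mulVec, Matrix.one_mulVec, smul_sub] at hzw
  have h1 : (z + 1) • (φ M *ᵥ v) = (z - 1) • v := by
    have : φ M *ᵥ v = z • v - z • φ M *ᵥ v - v := by rw [← hzw]; abel
    rw [add_smul, one_smul]
    nth_rewrite 2 [this]
    rw [sub_smul, one_smul]; abel
  have hz1 : z + 1 ≠ 0 := by
    intro h0
    have : z = -1 := by linear_combination h0
    rw [h0, zero_smul, this] at h1
    have h2 : (-1 - 1 : ℂ) ≠ 0 := by norm_num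
    exact hv0 ((smul_eq_zero.1 h1.symm).resolve_left h2)
  have h2 : φ M *ᵥ v = ((z - 1) / (z + 1)) • v := by
    rw [div_eq_inv_mul, mul_smul, ← h1, smul_smul, inv_mul_cancel₀ hz1, one_smul]
  have h3 := hM _ (mem_spectrum_iff_exists_mulVec.2 ⟨v, hv0, h2⟩)
  have hpos : 0 < Complex.normSq (z + 1) := Complex.normSq_pos.2 hz1
  rw [Complex.div_re, ← add_div, div_neg_iff] at h3
  have h4 := (h3.resolve_left fun h => by linarith [h.2]).1
  simp at h4
  have h5 : ‖z‖ ^ 2 < 1 := by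
    rw [Complex.sq_norm, Complex.normSq_apply]; nlinarith
  nlinarith [norm_nonneg z]

/-- A Lyapunov function of a Hurwitz matrix. -/
theorem Hurwitz.exists_lyapunov {n : ℕ} {M : Matrix (Fin n) (Fin n) ℝ} (hM : Hurwitz M) :
    ∃ X : Matrix (Fin n) (Fin n) ℝ, Xᵀ = X ∧ (∀ v, v ⬝ᵥ v ≤ v ⬝ᵥ X *ᵥ v) ∧
      ∃ c : ℝ, 0 < c ∧ ∀ v, 2 * (v ⬝ᵥ X *ᵥ (M *ᵥ v)) ≤ -c * (v ⬝ᵥ v) := by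
  -- Use the Stein solution `X` of the Cayley transform `C` of `M`. For `w = (1 - M) v` one has `C w
  -- = (1 + M) v`, and the Stein identity at `w` expands to `-4 v ⬝ X M v = w ⬝ w`. As `v ⬝ v ≤ K (w
  -- ⬝ w)`, the rate `1 / (2 K)` results.
  obtain ⟨X, hX, hXC, hX1⟩ := exists_stein _ fun z => norm_lt_one_of_mem_spectrum_cayley hM (z := z)
  have hD : IsUnit (1 - M).det := by simpa using isUnit_det_one_sub_of_hurwitz hM zero_le_one
  obtain ⟨K, hK, hKv⟩ := exists_mulVec_dotProduct_le (1 - M)⁻¹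
  refine ⟨X, hX, hX1, 1 / (2 * K), by positivity, fun v => ?_⟩
  have hsymm : ∀ a b, a ⬝ᵥ X *ᵥ b = b ⬝ᵥ X *ᵥ a := by
    intro a b
    rw [Matrix.dotProduct_mulVec, ← Matrix.mulVec_transpose, hX, dotProduct_comm]
  set w := v - M *ᵥ v with hw
  have hwD : (1 - M) *ᵥ v = w := by rw [Matrix.sub_mulVec, Matrix.one_mulVec]
  have hDw : (1 - M)⁻¹ *ᵥ w = v := by
    rw [← hwD, Matrix.mulVec_mulVec, Matrix.nonsing_inv_mul _ hD, Matrix.one_mulVec]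
  have hCw : ((1 + M) * (1 - M)⁻¹) *ᵥ w = v + M *ᵥ v := by
    rw [← Matrix.mulVec_mulVec, hDw, Matrix.add_mulVec, Matrix.one_mulVec]
  have h1 : w ⬝ᵥ X *ᵥ w = w ⬝ᵥ w + (v + M *ᵥ v) ⬝ᵥ X *ᵥ (v + M *ᵥ v) := by
    nth_rewrite 1 [hXC]
    rw [Matrix.add_mulVec, Matrix.one_mulVec, dotProduct_add, ← Matrix.mulVec_mulVec, hCw,
      ← Matrix.mulVec_mulVec, Matrix.dotProduct_mulVec w, Matrix.vecMul_transpose, hCw]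
  have h2 : v ⬝ᵥ v ≤ K * (w ⬝ᵥ w) := by simpa [hDw] using hKv w
  have h3 : -4 * (v ⬝ᵥ X *ᵥ (M *ᵥ v)) = w ⬝ᵥ w := by
    have h4 := hsymm (M *ᵥ v) v
    nth_rewrite 1 [hw] at h1
    nth_rewrite 1 [hw] at h1
    simp only [Matrix.mulVec_sub, Matrix.mulVec_add, dotProduct_sub, dotProduct_add,
      sub_dotProduct, add_dotProduct] at h1
    linarith
  have h5 : 1 / (2 * K) * (v ⬝ᵥ v) ≤ 1 / 2 * (w ⬝ᵥ w) := by
    rw [div_mul_eq_mul_div, one_mul, div_le_iff₀ (by positivity)]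
    linarith
  linarith

/-- Eigenvalues of a real matrix through real and imaginary parts of an eigenvector. -/
theorem mem_spectrum_map_ofReal_iff {n : ℕ} {M : Matrix (Fin n) (Fin n) ℝ} {z : ℂ} :
    z ∈ spectrum ℂ (M.map Complex.ofReal) ↔ ∃ a b : Fin n → ℝ, (a ≠ 0 ∨ b ≠ 0) ∧
      M *ᵥ a = z.re • a - z.im • b ∧ M *ᵥ b = z.im • a + z.re • b := by
  have key : ∀ v : Fin n → ℂ, M.map Complex.ofReal *ᵥ v = z • v ↔
      M *ᵥ (fun i => (v i).re) = z.re • (fun i => (v i).re) - z.im • (fun i => (v i).im) ∧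
      M *ᵥ (fun i => (v i).im) = z.im • (fun i => (v i).re) + z.re • (fun i => (v i).im) := by
    intro v
    simp only [funext_iff, Complex.ext_iff, ← forall_and]
    refine forall_congr' fun i => ?_
    simp [Matrix.mulVec, dotProduct, Complex.re_sum, Complex.im_sum, add_comm]
  rw [mem_spectrum_iff_exists_mulVec]
  constructor
  · rintro ⟨v, hv, h⟩
    refine ⟨_, _, ?_, (key v).1 h⟩
    by_contra! hc
    exact hv (funext fun i => Complex.ext (congrFun hc.1 i) (congrFun hc.2 i))
  · rintro ⟨a, b, hab, h⟩
    refine ⟨fun i => ⟨a i, b i⟩, ?_, (key _).2 h⟩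
    intro h0
    have h1 : ∀ i, a i = 0 ∧ b i = 0 := fun i => by
      simpa [Complex.ext_iff] using congrFun h0 i
    exact hab.elim (fun h => h (funext fun i => (h1 i).1)) fun h => h (funext fun i => (h1 i).2)

/-! ### Riccati equations and the spectrum of `M3`. -/

namespace Model

variable {n r : ℕ} {𝓜 : Model n r} {P Pbar : Matrix (Fin n) (Fin n) ℝ}

theorem S_transpose (hR : 𝓜.R.PosDef) : 𝓜.Sᵀ = 𝓜.S := by
  have hRt : 𝓜.Rᵀ = 𝓜.R := by simpa using hR.isHermitian.eq
  simp only [S, Matrix.transpose_mul, Matrix.transpose_transpose, Matrix.transpose_nonsing_inv, hRt,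
    Matrix.mul_assoc]

theorem Abar_transpose (hR : 𝓜.R.PosDef) (hP : P.PosSemidef) :
    (𝓜.Abar P)ᵀ = 𝓜.Aᵀ - P * 𝓜.S := by
  have hPt : Pᵀ = P := by simpa using hP.isHermitian.eq
  rw [Abar, Matrix.transpose_sub, Matrix.transpose_mul, S_transpose hR, hPt]

/-- Symmetry of `P` and `S` gives `Āᵀ = Aᵀ - P S`. With `K = P̄ - P`, the quadratic terms differ by
`P̄ S P̄ - P S P = K S P + P S K + K S K`; the mixed terms turn `A` into `Ā`, and `Q` cancels up to
`-Q Γ`. -/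
theorem riccati_sub (hR : 𝓜.R.PosDef) (hP : P.PosSemidef) (hPeq : 𝓜.Riccati P)
    (hPbar : 𝓜.GameRiccati Pbar) :
    𝓜.ρ • (Pbar - P) = (Pbar - P) * 𝓜.Abar P + (𝓜.Abar P)ᵀ * (Pbar - P)
      - (Pbar - P) * 𝓜.S * (Pbar - P) - 𝓜.Q * 𝓜.Γ := by
  rw [Abar_transpose hR hP, smul_sub, hPeq, hPbar, Abar]
  noncomm_ring

/-- The form `v ⬝ S v` is that of `R⁻¹ > 0` at `Bᵀ v`, so a nonpositive value forces `Bᵀ v = 0`. -/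
theorem mulVec_S_eq_zero (hR : 𝓜.R.PosDef) {v : Fin n → ℝ} (h : v ⬝ᵥ 𝓜.S *ᵥ v ≤ 0) :
    𝓜.S *ᵥ v = 0 := by
  have h1 : v ⬝ᵥ 𝓜.S *ᵥ v = (𝓜.Bᵀ *ᵥ v) ⬝ᵥ 𝓜.R⁻¹ *ᵥ (𝓜.Bᵀ *ᵥ v) := by
    rw [S, ← Matrix.mulVec_mulVec, ← Matrix.mulVec_mulVec, Matrix.dotProduct_mulVec v,
      Matrix.mulVec_transpose]
  have h2 : 𝓜.Bᵀ *ᵥ v = 0 := by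
    by_contra h0
    have := hR.inv.dotProduct_mulVec_pos h0
    simp only [star_trivial] at this
    linarith
  rw [S, ← Matrix.mulVec_mulVec, h2, Matrix.mulVec_zero]

theorem dotProduct_mulVec_S_nonneg (hR : 𝓜.R.PosDef) (v : Fin n → ℝ) :
    0 ≤ v ⬝ᵥ 𝓜.S *ᵥ v := by
  rcases le_total 0 (v ⬝ᵥ 𝓜.S *ᵥ v) with h | h
  · exact h
  · rw [mulVec_S_eq_zero hR h]; simp

/-- The optimally controlled drift is stable after discounting. -/
theorem hurwitz_Abar (hR : 𝓜.R.PosDef) (hSD : 𝓜.StabilizableDetectable) (hP : P.PosSemidef)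
    (hPeq : 𝓜.Riccati P) : Hurwitz (𝓜.Abar P - (𝓜.ρ / 2) • 1) := by
  obtain ⟨-, -, C, hC, hCQ, L, hL⟩ := hSD
  have hPt : Pᵀ = P := by simpa using hP.isHermitian.eq
  have hCt : Cᵀ = C := by simpa using hC.isHermitian.eq
  intro z hz
  obtain ⟨a, b, hab, ha, hb⟩ := mem_spectrum_map_ofReal_iff.1 hz
  -- As `P` is only semidefinite it yields no strict decay. Instead the Lyapunov identity forces an
  -- eigenvector with `0 ≤ Re z` into the kernels of `S P` and `C`, where detectability applies.
  by_contra! hre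
  set N := 𝓜.Abar P - (𝓜.ρ / 2) • (1 : Matrix (Fin n) (Fin n) ℝ) with hN
  have hsymm : ∀ a b, a ⬝ᵥ P *ᵥ b = b ⬝ᵥ P *ᵥ a := by
    intro a b
    rw [Matrix.dotProduct_mulVec, ← Matrix.mulVec_transpose, hPt, dotProduct_comm]
  have hlyap : Nᵀ * P + P * N + P * 𝓜.S * P + C * C = 0 := by
    rw [hCQ, hN, Matrix.transpose_sub, Abar_transpose hR hP, Abar]
    have := hPeq
    simp only [Riccati] at this
    simp only [Matrix.transpose_smul, Matrix.transpose_one, sub_mul, mul_sub, Matrix.smul_mul,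
      Matrix.mul_smul, one_mul, mul_one, ← Matrix.mul_assoc]
    have h2 : 𝓜.Q = 𝓜.ρ • P - 𝓜.Aᵀ * P - P * 𝓜.A + P * 𝓜.S * P := by rw [this]; abel
    rw [h2]
    module
  have hquad : ∀ v, 2 * (v ⬝ᵥ P *ᵥ (N *ᵥ v)) + (P *ᵥ v) ⬝ᵥ 𝓜.S *ᵥ (P *ᵥ v)
      + (C *ᵥ v) ⬝ᵥ (C *ᵥ v) = 0 := by
    intro v
    have h1 : v ⬝ᵥ (Nᵀ * P + P * N + P * 𝓜.S * P + C * C) *ᵥ v = 0 := by rw [hlyap]; simp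
    simp only [Matrix.add_mulVec, ← Matrix.mulVec_mulVec, dotProduct_add] at h1
    rw [Matrix.dotProduct_mulVec v Nᵀ, Matrix.vecMul_transpose, hsymm (N *ᵥ v) v,
      Matrix.dotProduct_mulVec v C, ← Matrix.mulVec_transpose, hCt,
      Matrix.dotProduct_mulVec v P (𝓜.S *ᵥ _), ← Matrix.mulVec_transpose P, hPt] at h1
    linarith
  have hqa := hquad a
  have hqb := hquad b
  have hPa := hP.dotProduct_mulVec_nonneg a
  have hPb := hP.dotProduct_mulVec_nonneg b
  simp only [star_trivial] at hPa hPb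
  have hSa := dotProduct_mulVec_S_nonneg hR (P *ᵥ a)
  have hSb := dotProduct_mulVec_S_nonneg hR (P *ᵥ b)
  have hCa : 0 ≤ (C *ᵥ a) ⬝ᵥ (C *ᵥ a) := Finset.sum_nonneg fun i _ => mul_self_nonneg _
  have hCb : 0 ≤ (C *ᵥ b) ⬝ᵥ (C *ᵥ b) := Finset.sum_nonneg fun i _ => mul_self_nonneg _
  have hba := hsymm b a
  rw [ha] at hqa
  rw [hb] at hqb
  simp only [Matrix.mulVec_add, Matrix.mulVec_sub, Matrix.mulVec_smul, dotProduct_add,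
    dotProduct_sub, dotProduct_smul, smul_eq_mul, hba] at hqa hqb
  have hmul := mul_nonneg hre hPa
  have hmul' := mul_nonneg hre hPb
  -- In the sum of `hqa` and `hqb` the terms with `Im z` cancel. Nonnegative terms with sum zero
  -- remain, so each of them vanishes.
  have e1 : 𝓜.S *ᵥ (P *ᵥ a) = 0 := mulVec_S_eq_zero hR (by linarith)
  have e2 : 𝓜.S *ᵥ (P *ᵥ b) = 0 := mulVec_S_eq_zero hR (by linarith)
  have e3 : C *ᵥ a = 0 := dotProduct_self_eq_zero.1 (by linarith)
  have e4 : C *ᵥ b = 0 := dotProduct_self_eq_zero.1 (by linarith)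
  -- On such vectors both the feedback and the output injection vanish, so `z` would be an
  -- eigenvalue of the Hurwitz matrix `A - (ρ/2) I + L C`.
  have hNv : ∀ v, 𝓜.S *ᵥ (P *ᵥ v) = 0 → C *ᵥ v = 0 →
      (𝓜.shiftedA + L * C) *ᵥ v = N *ᵥ v := by
    intro v h1 h2
    have h3 : N = 𝓜.shiftedA - 𝓜.S * P := by rw [hN, Abar, shiftedA]; abel
    rw [h3, Matrix.add_mulVec, Matrix.sub_mulVec, ← Matrix.mulVec_mulVec, ← Matrix.mulVec_mulVec,
      h1, h2, Matrix.mulVec_zero, add_zero, sub_zero]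
  have := hL z (mem_spectrum_map_ofReal_iff.2 ⟨a, b, hab, by rw [hNv a e1 e3, ha],
    by rw [hNv b e2 e4, hb]⟩)
  linarith

/-- The block triangular form of `M₃`. -/
theorem charpoly_M3 (hPbar : 𝓜.GameRiccati Pbar) :
    𝓜.M3.charpoly = (𝓜.shiftedA - 𝓜.S * Pbar).charpoly *
      (-(𝓜.shiftedAᵀ - Pbar * 𝓜.S)).charpoly := by
  -- The first block column of `T` spans the graph of `-P̄`. This graph is invariant under `M3`
  -- because the lower left block after conjugation is the residual of the Riccati equation of `P̄`.
  let T : Matrix (Fin n ⊕ Fin n) (Fin n ⊕ Fin n) ℝ := Matrix.fromBlocks 1 0 (-Pbar) 1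
  let T' : Matrix (Fin n ⊕ Fin n) (Fin n ⊕ Fin n) ℝ := Matrix.fromBlocks 1 0 Pbar 1
  have hT : T * T' = 1 := by simp [T, T', Matrix.fromBlocks_multiply]
  have hc : T' * (𝓜.M3 * T) = Matrix.fromBlocks (𝓜.shiftedA - 𝓜.S * Pbar) 𝓜.S 0
      (-(𝓜.shiftedAᵀ - Pbar * 𝓜.S)) := by
    have h := hPbar
    simp only [GameRiccati] at h
    simp only [T, T', M3, Matrix.fromBlocks_multiply]
    congr 1
    · simp; abel
    · simp
    · have h2 : 𝓜.Q * (1 - 𝓜.Γ) = 𝓜.ρ • Pbar - 𝓜.Aᵀ * Pbar - Pbar * 𝓜.A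
          + Pbar * 𝓜.S * Pbar := by rw [h]; abel
      rw [h2, shiftedA]
      simp only [Matrix.transpose_sub, Matrix.transpose_smul, Matrix.transpose_one, sub_mul,
        mul_sub, Matrix.smul_mul, mul_add, mul_neg, neg_mul, neg_neg, Matrix.mul_smul, one_mul,
        mul_one, ← Matrix.mul_assoc]
      module
    · simp; abel
  rw [← Matrix.charpoly_fromBlocks_zero₂₁ _ 𝓜.S, ← hc, Matrix.charpoly_mul_comm,
    Matrix.mul_assoc, hT, mul_one]

/-- Counting roots: the stable block contributes none with positive real part, so all `n` of these
are roots of the characteristic polynomial of `-H`. That polynomial has degree `n`, hence no other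
roots. -/
theorem hurwitz_of_hasSplitSpectrum (hPbar : 𝓜.IsStabilizingGameSolution Pbar)
    (h : HasSplitSpectrum 𝓜.M3 n n) : Hurwitz (𝓜.shiftedAᵀ - Pbar * 𝓜.S) := by
  classical
  set H := 𝓜.shiftedAᵀ - Pbar * 𝓜.S
  set K := 𝓜.shiftedA - 𝓜.S * Pbar
  have hcp : (𝓜.M3.map Complex.ofReal).charpoly =
      (K.map Complex.ofReal).charpoly * ((-H).map Complex.ofReal).charpoly := by
    have := congrArg (Polynomial.map Complex.ofRealHom) (charpoly_M3 hPbar.1)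
    rw [Polynomial.map_mul, ← Matrix.charpoly_map, ← Matrix.charpoly_map,
      ← Matrix.charpoly_map] at this
    exact this
  have hne : (K.map Complex.ofReal).charpoly * ((-H).map Complex.ofReal).charpoly ≠ 0 :=
    mul_ne_zero (Matrix.charpoly_monic _).ne_zero (Matrix.charpoly_monic _).ne_zero
  have hroots : (𝓜.M3.map Complex.ofReal).charpoly.roots =
      (K.map Complex.ofReal).charpoly.roots + ((-H).map Complex.ofReal).charpoly.roots := by
    rw [hcp, Polynomial.roots_mul hne]
  have hK : (K.map Complex.ofReal).charpoly.roots.filter (fun z => 0 < z.re) = 0 := by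
    rw [Multiset.filter_eq_nil]
    intro z hz
    have := hPbar.2 z (Matrix.mem_spectrum_iff_isRoot_charpoly.2 (Polynomial.isRoot_of_mem_roots hz))
    linarith
  have hcard : Multiset.card ((-H).map Complex.ofReal).charpoly.roots = n := by
    rw [← (IsAlgClosed.splits _).natDegree_eq_card_roots, Matrix.charpoly_natDegree_eq_dim]
    simp
  have hpos : ∀ z ∈ ((-H).map Complex.ofReal).charpoly.roots, 0 < z.re := by
    have h2 := h.2
    rw [hroots, Multiset.filter_add, hK, zero_add] at h2
    refine Multiset.filter_eq_self.1 (Multiset.eq_of_le_of_card_le (Multiset.filter_le _ _) ?_)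
    rw [hcard]
    convert h2.ge
  intro z hz
  obtain ⟨a, b, hab, ha, hb⟩ := mem_spectrum_map_ofReal_iff.1 hz
  have hz' : -z ∈ spectrum ℂ ((-H).map Complex.ofReal) := by
    refine mem_spectrum_map_ofReal_iff.2 ⟨a, b, hab, ?_, ?_⟩
    · rw [Matrix.neg_mulVec, ha, Complex.neg_re, Complex.neg_im]; module
    · rw [Matrix.neg_mulVec, hb, Complex.neg_re, Complex.neg_im]; module
  have := hpos _ ((Polynomial.mem_roots (Matrix.charpoly_monic _).ne_zero).2
    (Matrix.mem_spectrum_iff_isRoot_charpoly.1 hz'))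
  simpa using this

end Model

/-! ### Linear differential equations and discounted stability. -/

section LinearODE

variable {V : Type*} [NormedAddCommGroup V] [NormedSpace ℝ V]

/-- The variation of constants formula for `y' = L y + F`, `y 0 = y0`. -/
noncomputable def linearFlow (L : V →L[ℝ] V) (F : ℝ → V) (y0 : V) (t : ℝ) : V :=
  NormedSpace.exp (t • L) (y0 + ∫ s in (0 : ℝ)..t, NormedSpace.exp ((-s) • L) (F s))

theorem linearFlow_zero (L : V →L[ℝ] V) (F : ℝ → V) (y0 : V) : linearFlow L F y0 0 = y0 := by
  simp [linearFlow]

theorem eqOn_of_linear_ode (L : V →L[ℝ] V) {F y z : ℝ → V} (h0 : y 0 = z 0)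
    (hy : ∀ t, 0 ≤ t → HasDerivWithinAt y (L (y t) + F t) (Ici 0) t)
    (hz : ∀ t, 0 ≤ t → HasDerivWithinAt z (L (z t) + F t) (Ici 0) t) {t : ℝ} (ht : 0 ≤ t) :
    y t = z t := by
  have hc : ∀ {x : ℝ → V}, (∀ t, 0 ≤ t → HasDerivWithinAt x (L (x t) + F t) (Ici 0) t) →
      ContinuousOn x (Icc 0 t) := fun h s hs =>
    ((h s hs.1).continuousWithinAt).mono Icc_subset_Ici_self
  refine ODE_solution_unique (v := fun t x => L x + F t) (K := ‖L‖₊) (fun s => ?_) (hc hy)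
    (fun s hs => (hy s hs.1).mono (Ici_subset_Ici.2 hs.1)) (hc hz)
    (fun s hs => (hz s hs.1).mono (Ici_subset_Ici.2 hs.1)) h0 ⟨ht, le_rfl⟩
  refine LipschitzWith.of_dist_le_mul fun a b => ?_
  rw [dist_add_right, dist_eq_norm, ← map_sub, dist_eq_norm]
  exact L.le_opNorm _

variable [CompleteSpace V]

theorem continuous_exp_neg_smul_apply (L : V →L[ℝ] V) {F : ℝ → V} (hF : Continuous F) :
    Continuous fun s : ℝ => NormedSpace.exp ((-s) • L) (F s) := by
  have : Continuous fun s : ℝ => NormedSpace.exp ((-s) • L) :=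
    (continuous_iff_continuousAt.2 fun t => (hasDerivAt_exp_smul_const L t).continuousAt).comp
      continuous_neg
  exact this.clm_apply hF

theorem hasDerivAt_linearFlow (L : V →L[ℝ] V) {F : ℝ → V} (hF : Continuous F) (y0 : V) (t : ℝ) :
    HasDerivAt (linearFlow L F y0) (L (linearFlow L F y0 t) + F t) t := by
  have h1 : HasDerivAt (fun t : ℝ => NormedSpace.exp (t • L)) (L * NormedSpace.exp (t • L)) t :=
    hasDerivAt_exp_smul_const' L t
  have h2 := (((continuous_exp_neg_smul_apply L hF).integral_hasStrictDerivAt 0 t).hasDerivAt).const_add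
    y0
  convert! h1.clm_apply h2 using 1
  have h3 : NormedSpace.exp (t • L) * NormedSpace.exp ((-t) • L) = 1 := by
    let _ : NormedAlgebra ℚ (V →L[ℝ] V) := NormedAlgebra.restrictScalars ℚ ℝ _
    rw [← NormedSpace.exp_add_of_commute, ← add_smul, add_neg_cancel, zero_smul,
      NormedSpace.exp_zero]
    exact ((Commute.refl L).smul_left t).smul_right (-t)
  have h4 : NormedSpace.exp (t • L) (NormedSpace.exp ((-t) • L) (F t)) = F t := by
    simpa using DFunLike.congr_fun h3 (F t)
  rw [h4]
  rfl

end LinearODE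

section Quadratic

variable {ι κ : Type*} [Fintype ι] [Fintype κ]

theorem dotProduct_self_nonneg' (v : ι → ℝ) : 0 ≤ v ⬝ᵥ v :=
  Finset.sum_nonneg fun _ _ => mul_self_nonneg _

theorem dotProduct_self_add_le (v w : ι → ℝ) :
    (v + w) ⬝ᵥ (v + w) ≤ 2 * (v ⬝ᵥ v) + 2 * (w ⬝ᵥ w) := by
  have := dotProduct_self_nonneg' (v - w)
  simp only [dotProduct_add, add_dotProduct, dotProduct_sub, sub_dotProduct] at *
  linarith

/-- Expand `0 ≤ c⁻¹ ‖c v - w‖²`. -/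
theorem two_mul_dotProduct_le {c : ℝ} (hc : 0 < c) (v w : ι → ℝ) :
    2 * (v ⬝ᵥ w) ≤ c * (v ⬝ᵥ v) + c⁻¹ * (w ⬝ᵥ w) := by
  have h := dotProduct_self_nonneg' (c • v - w)
  simp only [dotProduct_sub, sub_dotProduct, dotProduct_smul, smul_dotProduct, smul_eq_mul,
    dotProduct_comm w v] at h
  have h2 := mul_nonneg (inv_nonneg.2 hc.le) h
  have h3 : c⁻¹ * (c * (c * (v ⬝ᵥ v) - v ⬝ᵥ w) - (c * (v ⬝ᵥ w) - w ⬝ᵥ w)) =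
      c * (v ⬝ᵥ v) + c⁻¹ * (w ⬝ᵥ w) - 2 * (v ⬝ᵥ w) := by
    field_simp
    ring
  linarith

theorem continuousOn_dotProduct {f g : ℝ → ι → ℝ} {s : Set ℝ} (hf : ContinuousOn f s)
    (hg : ContinuousOn g s) : ContinuousOn (fun t => f t ⬝ᵥ g t) s :=
  continuousOn_finsetSum _ fun i _ => (continuousOn_pi.1 hf i).mul (continuousOn_pi.1 hg i)

theorem hasDerivWithinAt_mulVec (M : Matrix κ ι ℝ) {z : ℝ → ι → ℝ} {z' : ι → ℝ} {s : Set ℝ}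
    {t : ℝ} (hz : HasDerivWithinAt z z' s t) :
    HasDerivWithinAt (fun t => M *ᵥ z t) (M *ᵥ z') s t :=
  (LinearMap.toContinuousLinearMap M.mulVecLin).hasFDerivAt.comp_hasDerivWithinAt t hz

theorem hasDerivWithinAt_dotProduct {y z : ℝ → ι → ℝ} {y' z' : ι → ℝ} {s : Set ℝ} {t : ℝ}
    (hy : HasDerivWithinAt y y' s t) (hz : HasDerivWithinAt z z' s t) :
    HasDerivWithinAt (fun t => y t ⬝ᵥ z t) (y' ⬝ᵥ z t + y t ⬝ᵥ z') s t := by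
  simp only [dotProduct, ← Finset.sum_add_distrib]
  exact HasDerivWithinAt.fun_sum fun i _ =>
    (hasDerivWithinAt_pi.1 hy i).mul (hasDerivWithinAt_pi.1 hz i)

/-- Differentiating the weight adds `-ρ z ⬝ X z = 2 z ⬝ X (-(ρ/2) z)`. Discounting thus shifts the
drift by `ρ/2`, which is why the stability conditions concern `A - (ρ/2) I`. -/
theorem hasDerivWithinAt_discounted_quadratic {n : ℕ} {X : Matrix (Fin n) (Fin n) ℝ} (hX : Xᵀ = X)
    (ρ : ℝ) {z : ℝ → Fin n → ℝ} {z' : Fin n → ℝ} {s : Set ℝ} {t : ℝ}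
    (hz : HasDerivWithinAt z z' s t) :
    HasDerivWithinAt (fun t => Real.exp (-ρ * t) * (z t ⬝ᵥ X *ᵥ z t))
      (Real.exp (-ρ * t) * (2 * (z t ⬝ᵥ X *ᵥ (z' - (ρ / 2) • z t)))) s t := by
  have h1 : HasDerivWithinAt (fun t => Real.exp (-ρ * t)) (Real.exp (-ρ * t) * (-ρ)) s t := by
    simpa using ((hasDerivAt_id t).const_mul (-ρ)).exp.hasDerivWithinAt
  convert! h1.mul (hasDerivWithinAt_dotProduct hz (hasDerivWithinAt_mulVec X hz)) using 1
  have : z' ⬝ᵥ X *ᵥ z t = z t ⬝ᵥ X *ᵥ z' := by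
    rw [Matrix.dotProduct_mulVec, ← Matrix.mulVec_transpose, hX, dotProduct_comm]
  rw [this, Matrix.mulVec_sub, Matrix.mulVec_smul, dotProduct_sub, dotProduct_smul, smul_eq_mul]
  ring

end Quadratic

section Stability

variable {n : ℕ}

/-- Integrate the derivative of `e^{-ρ t} z ⬝ X z` over `[0, T]`. Young's inequality with parameter
`c / 2` splits the cross term `2 z ⬝ X F`, so half of the decay `c` survives and `F` gets the factor
`2 / c * K`. The value at `T` is nonnegative, and the value at `0` is at most `(1 + K) / 2 * (z 0 ⬝
z 0)`. -/
theorem intervalIntegral_le_of_lyapunov {A X : Matrix (Fin n) (Fin n) ℝ} {ρ c K : ℝ}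
    (hX : Xᵀ = X) (hX1 : ∀ v, v ⬝ᵥ v ≤ v ⬝ᵥ X *ᵥ v) (hc : 0 < c)
    (hXc : ∀ v, 2 * (v ⬝ᵥ X *ᵥ ((A - (ρ / 2) • 1) *ᵥ v)) ≤ -c * (v ⬝ᵥ v))
    (hK : ∀ v, (X *ᵥ v) ⬝ᵥ (X *ᵥ v) ≤ K * (v ⬝ᵥ v)) {F z : ℝ → Fin n → ℝ}
    (hF : ContinuousOn F (Ici 0))
    (hz : ∀ t, 0 ≤ t → HasDerivWithinAt z (A *ᵥ z t + F t) (Ici 0) t) {T : ℝ} (hT : 0 ≤ T) :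
    c / 2 * ∫ t in (0 : ℝ)..T, Real.exp (-ρ * t) * (z t ⬝ᵥ z t) ≤
      (1 + K) / 2 * (z 0 ⬝ᵥ z 0) +
        2 / c * K * ∫ t in (0 : ℝ)..T, Real.exp (-ρ * t) * (F t ⬝ᵥ F t) := by
  have hsub : Icc 0 T ⊆ Ici (0 : ℝ) := Icc_subset_Ici_self
  have hzc : ContinuousOn z (Icc 0 T) := fun s hs => ((hz s hs.1).continuousWithinAt).mono hsub
  have hFc : ContinuousOn F (Icc 0 T) := hF.mono hsub
  have hec : Continuous fun t : ℝ => Real.exp (-ρ * t) := by fun_prop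
  have hzz : ContinuousOn (fun t => Real.exp (-ρ * t) * (z t ⬝ᵥ z t)) (Icc 0 T) :=
    hec.continuousOn.mul (continuousOn_dotProduct hzc hzc)
  have hFF : ContinuousOn (fun t => Real.exp (-ρ * t) * (F t ⬝ᵥ F t)) (Icc 0 T) :=
    hec.continuousOn.mul (continuousOn_dotProduct hFc hFc)
  have hmul : ∀ (M : Matrix (Fin n) (Fin n) ℝ) {g : ℝ → Fin n → ℝ}, ContinuousOn g (Icc 0 T) →
      ContinuousOn (fun t => M *ᵥ g t) (Icc 0 T) := fun M g hg =>
    (LinearMap.toContinuousLinearMap M.mulVecLin).continuous.comp_continuousOn hg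
  have hV := fun t ht => hasDerivWithinAt_discounted_quadratic hX ρ (hz t ht)
  have hsc : ContinuousOn (fun t => (ρ / 2) • z t) (Icc 0 T) := hzc.const_smul (ρ / 2)
  have hV'c : ContinuousOn (fun t => Real.exp (-ρ * t) *
      (2 * (z t ⬝ᵥ X *ᵥ (A *ᵥ z t + F t - (ρ / 2) • z t)))) (Icc 0 T) :=
    hec.continuousOn.mul (continuousOn_const.mul (continuousOn_dotProduct hzc (hmul X
      (((hmul A hzc).add hFc).sub hsc))))
  have hftc := intervalIntegral.integral_eq_sub_of_hasDeriv_right (a := 0) (b := T)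
    (f := fun t => Real.exp (-ρ * t) * (z t ⬝ᵥ X *ᵥ z t))
    (f' := fun t => Real.exp (-ρ * t) *
      (2 * (z t ⬝ᵥ X *ᵥ (A *ᵥ z t + F t - (ρ / 2) • z t))))
    (by rw [uIcc_of_le hT]; exact hec.continuousOn.mul (continuousOn_dotProduct hzc (hmul X hzc)))
    (fun t ht => by
      rw [min_eq_left hT] at ht
      exact (hV t ht.1.le).mono (Ioi_subset_Ici ht.1.le))
    (ContinuousOn.intervalIntegrable (by rwa [uIcc_of_le hT]))
  have hle : ∫ t in (0 : ℝ)..T, c / 2 * (Real.exp (-ρ * t) * (z t ⬝ᵥ z t)) ≤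
      ∫ t in (0 : ℝ)..T, (2 / c * K * (Real.exp (-ρ * t) * (F t ⬝ᵥ F t)) - Real.exp (-ρ * t) *
      (2 * (z t ⬝ᵥ X *ᵥ (A *ᵥ z t + F t - (ρ / 2) • z t)))) := by
    refine intervalIntegral.integral_mono_on hT ?_ ?_ fun t ht => ?_
    · exact ContinuousOn.intervalIntegrable (by rw [uIcc_of_le hT]; exact continuousOn_const.mul hzz)
    · exact ContinuousOn.intervalIntegrable (by
        rw [uIcc_of_le hT]; exact (continuousOn_const.mul hFF).sub hV'c)
    · have h1 := hXc (z t)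
      have h2 := two_mul_dotProduct_le (half_pos hc) (z t) (X *ᵥ F t)
      have h3 : (c / 2)⁻¹ * ((X *ᵥ F t) ⬝ᵥ (X *ᵥ F t)) ≤ 2 / c * K * (F t ⬝ᵥ F t) := by
        rw [inv_div, mul_assoc]
        exact mul_le_mul_of_nonneg_left (hK _) (by positivity)
      have h4 : A *ᵥ z t + F t - (ρ / 2) • z t = (A - (ρ / 2) • 1) *ᵥ z t + F t := by
        rw [Matrix.sub_mulVec, Matrix.smul_mulVec, Matrix.one_mulVec]; abel
      rw [h4, Matrix.mulVec_add, dotProduct_add]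
      have h5 := mul_le_mul_of_nonneg_left
        (show c / 2 * (z t ⬝ᵥ z t) ≤ 2 / c * K * (F t ⬝ᵥ F t) - 2 * (z t ⬝ᵥ X *ᵥ
          ((A - (ρ / 2) • 1) *ᵥ z t) + z t ⬝ᵥ X *ᵥ F t) by linarith) (Real.exp_pos (-ρ * t)).le
      linarith
  rw [intervalIntegral.integral_sub, hftc, intervalIntegral.integral_const_mul,
    intervalIntegral.integral_const_mul] at hle
  · have h1 := two_mul_dotProduct_le one_pos (z 0) (X *ᵥ z 0)
    have h2 := hK (z 0)
    have h3 : 0 ≤ Real.exp (-ρ * T) * (z T ⬝ᵥ X *ᵥ z T) :=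
      mul_nonneg (Real.exp_pos _).le ((dotProduct_self_nonneg' _).trans (hX1 _))
    simp only [mul_zero, Real.exp_zero, one_mul, inv_one] at hle h1
    linarith
  · exact ContinuousOn.intervalIntegrable (by rw [uIcc_of_le hT]; exact continuousOn_const.mul hFF)
  · exact ContinuousOn.intervalIntegrable (by rwa [uIcc_of_le hT])

theorem lintegral_Ioc_ofReal {f : ℝ → ℝ} {T : ℝ} (hT : 0 ≤ T) (hf : ContinuousOn f (Icc 0 T))
    (h0 : ∀ t, 0 ≤ f t) :
    ∫⁻ t in Ioc 0 T, ENNReal.ofReal (f t) = ENNReal.ofReal (∫ t in (0 : ℝ)..T, f t) := by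
  rw [intervalIntegral.integral_of_le hT, ofReal_integral_eq_lintegral_ofReal]
  · exact (hf.integrableOn_Icc).mono_set Ioc_subset_Icc_self
  · exact Eventually.of_forall h0

theorem lintegral_Ioi_le_of_forall_Ioc {f : ℝ → ℝ≥0∞} {b : ℝ≥0∞}
    (h : ∀ T : ℝ, 0 ≤ T → ∫⁻ t in Ioc 0 T, f t ≤ b) : ∫⁻ t in Ioi 0, f t ≤ b := by
  have hU : Ioi (0 : ℝ) = ⋃ k : ℕ, Ioc 0 (k : ℝ) := by
    ext t
    simp only [mem_Ioi, mem_iUnion, mem_Ioc]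
    exact ⟨fun ht => (exists_nat_ge t).imp fun k hk => ⟨ht, hk⟩, fun ⟨k, hk⟩ => hk.1⟩
  rw [hU, setLIntegral_iUnion_of_directed]
  · exact iSup_le fun k => h k k.cast_nonneg
  · exact Monotone.directed_le fun i j hij => Ioc_subset_Ioc_right (by exact_mod_cast hij)

/-- Discounted mean square stability: square integrable forcing of a stable linear equation has a
square integrable response. -/
theorem Hurwitz.exists_lintegral_le {A : Matrix (Fin n) (Fin n) ℝ} {ρ : ℝ}
    (hA : Hurwitz (A - (ρ / 2) • 1)) :
    ∃ C : ℝ≥0, ∀ F z : ℝ → Fin n → ℝ, ContinuousOn F (Ici 0) →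
      (∀ t, 0 ≤ t → HasDerivWithinAt z (A *ᵥ z t + F t) (Ici 0) t) →
      ∫⁻ t in Ioi (0 : ℝ), ENNReal.ofReal (Real.exp (-ρ * t) * (z t ⬝ᵥ z t)) ≤
        C * (ENNReal.ofReal (z 0 ⬝ᵥ z 0) +
          ∫⁻ t in Ioi (0 : ℝ), ENNReal.ofReal (Real.exp (-ρ * t) * (F t ⬝ᵥ F t))) := by
  obtain ⟨X, hX, hX1, c, hc, hXc⟩ := hA.exists_lyapunov
  obtain ⟨K, hK0, hK⟩ := exists_mulVec_dotProduct_le X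
  -- Divide the energy estimate by `c / 2` and bound each of its two coefficients by their sum.
  set D : ℝ := 2 / c * ((1 + K) / 2 + 2 / c * K) with hD
  have hD0 : 0 ≤ D := by positivity
  refine ⟨D.toNNReal, fun F z hF hz => lintegral_Ioi_le_of_forall_Ioc fun T hT => ?_⟩
  have hzc : ContinuousOn z (Icc 0 T) := fun s hs =>
    ((hz s hs.1).continuousWithinAt).mono Icc_subset_Ici_self
  have hFc : ContinuousOn F (Icc 0 T) := hF.mono Icc_subset_Ici_self
  have hec : Continuous fun t : ℝ => Real.exp (-ρ * t) := by fun_prop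
  have hFint : 0 ≤ ∫ t in (0 : ℝ)..T, Real.exp (-ρ * t) * (F t ⬝ᵥ F t) :=
    intervalIntegral.integral_nonneg hT fun t _ =>
      mul_nonneg (Real.exp_pos _).le (dotProduct_self_nonneg' _)
  have hcont : ∀ {g : ℝ → Fin n → ℝ}, ContinuousOn g (Icc 0 T) →
      ContinuousOn (fun t => Real.exp (-ρ * t) * (g t ⬝ᵥ g t)) (Icc 0 T) := fun hg =>
    hec.continuousOn.mul (continuousOn_dotProduct hg hg)
  rw [lintegral_Ioc_ofReal hT (hcont hzc) fun t =>
    mul_nonneg (Real.exp_pos _).le (dotProduct_self_nonneg' _)]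
  have h1 := intervalIntegral_le_of_lyapunov hX hX1 hc hXc hK hF hz hT
  have h0 := dotProduct_self_nonneg' (z 0)
  have h2 : ∫ t in (0 : ℝ)..T, Real.exp (-ρ * t) * (z t ⬝ᵥ z t) ≤
      D * (z 0 ⬝ᵥ z 0 + ∫ t in (0 : ℝ)..T, Real.exp (-ρ * t) * (F t ⬝ᵥ F t)) := by
    have h3 := mul_le_mul_of_nonneg_left h1 (show 0 ≤ 2 / c by positivity)
    have h4 : 2 / c * (c / 2 * ∫ t in (0 : ℝ)..T, Real.exp (-ρ * t) * (z t ⬝ᵥ z t)) =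
        ∫ t in (0 : ℝ)..T, Real.exp (-ρ * t) * (z t ⬝ᵥ z t) := by
      rw [← mul_assoc]; field_simp
    rw [h4] at h3
    refine h3.trans ?_
    rw [hD, mul_assoc (2 / c) (_ + _)]
    refine mul_le_mul_of_nonneg_left ?_ (by positivity)
    have h5 : 0 ≤ 2 / c * K * (z 0 ⬝ᵥ z 0) := by positivity
    have h6 := mul_nonneg (show 0 ≤ (1 + K) / 2 by positivity) hFint
    linarith
  calc _ ≤ ENNReal.ofReal (D * (z 0 ⬝ᵥ z 0 +
          ∫ t in (0 : ℝ)..T, Real.exp (-ρ * t) * (F t ⬝ᵥ F t))) := ENNReal.ofReal_le_ofReal h2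
    _ = ENNReal.ofReal D * (ENNReal.ofReal (z 0 ⬝ᵥ z 0) +
          ∫⁻ t in Ioc 0 T, ENNReal.ofReal (Real.exp (-ρ * t) * (F t ⬝ᵥ F t))) := by
        rw [ENNReal.ofReal_mul hD0, ENNReal.ofReal_add h0 hFint,
          lintegral_Ioc_ofReal hT (hcont hFc) fun t =>
            mul_nonneg (Real.exp_pos _).le (dotProduct_self_nonneg' _)]
    _ ≤ _ := by
        rw [ENNReal.ofReal]
        gcongr
        exact Ioc_subset_Ioi_self

/-- An antistable linear equation has no nonzero solution that is square integrable after
discounting. -/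
theorem Hurwitz.eq_zero_of_integrableOn {H : Matrix (Fin n) (Fin n) ℝ} (hH : Hurwitz H) {ρ : ℝ}
    {e : ℝ → Fin n → ℝ}
    (he : ∀ t, 0 ≤ t → HasDerivWithinAt e ((ρ / 2) • e t - H *ᵥ e t) (Ici 0) t)
    (hint : IntegrableOn (fun t => Real.exp (-ρ * t) * (e t ⬝ᵥ e t)) (Ici 0)) {t : ℝ}
    (ht : 0 ≤ t) : e t = 0 := by
  obtain ⟨X, hX, hX1, c, hc, hXc⟩ := hH.exists_lyapunov
  obtain ⟨K, hK0, hK⟩ := exists_mulVec_dotProduct_le X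
  set V : ℝ → ℝ := fun t => Real.exp (-ρ * t) * (e t ⬝ᵥ X *ᵥ e t) with hVdef
  have hV := fun t ht => hasDerivWithinAt_discounted_quadratic hX ρ (he t ht)
  -- Along `e' = (ρ/2) e - H e` the function `V` has derivative at least `c e^{-ρ t} ‖e‖²`. If `V t
  -- > 0`, then `V` stays above `V t`, so the discounted square of `e` is bounded below on `[t, ∞)`
  -- and cannot be integrable.
  have hmono : MonotoneOn V (Ici 0) := by
    refine monotoneOn_of_hasDerivWithinAt_nonneg (convex_Ici 0)
      (fun s hs => (hV s hs).continuousWithinAt)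
      (fun s hs => (hV s (interior_subset hs)).mono interior_subset) fun s hs => ?_
    refine mul_nonneg (Real.exp_pos _).le ?_
    have h1 := hXc (e s)
    have h2 := mul_nonneg hc.le (dotProduct_self_nonneg' (e s))
    rw [show (ρ / 2) • e s - H *ᵥ e s - (ρ / 2) • e s = -(H *ᵥ e s) by abel, Matrix.mulVec_neg,
      dotProduct_neg]
    linarith
  by_contra hne
  have hpos : 0 < V t := by
    refine mul_pos (Real.exp_pos _) (lt_of_lt_of_le ?_ (hX1 _))
    exact lt_of_le_of_ne (dotProduct_self_nonneg' _) fun h =>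
      hne (dotProduct_self_eq_zero.1 h.symm)
  have hbd : ∀ s, t ≤ s → V t ≤ (1 + K) / 2 * (Real.exp (-ρ * s) * (e s ⬝ᵥ e s)) := by
    intro s hs
    refine (hmono ht (ht.trans hs) hs).trans ?_
    have h1 := two_mul_dotProduct_le one_pos (e s) (X *ᵥ e s)
    have h2 := hK (e s)
    have h3 := mul_le_mul_of_nonneg_left (show e s ⬝ᵥ X *ᵥ e s ≤ (1 + K) / 2 * (e s ⬝ᵥ e s) by
      rw [inv_one] at h1; linarith) (Real.exp_pos (-ρ * s)).le
    simp only [hVdef]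
    linarith
  have hi : IntegrableOn (fun _ : ℝ => V t) (Ici t) := by
    refine Integrable.mono' ((hint.mono_set (Ici_subset_Ici.2 ht)).const_mul ((1 + K) / 2))
      aestronglyMeasurable_const ?_
    filter_upwards [ae_restrict_mem measurableSet_Ici] with s hs
    rw [Real.norm_of_nonneg hpos.le]
    exact hbd s hs
  rw [integrableOn_const_iff] at hi
  simp [hpos.ne'] at hi

end Stability

/-! ### The space `C_{ρ/2}` and the two deterministic systems. -/

namespace Model

variable {n r : ℕ} {𝓜 : Model n r} {P Pbar : Matrix (Fin n) (Fin n) ℝ}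

theorem integrableOn_of_lintegral_lt_top {g : ℝ → Fin n → ℝ} (hg : ContinuousOn g (Ici 0))
    (h : ∫⁻ t in Ioi (0 : ℝ), ENNReal.ofReal (Real.exp (-𝓜.ρ * t) * (g t ⬝ᵥ g t)) < ∞) :
    IntegrableOn (fun t => Real.exp (-𝓜.ρ * t) * (g t ⬝ᵥ g t)) (Ici 0) := by
  have hec : Continuous fun t : ℝ => Real.exp (-𝓜.ρ * t) := by fun_prop
  rw [integrableOn_Ici_iff_integrableOn_Ioi]
  refine ⟨((hec.continuousOn.mul (continuousOn_dotProduct hg hg)).mono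
    Ioi_subset_Ici_self).aestronglyMeasurable measurableSet_Ioi, ?_⟩
  rwa [hasFiniteIntegral_iff_ofReal]
  exact Eventually.of_forall fun t => mul_nonneg (Real.exp_pos _).le (dotProduct_self_nonneg' _)

theorem InC.lintegral_lt_top {g : ℝ → Fin n → ℝ} (hg : 𝓜.InC g) :
    ∫⁻ t in Ioi (0 : ℝ), ENNReal.ofReal (Real.exp (-𝓜.ρ * t) * (g t ⬝ᵥ g t)) < ∞ := by
  have h := (hg.2.mono_set Ioi_subset_Ici_self).hasFiniteIntegral
  rwa [hasFiniteIntegral_iff_ofReal] at h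
  exact Eventually.of_forall fun t => mul_nonneg (Real.exp_pos _).le (dotProduct_self_nonneg' _)

theorem InC.of_le {g h : ℝ → Fin n → ℝ} {C : ℝ} (hh : 𝓜.InC h) (hg : ContinuousOn g (Ici 0))
    (hgh : ∀ t, 0 ≤ t → g t ⬝ᵥ g t ≤ C * (h t ⬝ᵥ h t)) : 𝓜.InC g := by
  have hec : Continuous fun t : ℝ => Real.exp (-𝓜.ρ * t) := by fun_prop
  refine ⟨hg, Integrable.mono' (hh.2.const_mul C) ((hec.continuousOn.mul
    (continuousOn_dotProduct hg hg)).aestronglyMeasurable measurableSet_Ici) ?_⟩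
  filter_upwards [ae_restrict_mem measurableSet_Ici] with t ht
  rw [Real.norm_of_nonneg (mul_nonneg (Real.exp_pos _).le (dotProduct_self_nonneg' _)),
    mul_left_comm]
  exact mul_le_mul_of_nonneg_left (hgh t ht) (Real.exp_pos _).le

theorem InC.mulVec {g : ℝ → Fin n → ℝ} (hg : 𝓜.InC g) (M : Matrix (Fin n) (Fin n) ℝ) :
    𝓜.InC fun t => M *ᵥ g t := by
  obtain ⟨K, -, hK⟩ := exists_mulVec_dotProduct_le M
  exact hg.of_le ((LinearMap.toContinuousLinearMap M.mulVecLin).continuous.comp_continuousOn hg.1)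
    fun t _ => hK (g t)

theorem InC.add {g h : ℝ → Fin n → ℝ} (hg : 𝓜.InC g) (hh : 𝓜.InC h) :
    𝓜.InC fun t => g t + h t := by
  have hec : Continuous fun t : ℝ => Real.exp (-𝓜.ρ * t) := by fun_prop
  refine ⟨hg.1.add hh.1, Integrable.mono' ((hg.2.const_mul 2).add (hh.2.const_mul 2))
    ((hec.continuousOn.mul (continuousOn_dotProduct (hg.1.add hh.1)
      (hg.1.add hh.1))).aestronglyMeasurable measurableSet_Ici) (Eventually.of_forall fun t => ?_)⟩
  simp only [Pi.add_apply]
  rw [Real.norm_of_nonneg (mul_nonneg (Real.exp_pos _).le (dotProduct_self_nonneg' _))]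
  have := mul_le_mul_of_nonneg_left (dotProduct_self_add_le (g t) (h t)) (Real.exp_pos (-𝓜.ρ * t)).le
  linarith

theorem InC.sub {g h : ℝ → Fin n → ℝ} (hg : 𝓜.InC g) (hh : 𝓜.InC h) :
    𝓜.InC fun t => g t - h t := by
  have := hg.add (hh.mulVec (-1))
  simpa [Matrix.neg_mulVec, ← sub_eq_add_neg] using this

theorem inC_const (hρ : 0 < 𝓜.ρ) (v : Fin n → ℝ) : 𝓜.InC fun _ => v := by
  refine ⟨continuousOn_const, Integrable.mul_const ?_ _⟩
  exact (integrableOn_Ici_iff_integrableOn_Ioi).2 (exp_neg_integrableOn_Ioi 0 hρ)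

/-- The linear map `v ↦ M v` as a continuous linear map. -/
noncomputable abbrev mulVecCLM (M : Matrix (Fin n) (Fin n) ℝ) :
    (Fin n → ℝ) →L[ℝ] (Fin n → ℝ) :=
  LinearMap.toContinuousLinearMap M.mulVecLin

/-- With `K = P̄ - P` and `ψ = s* - K x̄*`, the state equations match since `P x̄* + s* = P̄ x̄* +
ψ`. In `ψ' = (s*)' - K (x̄*)'` the equation `riccati_sub` of `K` removes every term in `x̄*`. The
space `C_{ρ/2}` is stable under sums and matrices, so membership transfers both ways. -/
theorem decoupledSystem_iff (hR : 𝓜.R.PosDef) (hf : 𝓜.f = 0) (hP : P.PosSemidef)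
    (hPeq : 𝓜.Riccati P) (hPbar : 𝓜.GameRiccati Pbar) (xstar sstar : ℝ → Fin n → ℝ) :
    𝓜.FixedPointSystem P xstar sstar ↔
      𝓜.DecoupledSystem Pbar xstar (fun t => sstar t - (Pbar - P) *ᵥ xstar t) := by
  have hK := riccati_sub hR hP hPeq hPbar
  have hAt := Abar_transpose (𝓜 := 𝓜) hR hP
  set K := Pbar - P with hKdef
  have hPb : Pbar = P + K := by rw [hKdef]; abel
  have hx : ∀ t, 𝓜.Abar P *ᵥ xstar t - 𝓜.S *ᵥ sstar t =
      𝓜.A *ᵥ xstar t - 𝓜.S *ᵥ (Pbar *ᵥ xstar t + (sstar t - K *ᵥ xstar t)) + 𝓜.f t := by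
    intro t
    rw [hf, hPb, Abar]
    simp only [Matrix.sub_mulVec, Matrix.add_mulVec, Matrix.mulVec_add, Matrix.mulVec_sub,
      ← Matrix.mulVec_mulVec, Pi.zero_apply]
    abel
  have hs : ∀ t, 𝓜.ρ • (sstar t - K *ᵥ xstar t)
      - (𝓜.Aᵀ - Pbar * 𝓜.S) *ᵥ (sstar t - K *ᵥ xstar t) - Pbar *ᵥ 𝓜.f t + 𝓜.Q *ᵥ 𝓜.η =
      (𝓜.ρ • sstar t - (𝓜.Abar P)ᵀ *ᵥ sstar t + 𝓜.Q *ᵥ (𝓜.Γ *ᵥ xstar t + 𝓜.η)) -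
        K *ᵥ (𝓜.Abar P *ᵥ xstar t - 𝓜.S *ᵥ sstar t) := by
    intro t
    have h1 : 𝓜.ρ • (K *ᵥ xstar t) = (K * 𝓜.Abar P + (𝓜.Abar P)ᵀ * K - K * 𝓜.S * K
        - 𝓜.Q * 𝓜.Γ) *ᵥ xstar t := by rw [← hK, Matrix.smul_mulVec]
    rw [smul_sub, h1, hf, hAt, hPb]
    simp only [Matrix.sub_mulVec, Matrix.add_mulVec, Matrix.mulVec_add, Matrix.mulVec_sub,
      ← Matrix.mulVec_mulVec, Pi.zero_apply, Matrix.mulVec_zero, add_mul, sub_mul]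
    abel
  constructor
  · rintro ⟨hxC, hsC, h0, hd⟩
    refine ⟨hxC, hsC.sub (hxC.mulVec K), h0, fun t ht => ⟨?_, ?_⟩⟩
    · rw [hs]
      exact (hd t ht).1.sub (hasDerivWithinAt_mulVec K (hd t ht).2)
    · rw [← hx]
      exact (hd t ht).2
  · rintro ⟨hxC, hsC, h0, hd⟩
    have hsC' : 𝓜.InC sstar := by simpa using hsC.add (hxC.mulVec K)
    refine ⟨hxC, hsC', h0, fun t ht => ?_⟩
    have h2 := (hd t ht).2
    rw [← hx] at h2
    refine ⟨?_, h2⟩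
    have h1 := (hd t ht).1.add (hasDerivWithinAt_mulVec K h2)
    rw [hs, sub_add_cancel] at h1
    refine h1.congr_of_mem (fun s _ => ?_) ht
    simp

theorem DecoupledSystem.eqOn_state (hf : 𝓜.f = 0) {xbar shat xbar' shat' : ℝ → Fin n → ℝ}
    (h : 𝓜.DecoupledSystem Pbar xbar shat) (h' : 𝓜.DecoupledSystem Pbar xbar' shat')
    (hs : ∀ t, 0 ≤ t → shat' t = shat t) {t : ℝ} (ht : 0 ≤ t) : xbar' t = xbar t := by
  have aux : ∀ {x : ℝ → Fin n → ℝ} {s : ℝ → Fin n → ℝ}, 𝓜.DecoupledSystem Pbar x s →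
      (∀ t, 0 ≤ t → s t = shat t) → ∀ t, 0 ≤ t → HasDerivWithinAt x
        (mulVecCLM (𝓜.A - 𝓜.S * Pbar) (x t) + -(𝓜.S *ᵥ shat t)) (Ici 0) t := by
    intro x s hx hs t ht
    convert! (hx.2.2.2 t ht).2 using 1
    rw [hf, hs t ht]
    simp only [LinearMap.coe_toContinuousLinearMap', Matrix.mulVecLin_apply, Matrix.sub_mulVec,
      ← Matrix.mulVec_mulVec, Matrix.mulVec_add, Pi.zero_apply]
    abel
  exact eqOn_of_linear_ode _ (by rw [h.2.2.1, h'.2.2.1]) (aux h' hs) (aux h fun _ _ => rfl) ht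

/-- The inhomogeneous terms cancel in the difference `e` of two offsets, leaving `e' = (ρ/2) e - H
e` with `H` Hurwitz. This antistable equation has no nonzero solution in `C_{ρ/2}`. -/
theorem DecoupledSystem.eqOn_offset (hH : Hurwitz (𝓜.shiftedAᵀ - Pbar * 𝓜.S))
    {xbar shat xbar' shat' : ℝ → Fin n → ℝ}
    (h : 𝓜.DecoupledSystem Pbar xbar shat) (h' : 𝓜.DecoupledSystem Pbar xbar' shat')
    {t : ℝ} (ht : 0 ≤ t) : shat' t = shat t := by
  refine sub_eq_zero.1 (hH.eq_zero_of_integrableOn (ρ := 𝓜.ρ) (e := fun t => shat' t - shat t)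
    (fun t ht => ?_) (h'.2.1.sub h.2.1).2 ht)
  convert! (h'.2.2.2 t ht).1.sub (h.2.2.2 t ht).1 using 1
  simp only [shiftedA, Matrix.transpose_sub, Matrix.transpose_smul, Matrix.transpose_one,
    Matrix.sub_mulVec, Matrix.mulVec_sub, Matrix.smul_mulVec, Matrix.one_mulVec]
  module

/-- Since `f = 0` and `Q η` is constant, a constant offset works: `((ρ/2) I - H) s = -Q η` is
solvable because `ρ/2` is no eigenvalue of `H`. The state then has constant forcing, which is in
`C_{ρ/2}` by `ρ > 0`, and a drift that is stable after discounting because `P̄` is stabilizing. -/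
theorem exists_decoupledSystem (hρ : 0 < 𝓜.ρ) (hf : 𝓜.f = 0)
    (hPbar : 𝓜.IsStabilizingGameSolution Pbar) (hH : Hurwitz (𝓜.shiftedAᵀ - Pbar * 𝓜.S)) :
    ∃ xbar shat, 𝓜.DecoupledSystem Pbar xbar shat := by
  set H := 𝓜.shiftedAᵀ - Pbar * 𝓜.S with hHdef
  have hD := isUnit_det_one_sub_of_hurwitz hH (half_pos hρ).le
  set s : Fin n → ℝ := -(((𝓜.ρ / 2) • 1 - H)⁻¹ *ᵥ (𝓜.Q *ᵥ 𝓜.η)) with hs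
  have hs' : 𝓜.ρ • s - (𝓜.Aᵀ - Pbar * 𝓜.S) *ᵥ s + 𝓜.Q *ᵥ 𝓜.η = 0 := by
    have h1 : ((𝓜.ρ / 2) • 1 - H) *ᵥ s = -(𝓜.Q *ᵥ 𝓜.η) := by
      rw [hs, Matrix.mulVec_neg, Matrix.mulVec_mulVec, Matrix.mul_nonsing_inv _ hD,
        Matrix.one_mulVec]
    have h2 : 𝓜.Q *ᵥ 𝓜.η = -(((𝓜.ρ / 2) • 1 - H) *ᵥ s) := by rw [h1, neg_neg]
    rw [h2, hHdef, shiftedA]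
    simp only [Matrix.transpose_sub, Matrix.transpose_smul, Matrix.transpose_one,
      Matrix.sub_mulVec, Matrix.smul_mulVec, Matrix.one_mulVec]
    module
  have hcon : Continuous fun _ : ℝ => -(𝓜.S *ᵥ s) := continuous_const
  set x := linearFlow (mulVecCLM (𝓜.A - 𝓜.S * Pbar)) (fun _ => -(𝓜.S *ᵥ s)) 𝓜.xbar0 with hx
  have hxd : ∀ t, HasDerivAt x ((𝓜.A - 𝓜.S * Pbar) *ᵥ x t + -(𝓜.S *ᵥ s)) t :=
    fun t => hasDerivAt_linearFlow _ hcon _ t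
  have hA : Hurwitz (𝓜.A - 𝓜.S * Pbar - (𝓜.ρ / 2) • 1) := by
    have := hPbar.2
    rwa [shiftedA, sub_right_comm] at this
  obtain ⟨C, hC⟩ := hA.exists_lintegral_le
  have hxc : ContinuousOn x (Ici 0) := fun t _ => (hxd t).continuousAt.continuousWithinAt
  have hsC : 𝓜.InC fun _ => -(𝓜.S *ᵥ s) := inC_const hρ _
  refine ⟨x, fun _ => s, ⟨hxc, integrableOn_of_lintegral_lt_top hxc ?_⟩, inC_const hρ s,
    linearFlow_zero _ _ _, fun t _ => ⟨?_, ?_⟩⟩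
  · refine (hC _ x continuousOn_const fun t _ => (hxd t).hasDerivWithinAt).trans_lt ?_
    exact ENNReal.mul_lt_top ENNReal.coe_lt_top
      (ENNReal.add_lt_top.2 ⟨ENNReal.ofReal_lt_top, hsC.lintegral_lt_top⟩)
  · rw [hf, Pi.zero_apply, Matrix.mulVec_zero, sub_zero, hs']
    exact hasDerivWithinAt_const _ _ _
  · convert! (hxd t).hasDerivWithinAt using 1
    rw [hf, Pi.zero_apply, Matrix.sub_mulVec, Matrix.mulVec_add, Matrix.mulVec_mulVec]
    abel

theorem exists_fixedPointSystem (hR : 𝓜.R.PosDef) (hf : 𝓜.f = 0) (hP : P.PosSemidef)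
    (hPeq : 𝓜.Riccati P) (hPbar : 𝓜.GameRiccati Pbar)
    (h : ∃ xbar shat, 𝓜.DecoupledSystem Pbar xbar shat) :
    ∃ xstar sstar, 𝓜.FixedPointSystem P xstar sstar := by
  obtain ⟨x, s, h⟩ := h
  refine ⟨x, fun t => s t + (Pbar - P) *ᵥ x t, (decoupledSystem_iff hR hf hP hPeq hPbar _ _).2 ?_⟩
  simpa using h

end Model

/-! ### Maximal inequality for sums of independent variables. -/

section Kolmogorov

variable {Ω : Type*} [mΩ : MeasurableSpace Ω] {μ : Measure Ω}
  {ξ : ℕ → Ω → ℝ}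

/-- The filtration `σ(ξ_0, …, ξ_{j-1})`. -/
def pastFiltration (hξ : ∀ k, Measurable (ξ k)) : Filtration ℕ mΩ where
  seq j := ⨆ k : Finset.range j, MeasurableSpace.comap (ξ k) inferInstance
  mono' _ j hij := iSup_le fun k => le_iSup_of_le
    (⟨k, Finset.mem_range.2 ((Finset.mem_range.1 k.2).trans_le hij)⟩ : Finset.range j) le_rfl
  le' _ := iSup_le fun k => (hξ k).comap_le

theorem measurable_pastFiltration (hξ : ∀ k, Measurable (ξ k)) {j k : ℕ} (hk : k < j) :
    Measurable[pastFiltration hξ j] (ξ k) :=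
  Measurable.mono (comap_measurable (ξ k))
    (le_iSup_of_le (⟨k, Finset.mem_range.2 hk⟩ : Finset.range j) le_rfl) le_rfl

theorem measurable_sum_pastFiltration (hξ : ∀ k, Measurable (ξ k)) (j : ℕ) :
    Measurable[pastFiltration hξ j] fun ω => ∑ k ∈ Finset.range j, ξ k ω :=
  Finset.measurable_fun_sum _ fun _ hk => measurable_pastFiltration hξ (Finset.mem_range.1 hk)

theorem indep_pastFiltration (hξ : ∀ k, Measurable (ξ k)) (hind : iIndepFun ξ μ) (j : ℕ) :
    Indep (pastFiltration hξ j) (MeasurableSpace.comap (ξ j) inferInstance) μ := by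
  have h := (hind.indepFun_finset (Finset.range j) {j} (by simp) hξ)
  have hm : Measurable fun f : ({j} : Finset ℕ) → ℝ => f ⟨j, Finset.mem_singleton_self j⟩ :=
    measurable_pi_apply _
  have h2 := h.comp measurable_id hm
  rw [IndepFun_iff_Indep] at h2
  refine indep_of_indep_of_le_left h2 (iSup_le fun k => ?_)
  exact Measurable.comap_le ((measurable_pi_apply k).comp
    (comap_measurable (fun ω (k : Finset.range j) => ξ k ω)))

variable [IsProbabilityMeasure μ]

/-- The square of a sum of independent centered variables is a submartingale. -/
theorem submartingale_sum_sq (hξ : ∀ k, Measurable (ξ k)) (hind : iIndepFun ξ μ)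
    (hL2 : ∀ k, MemLp (ξ k) 2 μ) (hmean : ∀ k, ∫ ω, ξ k ω ∂μ = 0) :
    Submartingale (fun j ω => (∑ k ∈ Finset.range j, ξ k ω) ^ 2) (pastFiltration hξ) μ := by
  have hS : ∀ j, MemLp (fun ω => ∑ k ∈ Finset.range j, ξ k ω) 2 μ := fun j =>
    memLp_finsetSum _ fun k _ => hL2 k
  refine submartingale_of_setIntegral_le_succ
    (fun j => ((measurable_sum_pastFiltration hξ j).pow_const 2).stronglyMeasurable)
    (fun j => (hS j).integrable_sq) fun j A hA => ?_
  have hA' := (pastFiltration hξ).le j A hA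
  -- The partial sum cut off to `A` is still measurable with respect to the past, hence independent
  -- of `ξ j`; this kills the cross term in the square.
  set Y : Ω → ℝ := A.indicator fun ω => ∑ k ∈ Finset.range j, ξ k ω with hY
  have hYm : Measurable[pastFiltration hξ j] Y :=
    (measurable_sum_pastFiltration hξ j).indicator hA
  have hYξ : IndepFun Y (ξ j) μ := by
    rw [IndepFun_iff_Indep]
    exact indep_of_indep_of_le_left (indep_pastFiltration hξ hind j) hYm.comap_le
  have hY2 : MemLp Y 2 μ := (hS j).indicator hA'
  have h0 : ∫ ω, Y ω * ξ j ω ∂μ = 0 := by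
    have := hYξ.integral_fun_mul_eq_mul_integral hY2.aestronglyMeasurable
      (hL2 j).aestronglyMeasurable
    rw [this, hmean, mul_zero]
  have h1 : ∫ ω in A, (∑ k ∈ Finset.range j, ξ k ω) * ξ j ω ∂μ = 0 := by
    rw [← integral_indicator hA', ← h0]
    congr 1
    ext ω
    by_cases hω : ω ∈ A <;> simp [hY, hω]
  have hi : Integrable (fun ω => (∑ k ∈ Finset.range j, ξ k ω) * ξ j ω) μ :=
    (hS j).integrable_mul (hL2 j)
  have h2 : ∀ ω, (∑ k ∈ Finset.range (j + 1), ξ k ω) ^ 2 = (∑ k ∈ Finset.range j, ξ k ω) ^ 2 +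
      (2 * ((∑ k ∈ Finset.range j, ξ k ω) * ξ j ω) + ξ j ω ^ 2) := by
    intro ω
    rw [Finset.sum_range_succ]; ring
  simp only [h2]
  rw [integral_add (hS j).integrable_sq.integrableOn
    (show Integrable (fun ω => 2 * ((∑ k ∈ Finset.range j, ξ k ω) * ξ j ω) + ξ j ω ^ 2) μ from
      (hi.const_mul 2).add (hL2 j).integrable_sq).integrableOn,
    integral_add (hi.const_mul 2).integrableOn (hL2 j).integrable_sq.integrableOn,
    integral_const_mul, h1]
  have : 0 ≤ ∫ ω in A, ξ j ω ^ 2 ∂μ := integral_nonneg fun ω => sq_nonneg _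
  linarith

/-- Kolmogorov's maximal inequality. -/
theorem measure_exists_le_abs_sum_le (hξ : ∀ k, Measurable (ξ k)) (hind : iIndepFun ξ μ)
    (hL2 : ∀ k, MemLp (ξ k) 2 μ) (hmean : ∀ k, ∫ ω, ξ k ω ∂μ = 0) {l : ℝ} (hl : 0 < l) (n : ℕ) :
    μ {ω | ∃ j ≤ n, l ≤ |∑ k ∈ Finset.range j, ξ k ω|} ≤
      ENNReal.ofReal ((∫ ω, (∑ k ∈ Finset.range n, ξ k ω) ^ 2 ∂μ) / l ^ 2) := by
  have hsub := submartingale_sum_sq hξ hind hL2 hmean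
  -- Doob's inequality is applied to the squares, hence the threshold `l ^ 2`.
  have h := maximal_ineq hsub (fun j ω => sq_nonneg _) (ε := (l ^ 2).toNNReal) n
  set E := {ω | ((l ^ 2).toNNReal : ℝ) ≤ (Finset.range (n + 1)).sup' Finset.nonempty_range_add_one
    fun k => (∑ k ∈ Finset.range k, ξ k ω) ^ 2} with hE
  have hset : {ω | ∃ j ≤ n, l ≤ |∑ k ∈ Finset.range j, ξ k ω|} ⊆ E := by
    rintro ω ⟨j, hj, hlj⟩
    rw [hE, mem_ofPred_eq, Real.coe_toNNReal _ (sq_nonneg l), Finset.le_sup'_iff]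
    refine ⟨j, Finset.mem_range.2 (by omega), ?_⟩
    rw [← sq_abs (∑ k ∈ Finset.range j, ξ k ω)]
    gcongr
  have h3 : ∫ ω in E, (∑ k ∈ Finset.range n, ξ k ω) ^ 2 ∂μ ≤
      ∫ ω, (∑ k ∈ Finset.range n, ξ k ω) ^ 2 ∂μ :=
    setIntegral_le_integral (hsub.integrable n) (Eventually.of_forall fun ω => sq_nonneg _)
  rw [ENNReal.ofReal_div_of_pos (by positivity), ENNReal.le_div_iff_mul_le
    (Or.inl (by simpa using hl.ne')) (Or.inl ENNReal.ofReal_ne_top), mul_comm]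
  refine (mul_le_mul_right (measure_mono hset) _).trans (h.trans (ENNReal.ofReal_le_ofReal h3))

end Kolmogorov

/-! ### The Wiener isometry on step functions. -/

section StepPairs

variable {Ω : Type*} {w : ℝ≥0 → Ω → ℝ}

/-- Linear combinations of values of the process `w`, each paired with the same linear combination
of the indicator functions of the intervals `[0, t)`. -/
def stepPairs (w : ℝ≥0 → Ω → ℝ) : Submodule ℝ ((Ω → ℝ) × (ℝ → ℝ)) :=
  Submodule.span ℝ (range fun t : ℝ≥0 => (w t, (Ico (0 : ℝ) t).indicator fun _ => (1 : ℝ)))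

theorem mem_stepPairs (w : ℝ≥0 → Ω → ℝ) (t : ℝ≥0) :
    (w t, (Ico (0 : ℝ) t).indicator fun _ => (1 : ℝ)) ∈ stepPairs w :=
  Submodule.subset_span ⟨t, rfl⟩

/-- Step sums of a function are paired with step functions that approximate the function. -/
theorem exists_mem_stepPairs (w : ℝ≥0 → Ω → ℝ) {φ : ℝ≥0 → ℝ} {τ : ℕ → ℝ≥0} (hτ : Monotone τ)
    (hτ0 : τ 0 = 0) {a : ℕ → ℝ} {ε : ℝ} (K : ℕ)
    (h : ∀ k < K, ∀ y, τ k ≤ y → y < τ (k + 1) → |a k - φ y| ≤ ε) :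
    ∃ f : ℝ → ℝ, (fun ω => ∑ k ∈ Finset.range K, a k * (w (τ (k + 1)) ω - w (τ k) ω), f) ∈
        stepPairs w ∧ (∀ x ∉ Ico (0 : ℝ) (τ K), f x = 0) ∧
      ∀ x ∈ Ico (0 : ℝ) (τ K), |f x - φ x.toNNReal| ≤ ε := by
  induction K with
  | zero => exact ⟨0, by simp only [Finset.range_zero, Finset.sum_empty]; exact (stepPairs w).zero_mem, fun _ _ => rfl, by simp [hτ0]⟩
  | succ K ih =>
    obtain ⟨f, hf, hf0, hfε⟩ := ih fun k hk => h k (hk.trans K.lt_succ_self)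
    have hle : (τ K : ℝ) ≤ τ (K + 1) := by exact_mod_cast hτ K.le_succ
    -- The new increment is paired with the indicator of `[τ K, τ (K + 1))`, written as a difference
    -- of two generators.
    refine ⟨fun x => f x + a K * ((Ico (0 : ℝ) (τ (K + 1))).indicator (fun _ => (1 : ℝ)) x -
      (Ico (0 : ℝ) (τ K)).indicator (fun _ => (1 : ℝ)) x), ?_, ?_, ?_⟩
    · simp only [Finset.sum_range_succ]
      exact (stepPairs w).add_mem hf ((stepPairs w).smul_mem (a K)
        ((stepPairs w).sub_mem (mem_stepPairs w _) (mem_stepPairs w _)))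
    · intro x hx
      have hx' : x ∉ Ico (0 : ℝ) (τ K) := fun h => hx ⟨h.1, h.2.trans_le hle⟩
      simp only [hf0 x hx', indicator_of_notMem hx, indicator_of_notMem hx']
      simp
    · intro x hx
      simp only [indicator_of_mem hx]
      by_cases hx' : x ∈ Ico (0 : ℝ) (τ K)
      · rw [indicator_of_mem hx']
        simpa using hfε x hx'
      · rw [indicator_of_notMem hx', hf0 x hx']
        have h1 : τ K ≤ x.toNNReal := by
          by_contra! hlt
          refine hx' ⟨hx.1, ?_⟩
          rw [← Real.coe_toNNReal x hx.1]
          exact_mod_cast hlt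
        have h2 : x.toNNReal < τ (K + 1) := by
          rw [← NNReal.coe_lt_coe, Real.coe_toNNReal x hx.1]
          exact hx.2
        simpa using h K K.lt_succ_self _ h1 h2

variable [MeasurableSpace Ω] {μ : Measure Ω}

theorem memLp_of_mem_stepPairs (hw : IsPreBrownianReal w μ) {p : (Ω → ℝ) × (ℝ → ℝ)}
    (hp : p ∈ stepPairs w) : MemLp p.1 2 μ ∧ MemLp p.2 2 volume := by
  induction hp using Submodule.span_induction with
  | mem p hp =>
    obtain ⟨t, rfl⟩ := hp
    exact ⟨(hw.isGaussianProcess.hasGaussianLaw_eval t).memLp_two,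
      memLp_indicator_const 2 measurableSet_Ico 1 (Or.inr (by simp))⟩
  | zero => exact ⟨MemLp.zero, MemLp.zero⟩
  | add p q _ _ hp hq => exact ⟨hp.1.add hq.1, hp.2.add hq.2⟩
  | smul c p _ hp => exact ⟨hp.1.const_smul c, hp.2.const_smul c⟩

theorem integral_mul_eval (hw : IsPreBrownianReal w μ) (s t : ℝ≥0) :
    ∫ ω, w s ω * w t ω ∂μ = ((min s t : ℝ≥0) : ℝ) := by
  have := hw.isGaussianProcess.isProbabilityMeasure
  have h := hw.covariance_eval s t
  rw [covariance_eq_sub (hw.isGaussianProcess.hasGaussianLaw_eval s).memLp_two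
    (hw.isGaussianProcess.hasGaussianLaw_eval t).memLp_two, hw.integral_eval, zero_mul,
    sub_zero] at h
  simpa using h

/-- The covariance of linear combinations of values of a Brownian motion. -/
theorem integral_mul_of_mem_stepPairs (hw : IsPreBrownianReal w μ) {p q : (Ω → ℝ) × (ℝ → ℝ)}
    (hp : p ∈ stepPairs w) (hq : q ∈ stepPairs w) :
    ∫ ω, p.1 ω * q.1 ω ∂μ = ∫ x, p.2 x * q.2 x := by
  have hi : ∀ {p q}, p ∈ stepPairs w → q ∈ stepPairs w →
      Integrable (fun ω => p.1 ω * q.1 ω) μ ∧ Integrable (fun x => p.2 x * q.2 x) := fun hp hq =>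
    ⟨(memLp_of_mem_stepPairs hw hp).1.integrable_mul (memLp_of_mem_stepPairs hw hq).1,
      (memLp_of_mem_stepPairs hw hp).2.integrable_mul (memLp_of_mem_stepPairs hw hq).2⟩
  induction hp, hq using Submodule.span_induction₂ with
  | mem_mem p q hp hq =>
    obtain ⟨s, rfl⟩ := hp
    obtain ⟨t, rfl⟩ := hq
    have h : ∀ x, (Ico (0 : ℝ) s).indicator (fun _ => (1 : ℝ)) x *
        (Ico (0 : ℝ) t).indicator (fun _ => (1 : ℝ)) x =
        (Ico (0 : ℝ) (min s t : ℝ≥0)).indicator (fun _ => (1 : ℝ)) x := by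
      intro x
      rw [← inter_indicator_mul, Ico_inter_Ico]
      simp
    simp only [h, integral_mul_eval hw]
    rw [integral_indicator measurableSet_Ico]
    simp
  | zero_left q hq => simp
  | zero_right p hp => simp
  | add_left p p' q hp hp' hq h h' =>
    simp only [Prod.fst_add, Prod.snd_add, Pi.add_apply, add_mul]
    rw [integral_add (hi hp hq).1 (hi hp' hq).1, integral_add (hi hp hq).2 (hi hp' hq).2, h, h']
  | add_right p q q' hp hq hq' h h' =>
    simp only [Prod.fst_add, Prod.snd_add, Pi.add_apply, mul_add]
    rw [integral_add (hi hp hq).1 (hi hp hq').1, integral_add (hi hp hq).2 (hi hp hq').2, h, h']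
  | smul_left c p q hp hq h =>
    simp only [Prod.smul_fst, Prod.smul_snd, Pi.smul_apply, smul_eq_mul, mul_assoc,
      integral_const_mul, h]
  | smul_right c p q hp hq h =>
    simp only [Prod.smul_fst, Prod.smul_snd, Pi.smul_apply, smul_eq_mul, mul_left_comm _ c,
      integral_const_mul, h]

/-- The Wiener isometry, from the covariance identity on the diagonal. Working with pairs instead of
a map avoids showing that a step function determines its random variable. -/
theorem eLpNorm_of_mem_stepPairs (hw : IsPreBrownianReal w μ) {p : (Ω → ℝ) × (ℝ → ℝ)}
    (hp : p ∈ stepPairs w) : eLpNorm p.1 2 μ = eLpNorm p.2 2 volume := by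
  obtain ⟨h1, h2⟩ := memLp_of_mem_stepPairs hw hp
  rw [h1.eLpNorm_eq_integral_rpow_norm two_ne_zero ENNReal.ofNat_ne_top,
    h2.eLpNorm_eq_integral_rpow_norm two_ne_zero ENNReal.ofNat_ne_top]
  have := integral_mul_of_mem_stepPairs hw hp hp
  simp only [ENNReal.toReal_ofNat, Real.rpow_ofNat, Real.norm_eq_abs, sq_abs]
  simp only [← sq] at this
  rw [this]

theorem eLpNorm_le_of_mem_stepPairs (hw : IsPreBrownianReal w μ) {p : (Ω → ℝ) × (ℝ → ℝ)}
    (hp : p ∈ stepPairs w) {t : ℝ≥0} {b : ℝ} (h0 : ∀ x ∉ Ico (0 : ℝ) t, p.2 x = 0)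
    (hb : ∀ x ∈ Ico (0 : ℝ) t, |p.2 x| ≤ b) :
    eLpNorm p.1 2 μ ≤ ENNReal.ofReal (b * √t) := by
  rcases eq_or_ne t 0 with rfl | ht
  · have : p.2 = 0 := funext fun x => h0 x (by simp)
    rw [eLpNorm_of_mem_stepPairs hw hp, this]
    simp
  have hb0 : 0 ≤ b := (abs_nonneg _).trans (hb 0 ⟨le_rfl, by exact_mod_cast pos_of_ne_zero ht⟩)
  rw [eLpNorm_of_mem_stepPairs hw hp]
  calc eLpNorm p.2 2 volume ≤ eLpNorm ((Ico (0 : ℝ) t).indicator fun _ => b) 2 volume := by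
        refine eLpNorm_mono fun x => ?_
        by_cases hx : x ∈ Ico (0 : ℝ) t
        · rw [indicator_of_mem hx, Real.norm_eq_abs, Real.norm_of_nonneg hb0]
          exact hb x hx
        · rw [h0 x hx]; simp
    _ = ENNReal.ofReal (b * √t) := by
        rw [eLpNorm_indicator_const measurableSet_Ico two_ne_zero ENNReal.ofNat_ne_top,
          Real.volume_Ico, sub_zero, ENNReal.ofReal_mul hb0, Real.sqrt_eq_rpow,
          ← ENNReal.ofReal_rpow_of_nonneg t.coe_nonneg (by norm_num), Real.enorm_of_nonneg hb0]
        simp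

end StepPairs

/-! ### Dyadic step sums and their maximal inequality. -/

section Dyadic

variable {Ω : Type*} {w : ℝ≥0 → Ω → ℝ}

/-- Left-endpoint sums over the first `K` dyadic intervals of length `2⁻ᵖ`, stopped at time `t`. -/
noncomputable def dyadicSum (w : ℝ≥0 → Ω → ℝ) (φ : ℝ≥0 → ℝ) (p K : ℕ) (t : ℝ≥0) (ω : Ω) : ℝ :=
  ∑ k ∈ Finset.range K, φ (k / 2 ^ p) *
    (w (min t ((k + 1 : ℕ) / 2 ^ p)) ω - w (min t ((k : ℕ) / 2 ^ p)) ω)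

/-- On each of the dyadic intervals of length `2⁻ᵖ` in `[0, T]`, the increments of `D` are a
constant multiple of the increments of `w`. -/
def IsDyadicStep (w D : ℝ≥0 → Ω → ℝ) (p T : ℕ) : Prop :=
  ∀ k < T * 2 ^ p, ∃ c : ℝ, ∀ s t : ℝ≥0, (k / 2 ^ p : ℝ≥0) ≤ s → s ≤ (k + 1 : ℕ) / 2 ^ p →
    (k / 2 ^ p : ℝ≥0) ≤ t → t ≤ (k + 1 : ℕ) / 2 ^ p →
    ∀ ω, D t ω - D s ω = c * (w t ω - w s ω)

theorem dyadic_le {p j k : ℕ} (h : j ≤ k) : (j / 2 ^ p : ℝ≥0) ≤ k / 2 ^ p := by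
  gcongr

/-- While `t` runs through the `k`th cell, earlier summands are already frozen and later ones are
still zero, so only the `k`th one moves. -/
theorem isDyadicStep_dyadicSum (w : ℝ≥0 → Ω → ℝ) (φ : ℝ≥0 → ℝ) (p T : ℕ) :
    IsDyadicStep w (dyadicSum w φ p (T * 2 ^ p)) p T := by
  intro k hk
  refine ⟨φ (k / 2 ^ p), fun s t hs hs' ht ht' ω => ?_⟩
  rw [dyadicSum, dyadicSum, ← Finset.sum_sub_distrib, Finset.sum_eq_single k]
  · rw [min_eq_left ht', min_eq_left hs', min_eq_right ht, min_eq_right hs]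
    ring
  · intro j _ hjk
    rcases lt_or_gt_of_ne hjk with h | h
    · have h1 : ((j + 1 : ℕ) / 2 ^ p : ℝ≥0) ≤ k / 2 ^ p := dyadic_le h
      have h2 : (j / 2 ^ p : ℝ≥0) ≤ k / 2 ^ p := dyadic_le h.le
      rw [min_eq_right (h1.trans ht), min_eq_right (h1.trans hs), min_eq_right (h2.trans ht),
        min_eq_right (h2.trans hs)]
      ring
    · have h1 : ((k + 1 : ℕ) / 2 ^ p : ℝ≥0) ≤ j / 2 ^ p := dyadic_le h
      have h2 : ((k + 1 : ℕ) / 2 ^ p : ℝ≥0) ≤ (j + 1 : ℕ) / 2 ^ p := dyadic_le (by omega)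
      rw [min_eq_left (ht'.trans h1), min_eq_left (hs'.trans h1), min_eq_left (ht'.trans h2),
        min_eq_left (hs'.trans h2)]
      ring
  · intro h
    exact absurd (Finset.mem_range.2 hk) h

theorem dyadicSum_zero (w : ℝ≥0 → Ω → ℝ) (φ : ℝ≥0 → ℝ) (p K : ℕ) (ω : Ω) :
    dyadicSum w φ p K 0 ω = 0 := by
  simp [dyadicSum]

theorem continuous_dyadicSum {φ : ℝ≥0 → ℝ} {p K : ℕ} {ω : Ω} (h : Continuous fun t => w t ω) :
    Continuous fun t => dyadicSum w φ p K t ω := by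
  unfold dyadicSum
  refine continuous_finsetSum _ fun k _ => continuous_const.mul (Continuous.sub ?_ ?_) <;>
  exact h.comp (continuous_id.min continuous_const)

theorem IsDyadicStep.sub {D D' : ℝ≥0 → Ω → ℝ} {p T : ℕ} (h : IsDyadicStep w D p T)
    (h' : IsDyadicStep w D' p T) : IsDyadicStep w (fun t ω => D t ω - D' t ω) p T := by
  intro k hk
  obtain ⟨c, hc⟩ := h k hk
  obtain ⟨c', hc'⟩ := h' k hk
  refine ⟨c - c', fun s t h1 h2 h3 h4 ω => ?_⟩
  linear_combination hc s t h1 h2 h3 h4 ω - hc' s t h1 h2 h3 h4 ω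

theorem IsDyadicStep.mono_horizon {D : ℝ≥0 → Ω → ℝ} {p T T' : ℕ} (h : IsDyadicStep w D p T)
    (hT : T' ≤ T) : IsDyadicStep w D p T' := fun k hk =>
  h k (hk.trans_le (Nat.mul_le_mul_right _ hT))

/-- Cell `k` of level `q + 1` lies in cell `k / 2` of level `q`. This lets step sums of different
levels be compared on the finer grid. -/
theorem IsDyadicStep.refine {D : ℝ≥0 → Ω → ℝ} {p q T : ℕ} (h : IsDyadicStep w D p T)
    (hpq : p ≤ q) : IsDyadicStep w D q T := by
  induction q, hpq using Nat.le_induction with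
  | base => exact h
  | succ q _ ih =>
    intro k hk
    obtain ⟨c, hc⟩ := ih (k / 2) (by rw [pow_succ, ← mul_assoc] at hk; omega)
    have h1 : ((k / 2 : ℕ) / 2 ^ q : ℝ≥0) ≤ k / 2 ^ (q + 1) := by
      rw [pow_succ', ← div_div]
      gcongr
      exact Nat.cast_div_le
    have h2 : ((k + 1 : ℕ) / 2 ^ (q + 1) : ℝ≥0) ≤ (k / 2 + 1 : ℕ) / 2 ^ q := by
      rw [pow_succ', ← div_div]
      gcongr
      rw [div_le_iff₀ (by norm_num)]
      have : k + 1 ≤ (k / 2 + 1) * 2 := by omega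
      exact_mod_cast this
    exact ⟨c, fun s t hs hs' ht ht' => hc s t (h1.trans hs) (hs'.trans h2) (h1.trans ht)
      (ht'.trans h2)⟩

/-- Stopping at `t` replaces the grid by `min t (k / 2 ^ p)`. A nonempty truncated cell still starts
at `k / 2 ^ p`, so its coefficient is the value of `φ` at its left end. -/
theorem exists_mem_stepPairs_dyadicSum (w : ℝ≥0 → Ω → ℝ) {φ : ℝ≥0 → ℝ} {p K : ℕ} {t : ℝ≥0}
    {ε : ℝ} (ht : t ≤ K / 2 ^ p)
    (h : ∀ x y, x ≤ t → y ≤ t → dist x y ≤ 1 / 2 ^ p → |φ x - φ y| ≤ ε) :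
    ∃ f : ℝ → ℝ, (dyadicSum w φ p K t, f) ∈ stepPairs w ∧ (∀ x ∉ Ico (0 : ℝ) t, f x = 0) ∧
      ∀ x ∈ Ico (0 : ℝ) t, |f x - φ x.toNNReal| ≤ ε := by
  have := exists_mem_stepPairs w (φ := φ) (τ := fun k => min t (k / 2 ^ p))
    (fun j k hjk => min_le_min_left _ (dyadic_le hjk)) (by simp) (a := fun k => φ (k / 2 ^ p))
    (ε := ε) K fun k _ y hy hy' => by
      have hyt : y < t := hy'.trans_le (min_le_left _ _)
      have hyk : y < (k + 1 : ℕ) / 2 ^ p := hy'.trans_le (min_le_right _ _)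
      have hk : (k / 2 ^ p : ℝ≥0) ≤ y := by
        rcases min_le_iff.1 hy with h | h
        · exact absurd h (not_le.2 hyt)
        · exact h
      refine h _ _ (hk.trans hyt.le) hyt.le ?_
      have h1 : (y : ℝ) < (k + 1 : ℕ) / 2 ^ p := by exact_mod_cast hyk
      have h2 : (k / 2 ^ p : ℝ) ≤ y := by exact_mod_cast hk
      rw [dist_comm, NNReal.dist_eq]
      push_cast at h1 ⊢
      rw [abs_of_nonneg (by linarith)]
      rw [add_div] at h1
      linarith
  simpa only [min_eq_left ht] using! this

variable [MeasurableSpace Ω] {μ : Measure Ω}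

theorem measurable_dyadicSum (hm : ∀ t, Measurable (w t)) (φ : ℝ≥0 → ℝ) (p K : ℕ) (t : ℝ≥0) :
    Measurable (dyadicSum w φ p K t) :=
  Finset.measurable_fun_sum _ fun _ _ => ((hm _).sub (hm _)).const_mul _

/-- On the grid, `D` is a partial sum of multiples of Brownian increments, which are independent and
centered. -/
theorem IsDyadicStep.measure_grid_le (hw : IsPreBrownianReal w μ) (hm : ∀ t, Measurable (w t))
    {D : ℝ≥0 → Ω → ℝ} {p T : ℕ} (hD : IsDyadicStep w D p T) (hD0 : ∀ ω, D 0 ω = 0) {l : ℝ}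
    (hl : 0 < l) :
    μ {ω | ∃ j ≤ T * 2 ^ p, l ≤ |D (j / 2 ^ p) ω|} ≤
      ENNReal.ofReal ((∫ ω, D T ω ^ 2 ∂μ) / l ^ 2) := by
  have := hw.isGaussianProcess.isProbabilityMeasure
  choose c hc using hD
  -- The slopes are only given up to the horizon; zero beyond it completes them to a sequence.
  set b : ℕ → ℝ := fun k => if h : k < T * 2 ^ p then c k h else 0 with hb
  set τ : ℕ → ℝ≥0 := fun k => k / 2 ^ p with hτ
  set ξ : ℕ → Ω → ℝ := fun k ω => b k * (w (τ (k + 1)) ω - w (τ k) ω) with hξ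
  have hτm : Monotone τ := fun j k hjk => dyadic_le hjk
  have hsum : ∀ j ≤ T * 2 ^ p, ∀ ω, D (j / 2 ^ p) ω = ∑ k ∈ Finset.range j, ξ k ω := by
    intro j
    induction j with
    | zero => intro _ ω; simpa using hD0 ω
    | succ j ih =>
      intro hj ω
      have hj' : j < T * 2 ^ p := hj
      rw [Finset.sum_range_succ, ← ih hj'.le ω]
      have h1 := hc j hj' (τ j) (τ (j + 1)) le_rfl (hτm j.le_succ) (hτm j.le_succ) le_rfl ω
      simp only [hξ, hb, dif_pos hj']
      linear_combination h1
  have hL2 : ∀ t, MemLp (w t) 2 μ := fun t =>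
    (hw.isGaussianProcess.hasGaussianLaw_eval t).memLp_two
  have hind : iIndepFun ξ μ :=
    (hw.hasIndepIncrements.nat hτm).comp (fun k x => b k * x) fun k => measurable_const_mul _
  have hmax := measure_exists_le_abs_sum_le (ξ := ξ) (μ := μ)
    (fun k => ((hm _).sub (hm _)).const_mul _) hind
    (fun k => ((hL2 _).sub (hL2 _)).const_mul _) (fun k => by
      simp only [hξ]
      rw [integral_const_mul, integral_sub (hw.integrable_eval _) (hw.integrable_eval _),
        hw.integral_eval, hw.integral_eval]
      simp) hl (T * 2 ^ p)
  have hT : ((T * 2 ^ p : ℕ) / 2 ^ p : ℝ≥0) = T := by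
    push_cast
    rw [mul_div_assoc, div_self (by positivity), mul_one]
  simp only [← hsum _ le_rfl, hT] at hmax
  refine (measure_mono ?_).trans hmax
  rintro ω ⟨j, hj, h⟩
  exact ⟨j, hj, by rwa [← hsum j hj]⟩

/-- Kolmogorov's maximal inequality in continuous time. -/
theorem IsDyadicStep.measure_sup_le (hw : IsPreBrownianReal w μ) (hm : ∀ t, Measurable (w t))
    {D : ℝ≥0 → Ω → ℝ} {p T : ℕ} (hD : IsDyadicStep w D p T) (hD0 : ∀ ω, D 0 ω = 0)
    (hcont : ∀ᵐ ω ∂μ, Continuous fun t => D t ω) {l : ℝ} (hl : 0 < l) :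
    μ {ω | ∃ t ≤ (T : ℝ≥0), l < |D t ω|} ≤ ENNReal.ofReal ((∫ ω, D T ω ^ 2 ∂μ) / l ^ 2) := by
  -- The grid bound is uniform in the level and the events `E q` increase. By continuity, a strict
  -- excess at any `t` gives a weak excess at a nearby grid point to the left, hence the `<` in the
  -- statement against `≤` here.
  set E : ℕ → Set Ω := fun q => {ω | ∃ j ≤ T * 2 ^ (p + q), l ≤ |D (j / 2 ^ (p + q)) ω|} with hE
  have hmono : Monotone E := by
    refine monotone_nat_of_le_succ fun q ω => ?_
    rintro ⟨j, hj, h⟩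
    refine ⟨2 * j, ?_, ?_⟩
    · rw [← add_assoc, pow_succ]
      nlinarith
    · rw [← add_assoc, pow_succ']
      push_cast
      rwa [mul_div_mul_left _ _ two_ne_zero]
  have hsub : ∀ᵐ ω ∂μ, ω ∈ {ω | ∃ t ≤ (T : ℝ≥0), l < |D t ω|} → ω ∈ ⋃ q, E q := by
    filter_upwards [hcont] with ω hω
    rintro ⟨t, ht, hlt⟩
    have hpow : Tendsto (fun q : ℕ => (2 : ℝ) ^ (p + q)) atTop atTop :=
      ((tendsto_pow_atTop_atTop_of_one_lt one_lt_two).comp (tendsto_add_atTop_nat p)).congr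
        fun q => by simp [add_comm]
    have hlim : Tendsto (fun q : ℕ => ((⌊t * 2 ^ (p + q)⌋₊ : ℕ) / 2 ^ (p + q) : ℝ≥0)) atTop
        (𝓝 t) := by
      refine NNReal.tendsto_coe.1
        (((tendsto_nat_floor_mul_div_atTop t.coe_nonneg).comp hpow).congr fun q => ?_)
      have : ⌊(t : ℝ) * 2 ^ (p + q)⌋₊ = ⌊t * 2 ^ (p + q)⌋₊ :=
        (congrArg Nat.floor rfl).trans
          (Nonneg.nat_floor_coe (α := ℝ) (t * 2 ^ (p + q) : ℝ≥0))
      simp [this]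
    have hev := ((hω.abs.tendsto t).comp hlim).eventually_const_lt hlt
    obtain ⟨q, hq⟩ := hev.exists
    refine mem_iUnion.2 ⟨q, ⌊t * 2 ^ (p + q)⌋₊, ?_, hq.le⟩
    refine Nat.floor_le_of_le ?_
    push_cast
    gcongr
  calc _ ≤ μ (⋃ q, E q) := measure_mono_ae hsub
    _ = ⨆ q, μ (E q) := hmono.measure_iUnion
    _ ≤ _ := iSup_le fun q => (hD.refine (Nat.le_add_right p q)).measure_grid_le hw hm hD0 hl

end Dyadic

/-- A monotone sequence of dyadic scales that are fine enough for `φ` on `[0, m + 1]`. -/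
theorem exists_dyadic_scales {φ : ℝ≥0 → ℝ} (hφ : Continuous φ) :
    ∃ p : ℕ → ℕ, Monotone p ∧ ∀ m : ℕ, ∀ x y : ℝ≥0, x ≤ m + 1 → y ≤ m + 1 →
      dist x y ≤ 1 / 2 ^ p m → |φ x - φ y| ≤ (1 / 4) ^ m := by
  have h : ∀ m : ℕ, ∃ q : ℕ, ∀ x y : ℝ≥0, x ≤ m + 1 → y ≤ m + 1 →
      dist x y ≤ 1 / 2 ^ q → |φ x - φ y| ≤ (1 / 4) ^ m := by
    intro m
    have huc := (isCompact_Icc (a := (0 : ℝ≥0)) (b := m + 1)).uniformContinuousOn_of_continuous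
      hφ.continuousOn
    obtain ⟨δ, hδ, hφδ⟩ := Metric.uniformContinuousOn_iff_le.1 huc ((1 / 4) ^ m) (by positivity)
    obtain ⟨q, hq⟩ := exists_pow_lt_of_lt_one hδ (show (1 / 2 : ℝ) < 1 by norm_num)
    refine ⟨q, fun x y hx hy hxy => ?_⟩
    rw [← Real.dist_eq]
    refine hφδ x ⟨zero_le, hx⟩ y ⟨zero_le, hy⟩ (hxy.trans ?_)
    rw [← one_div_pow]
    exact hq.le
  choose q hq using h
  -- Summing the individual scales makes the sequence monotone and keeps each level at least as fine
  -- as required.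
  refine ⟨fun m => ∑ i ∈ Finset.range (m + 1), q i, ?_, fun m x y hx hy hxy =>
    hq m x y hx hy (hxy.trans ?_)⟩
  · intro i j hij
    exact Finset.sum_le_sum_of_subset (Finset.range_subset_range.2 (by omega))
  · gcongr
    · norm_num
    · exact Finset.single_le_sum (f := q) (fun _ _ => Nat.zero_le _) (Finset.self_mem_range_succ m)

/-- A sequence of continuous functions with geometrically small increments on bounded intervals
converges to a continuous function. -/
theorem exists_continuous_limit {I : ℕ → ℝ≥0 → ℝ} (hI : ∀ m, Continuous (I m))
    (h : ∀ᶠ m : ℕ in atTop, ∀ t : ℝ≥0, t ≤ m → |I (m + 1) t - I m t| ≤ (1 / 2) ^ m) :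
    ∃ g : ℝ≥0 → ℝ, Continuous g ∧ ∀ t, Tendsto (fun m => I m t) atTop (𝓝 (g t)) := by
  obtain ⟨m0, hm0⟩ := eventually_atTop.1 h
  -- The bound has the form `C / 2 / 2 ^ j` of a geometric Cauchy sequence with `C = 2 * (1 / 2) ^
  -- M`, which also bounds the distance from `I M t` to the limit.
  have hstep : ∀ M : ℕ, m0 ≤ M → ∀ t : ℝ≥0, t ≤ M → ∀ j,
      dist (I (M + j) t) (I (M + (j + 1)) t) ≤ 2 * (1 / 2) ^ M / 2 / 2 ^ j := by
    intro M hM t ht j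
    have := hm0 (M + j) (by omega) t (ht.trans (by exact_mod_cast Nat.le_add_right M j))
    rw [dist_comm, Real.dist_eq, ← add_assoc]
    refine this.trans (le_of_eq ?_)
    rw [pow_add, one_div_pow 2 j]
    ring
  have hlim : ∀ t, ∃ y, Tendsto (fun m => I m t) atTop (𝓝 y) := by
    intro t
    obtain ⟨M, hM⟩ := exists_nat_ge t
    have hM' : t ≤ (max m0 M : ℕ) := hM.trans (by exact_mod_cast le_max_right _ _)
    obtain ⟨y, hy⟩ := cauchySeq_tendsto_of_complete
      (cauchySeq_of_le_geometric_two (hstep _ (le_max_left _ _) t hM'))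
    refine ⟨y, (tendsto_add_atTop_iff_nat (max m0 M)).1 (hy.congr fun j => by rw [add_comm])⟩
  choose g hg using hlim
  refine ⟨g, ?_, hg⟩
  have hunif : ∀ M : ℕ, m0 ≤ M → ∀ t : ℝ≥0, t ≤ M → dist (I M t) (g t) ≤ 2 * (1 / 2) ^ M := by
    intro M hM t ht
    have h1 : Tendsto (fun j => I (M + j) t) atTop (𝓝 (g t)) :=
      ((tendsto_add_atTop_iff_nat M).2 (hg t)).congr fun j => by rw [add_comm]
    exact dist_le_of_le_geometric_two_of_tendsto₀ (hstep M hM t ht) h1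
  refine TendstoLocallyUniformly.continuous (F := I) (p := atTop) ?_
    (Eventually.of_forall hI).frequently
  rw [Metric.tendstoLocallyUniformly_iff]
  intro ε hε t
  refine ⟨Iio (t + 1), Iio_mem_nhds (lt_add_one t), ?_⟩
  obtain ⟨T, hT⟩ := exists_nat_ge (t + 1)
  have h2 : Tendsto (fun M : ℕ => (2 : ℝ) * (1 / 2) ^ M) atTop (𝓝 0) := by
    simpa using (tendsto_pow_atTop_nhds_zero_of_lt_one (by norm_num)
      (by norm_num : (1 / 2 : ℝ) < 1)).const_mul 2
  filter_upwards [h2.eventually_lt_const hε, eventually_ge_atTop m0, eventually_ge_atTop T]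
    with M hM hm hTM s hs
  rw [dist_comm]
  exact (hunif M hm s ((mem_Iio.1 hs).le.trans (hT.trans (by exact_mod_cast hTM)))).trans_lt hM

/-! ### Continuous version of the Wiener integral. -/

section WienerIntegral

variable {Ω : Type*} [MeasurableSpace Ω] {μ : Measure Ω} {w : ℝ≥0 → Ω → ℝ}

theorem integral_sq_le_of_eLpNorm_le {f : Ω → ℝ} (hf : MemLp f 2 μ) {b : ℝ} (hb : 0 ≤ b)
    (h : eLpNorm f 2 μ ≤ ENNReal.ofReal b) : ∫ ω, f ω ^ 2 ∂μ ≤ b ^ 2 := by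
  rw [hf.eLpNorm_eq_integral_rpow_norm two_ne_zero ENNReal.ofNat_ne_top,
    ENNReal.ofReal_le_ofReal_iff hb] at h
  simp only [ENNReal.toReal_ofNat, Real.rpow_ofNat, Real.norm_eq_abs, sq_abs] at h
  have h0 : 0 ≤ ∫ ω, f ω ^ 2 ∂μ := integral_nonneg fun ω => sq_nonneg _
  rw [← one_div, ← Real.sqrt_eq_rpow, Real.sqrt_le_left hb] at h
  exact h

/-- Along fine dyadic scales the step sums converge almost surely, uniformly on bounded intervals. -/
theorem ae_eventually_dyadicSum_sub_le (hw : IsBrownianReal w μ) (hm : ∀ t, Measurable (w t))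
    {φ : ℝ≥0 → ℝ} {p : ℕ → ℕ} (hp : Monotone p)
    (hφp : ∀ m : ℕ, ∀ x y : ℝ≥0, x ≤ m + 1 → y ≤ m + 1 →
      dist x y ≤ 1 / 2 ^ p m → |φ x - φ y| ≤ (1 / 4) ^ m) :
    ∀ᵐ ω ∂μ, ∀ᶠ m : ℕ in atTop, ∀ t : ℝ≥0, t ≤ m →
      |dyadicSum w φ (p (m + 1)) ((m + 1) * 2 ^ p (m + 1)) t ω -
        dyadicSum w φ (p m) (m * 2 ^ p m) t ω| ≤ (1 / 2) ^ m := by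
  set I : ℕ → ℝ≥0 → Ω → ℝ := fun m => dyadicSum w φ (p m) (m * 2 ^ p m) with hI
  set E : ℕ → Set Ω := fun m => {ω | ∃ t ≤ (m : ℝ≥0), (1 / 2) ^ m < |I (m + 1) t ω - I m t ω|}
    with hE
  have hgrid : ∀ m q : ℕ, (m : ℝ≥0) = (m * 2 ^ q : ℕ) / 2 ^ q := by
    intro m q
    push_cast
    rw [mul_div_assoc, div_self (by positivity), mul_one]
  -- The step functions of levels `m` and `m + 1` differ by at most `2 * (1 / 4) ^ m` on `[0, m)`,
  -- so by the isometry the variance is at most `4 m (1 / 16) ^ m`. Dividing by the squared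
  -- threshold `(1 / 4) ^ m` leaves a summable bound for Borel–Cantelli.
  have hbound : ∀ m, μ (E m) ≤ ENNReal.ofReal (4 * (m * (1 / 4) ^ m)) := by
    intro m
    have hstep : IsDyadicStep w (fun t ω => I (m + 1) t ω - I m t ω) (p (m + 1)) m :=
      ((isDyadicStep_dyadicSum w φ (p (m + 1)) (m + 1)).mono_horizon m.le_succ).sub
        ((isDyadicStep_dyadicSum w φ (p m) m).refine (hp m.le_succ))
    have hcont : ∀ᵐ ω ∂μ, Continuous fun t => I (m + 1) t ω - I m t ω := by
      filter_upwards [hw.cont] with ω hω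
      exact (continuous_dyadicSum hω).sub (continuous_dyadicSum hω)
    have h1 := hstep.measure_sup_le hw.toIsPreBrownianReal hm
      (fun ω => by simp [hI, dyadicSum_zero]) hcont (l := (1 / 2) ^ m) (by positivity)
    refine h1.trans (ENNReal.ofReal_le_ofReal ?_)
    obtain ⟨f, hf, hf0, hfb⟩ := exists_mem_stepPairs_dyadicSum w (φ := φ) (p := p m)
      (K := m * 2 ^ p m) (t := m) (ε := (1 / 4) ^ m) (hgrid m _).le
      fun x y hx hy => hφp m x y (hx.trans (by simp)) (hy.trans (by simp))
    obtain ⟨f', hf', hf0', hfb'⟩ := exists_mem_stepPairs_dyadicSum w (φ := φ) (p := p (m + 1))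
      (K := (m + 1) * 2 ^ p (m + 1)) (t := m) (ε := (1 / 4) ^ (m + 1))
      ((show (m : ℝ≥0) ≤ (m + 1 : ℕ) by simp).trans (hgrid (m + 1) _).le)
      fun x y hx hy => hφp (m + 1) x y (hx.trans (by push_cast; rw [add_assoc]; simp))
        (hy.trans (by push_cast; rw [add_assoc]; simp))
    have hmem := (stepPairs w).sub_mem hf' hf
    have hL2 := eLpNorm_le_of_mem_stepPairs hw.toIsPreBrownianReal hmem (t := m)
      (b := 2 * (1 / 4) ^ m) (fun x hx => by simp [hf0 x hx, hf0' x hx]) fun x hx => by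
        have e1 := hfb x hx
        have e2 := hfb' x hx
        have e3 : ((1 : ℝ) / 4) ^ (m + 1) ≤ (1 / 4) ^ m :=
          pow_le_pow_of_le_one (by norm_num) (by norm_num) m.le_succ
        rw [abs_le] at e1 e2
        simp only [Prod.snd_sub, Pi.sub_apply]
        rw [abs_le]
        constructor <;> linarith
    have h2 := integral_sq_le_of_eLpNorm_le
      (memLp_of_mem_stepPairs hw.toIsPreBrownianReal hmem).1 (by positivity) hL2
    refine (div_le_div_of_nonneg_right h2 (by positivity)).trans (le_of_eq ?_)
    rw [NNReal.coe_natCast, mul_pow, Real.sq_sqrt (Nat.cast_nonneg m), mul_pow, ← pow_mul, ← pow_mul,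
      div_eq_iff (by positivity)]
    rw [show (1 / 4 : ℝ) = (1 / 2) ^ 2 by norm_num, ← pow_mul, ← pow_mul]
    ring
  have hsum : ∑' m, μ (E m) ≠ ∞ := by
    have hs : Summable fun m : ℕ => 4 * ((m : ℝ) * (1 / 4) ^ m) := by
      have := summable_pow_mul_geometric_of_norm_lt_one (R := ℝ) 1 (r := 1 / 4)
        (by rw [Real.norm_eq_abs, abs_of_pos] <;> norm_num)
      simpa using this.mul_left 4
    refine ((ENNReal.tsum_le_tsum hbound).trans_lt ?_).ne
    rw [← ENNReal.ofReal_tsum_of_nonneg (fun m => by positivity) hs]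
    exact ENNReal.ofReal_lt_top
  filter_upwards [ae_eventually_notMem hsum] with ω hω
  filter_upwards [hω] with m hmω t ht
  by_contra! hc
  exact hmω ⟨t, ht, hc⟩

/-- The Wiener integral of a continuous function has a continuous version. -/
theorem exists_wienerIntegral (hw : IsBrownianReal w μ) (hm : ∀ t, Measurable (w t))
    {φ : ℝ≥0 → ℝ} (hφ : Continuous φ) :
    ∃ N : ℝ≥0 → Ω → ℝ, (∀ t, Measurable (N t)) ∧ (∀ ω, Continuous fun t => N t ω) ∧
      (∀ ω, N 0 ω = 0) ∧
      (∀ t : ℝ≥0, Tendsto (fun m : ℕ => eLpNorm (fun ω => ∑ k ∈ Finset.range m,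
        φ (t * (k / m)) * (w (t * ((k + 1 : ℕ) / m)) ω - w (t * ((k : ℕ) / m)) ω) - N t ω) 2 μ)
        atTop (𝓝 0)) ∧
      ∀ s t : ℝ≥0, s ≤ t → eLpNorm (fun ω => N t ω - N s ω) 2 μ ≤
        eLpNorm ((Ico (s : ℝ) t).indicator fun x => φ x.toNNReal) 2 volume := by
  have hwp := hw.toIsPreBrownianReal
  obtain ⟨p, hp, hφp⟩ := exists_dyadic_scales hφ
  set I : ℕ → ℝ≥0 → Ω → ℝ := fun m => dyadicSum w φ (p m) (m * 2 ^ p m) with hI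
  have hgood : ∀ᵐ ω ∂μ, ∃ g : ℝ≥0 → ℝ, Continuous g ∧
      ∀ t, Tendsto (fun m => I m t ω) atTop (𝓝 (g t)) := by
    filter_upwards [hw.cont, ae_eventually_dyadicSum_sub_le hw hm hp hφp] with ω hc hω
    exact exists_continuous_limit (fun m => continuous_dyadicSum hc) hω
  -- Setting the limit to zero on a measurable null set makes all paths continuous and all time
  -- slices measurable.
  obtain ⟨Z, hZsub, hZm, hZ0⟩ := exists_measurable_superset_of_null (ae_iff.1 hgood)
  have hg : ∀ ω ∉ Z, ∃ g : ℝ≥0 → ℝ, Continuous g ∧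
      ∀ t, Tendsto (fun m => I m t ω) atTop (𝓝 (g t)) := fun ω hω => by
    by_contra h
    exact hω (hZsub h)
  choose! g hgc hgl using hg
  set N : ℝ≥0 → Ω → ℝ := fun t => Zᶜ.indicator fun ω => g ω t with hN
  have hNI : ∀ t ω, Tendsto (fun m => Zᶜ.indicator (I m t) ω) atTop (𝓝 (N t ω)) := by
    intro t ω
    by_cases hω : ω ∈ Z
    · simp [hN, hω]
    · simpa [hN, hω] using hgl ω hω t
  have hNm : ∀ t, Measurable (N t) := fun t =>
    measurable_of_tendsto_metrizable
      (fun m => (measurable_dyadicSum hm φ _ _ t).indicator hZm.compl)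
      (tendsto_pi_nhds.2 fun ω => hNI t ω)
  have hNae : ∀ t, ∀ᵐ ω ∂μ, Tendsto (fun m => I m t ω) atTop (𝓝 (N t ω)) := by
    intro t
    filter_upwards [show ∀ᵐ ω ∂μ, ω ∉ Z from measure_eq_zero_iff_ae_notMem.1 hZ0] with ω hω
    simpa [hω] using hNI t ω
  have hIm : ∀ m t, Measurable (I m t) := fun m t => measurable_dyadicSum hm φ _ _ t
  have hpair : ∀ (t : ℝ≥0) (m : ℕ), t ≤ m → ∃ f : ℝ → ℝ, (I m t, f) ∈ stepPairs w ∧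
      (∀ x ∉ Ico (0 : ℝ) t, f x = 0) ∧
      ∀ x ∈ Ico (0 : ℝ) t, |f x - φ x.toNNReal| ≤ (1 / 4) ^ m := by
    intro t m htm
    refine exists_mem_stepPairs_dyadicSum w ?_ fun x y hx hy => hφp m x y
      (hx.trans (htm.trans (by simp))) (hy.trans (htm.trans (by simp)))
    push_cast
    rwa [mul_div_assoc, div_self (by positivity), mul_one]
  have h4 : Tendsto (fun m : ℕ => ((1 : ℝ) / 4) ^ m) atTop (𝓝 0) :=
    tendsto_pow_atTop_nhds_zero_of_lt_one (by norm_num) (by norm_num)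
  refine ⟨N, hNm, fun ω => ?_, fun ω => ?_, fun t => ?_, fun s t hst => ?_⟩
  · by_cases hω : ω ∈ Z
    · simpa [hN, hω] using continuous_const
    · simpa [hN, hω] using hgc ω hω
  · refine tendsto_nhds_unique (hNI 0 ω) ?_
    have : ∀ m, Zᶜ.indicator (I m 0) ω = 0 := fun m => by
      by_cases hω : ω ∈ Z <;> simp [hω, hI, dyadicSum_zero]
    simp [this]
  -- Uniform partitions meet the dyadic construction here: for fine partitions both step functions
  -- are within `ε` of `φ` on `[0, t)`, so the sums differ by at most `2 ε √t` in `L²`. Fatou's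
  -- lemma passes to the dyadic limit `N t`.
  · rw [ENNReal.tendsto_nhds_zero]
    intro b hb
    obtain ⟨ε, hε, hεb⟩ : ∃ ε : ℝ, 0 < ε ∧ ENNReal.ofReal (2 * ε * √t) ≤ b := by
      have hlim : Tendsto (fun m : ℕ => ENNReal.ofReal (2 * (1 / 4) ^ m * √t)) atTop (𝓝 0) := by
        have := ENNReal.tendsto_ofReal ((h4.const_mul 2).mul_const √(t : ℝ))
        simpa using this
      obtain ⟨m, hm⟩ := (hlim.eventually_lt_const hb).exists
      exact ⟨(1 / 4) ^ m, by positivity, hm.le⟩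
    have huc := (isCompact_Icc (a := (0 : ℝ≥0)) (b := t)).uniformContinuousOn_of_continuous
      hφ.continuousOn
    obtain ⟨δ, hδ, hφδ⟩ := Metric.uniformContinuousOn_iff_le.1 huc ε hε
    have hmδ : ∀ᶠ m : ℕ in atTop, (t : ℝ) / m ≤ δ :=
      ((tendsto_const_div_atTop_nhds_zero_nat (t : ℝ)).eventually_lt_const hδ).mono fun _ => le_of_lt
    filter_upwards [hmδ, eventually_gt_atTop 0] with m hmδ hm0
    have hm0' : (m : ℝ≥0) ≠ 0 := by exact_mod_cast hm0.ne'
    set X : Ω → ℝ := fun ω => ∑ k ∈ Finset.range m,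
      φ (t * (k / m)) * (w (t * ((k + 1 : ℕ) / m)) ω - w (t * ((k : ℕ) / m)) ω) with hX
    have hτm : Monotone fun k : ℕ => t * (k / m : ℝ≥0) := fun i j hij => by dsimp only; gcongr
    obtain ⟨f, hf, hf0, hfb⟩ := exists_mem_stepPairs w (φ := φ)
      (τ := fun k => t * (k / m)) hτm (by simp)
      (a := fun k => φ (t * (k / m))) (ε := ε) m fun k hk y hy hy' => by
        have hkm : ((k + 1 : ℕ) / m : ℝ≥0) ≤ 1 := by
          rw [div_le_one₀ (by exact_mod_cast hm0)]
          exact_mod_cast hk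
        have hyt : y ≤ t := hy'.le.trans (mul_le_of_le_one_right zero_le hkm)
        rw [← Real.dist_eq]
        refine hφδ _ ⟨zero_le, hy.trans hyt⟩ y ⟨zero_le, hyt⟩ (le_trans ?_ hmδ)
        have h1 : (t * (k / m) : ℝ) ≤ y := by simpa using NNReal.coe_le_coe.2 hy
        have h2 : (y : ℝ) < t * ((k + 1 : ℕ) / m) := by simpa using NNReal.coe_lt_coe.2 hy'
        rw [dist_comm, NNReal.dist_eq]
        push_cast at h2 ⊢
        rw [abs_of_nonneg (by linarith)]
        have h3 : (t * ((k + 1) / m) : ℝ) = t * (k / m) + t / m := by ring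
        linarith
    simp only [div_self hm0', mul_one] at hf0 hfb
    have hXm : MemLp X 2 μ := (memLp_of_mem_stepPairs hwp hf).1
    refine (Lp.eLpNorm_lim_le_liminf_eLpNorm (f := fun q ω => X ω - I q t ω)
      (fun q => (hXm.1.sub (hIm q t).aestronglyMeasurable)) _ ?_).trans ?_
    · filter_upwards [hNae t] with ω hω using tendsto_const_nhds.sub hω
    · refine (liminf_le_of_frequently_le' (Eventually.frequently ?_))
      obtain ⟨T, hT⟩ := exists_nat_ge t
      filter_upwards [h4.eventually_lt_const hε, eventually_ge_atTop T] with q hq hTq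
      obtain ⟨f', hf', hf0', hfb'⟩ := hpair t q (hT.trans (by exact_mod_cast hTq))
      refine (eLpNorm_le_of_mem_stepPairs hwp ((stepPairs w).sub_mem hf hf') (t := t)
        (b := 2 * ε) (fun x hx => by simp [hf0 x hx, hf0' x hx]) fun x hx => ?_).trans hεb
      have e1 := hfb x hx
      have e2 := hfb' x hx
      rw [abs_le] at e1 e2
      simp only [Prod.snd_sub, Pi.sub_apply]
      rw [abs_le]
      constructor <;> linarith
  -- The increment of the step sums is paired with `f - f'`, which is within `2 * (1 / 4) ^ q` of
  -- `φ` restricted to `[s, t)`; Fatou's lemma removes this error.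
  · have hlim : Tendsto (fun m : ℕ => eLpNorm ((Ico (s : ℝ) t).indicator fun x => φ x.toNNReal) 2
        volume + ENNReal.ofReal (2 * (1 / 4) ^ m * √t)) atTop
        (𝓝 (eLpNorm ((Ico (s : ℝ) t).indicator fun x => φ x.toNNReal) 2 volume)) := by
      have h1 := ENNReal.tendsto_ofReal ((h4.const_mul 2).mul_const √(t : ℝ))
      simp only [mul_zero, zero_mul, ENNReal.ofReal_zero] at h1
      simpa using tendsto_const_nhds.add h1
    refine (Lp.eLpNorm_lim_le_liminf_eLpNorm (f := fun q ω => I q t ω - I q s ω)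
      (fun q => ((hIm q t).sub (hIm q s)).aestronglyMeasurable) _ ?_).trans ?_
    · filter_upwards [hNae t, hNae s] with ω h1 h2 using h1.sub h2
    · rw [← hlim.liminf_eq]
      refine liminf_le_liminf ?_
      obtain ⟨T, hT⟩ := exists_nat_ge t
      filter_upwards [eventually_ge_atTop T] with q hTq
      have htq : t ≤ q := hT.trans (by exact_mod_cast hTq)
      obtain ⟨f, hf, hf0, hfb⟩ := hpair t q htq
      obtain ⟨f', hf', hf0', hfb'⟩ := hpair s q (hst.trans htq)
      have hmem := (stepPairs w).sub_mem hf hf'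
      have hst' : (s : ℝ) ≤ t := by exact_mod_cast hst
      have hind : Measurable ((Ico (s : ℝ) t).indicator fun x => φ x.toNNReal) :=
        ((hφ.comp continuous_real_toNNReal).measurable).indicator measurableSet_Ico
      have heq := eLpNorm_of_mem_stepPairs hwp hmem
      simp only [Prod.fst_sub, Prod.snd_sub] at heq
      change eLpNorm (I q t - I q s) 2 μ ≤ _
      rw [heq]
      set F := (Ico (s : ℝ) t).indicator fun x => φ x.toNNReal with hF
      have hsplit : f - f' = F + (f - f' - F) := by abel
      rw [hsplit]
      have hfm := (memLp_of_mem_stepPairs hwp hmem).2.1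
      refine (eLpNorm_add_le hind.aestronglyMeasurable (hfm.sub hind.aestronglyMeasurable)
        one_le_two).trans (add_le_add_right ?_ _)
      have hb0 : (0 : ℝ) ≤ 2 * (1 / 4) ^ q := by positivity
      calc eLpNorm (f - f' - F) 2 volume ≤
          eLpNorm ((Ico (0 : ℝ) t).indicator fun _ => 2 * (1 / 4 : ℝ) ^ q) 2 volume := by
            refine eLpNorm_mono fun x => ?_
            by_cases hx : x ∈ Ico (0 : ℝ) t
            · rw [indicator_of_mem hx, Real.norm_eq_abs, Real.norm_of_nonneg hb0]
              have e1 := hfb x hx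
              rw [abs_le] at e1
              simp only [Pi.sub_apply]
              by_cases hxs : x < s
              · have e2 := hfb' x ⟨hx.1, hxs⟩
                rw [abs_le] at e2
                rw [hF, indicator_of_notMem (fun h => not_lt.2 h.1 hxs), sub_zero, abs_le]
                constructor <;> linarith
              · rw [hf0' x fun h => hxs h.2, hF, indicator_of_mem (mem_Ico.2 ⟨not_lt.1 hxs, hx.2⟩), abs_le]
                have : (0 : ℝ) ≤ (1 / 4) ^ q := by positivity
                constructor <;> linarith
            · have hx1 : x ∉ Ico (0 : ℝ) s := fun h => hx ⟨h.1, h.2.trans_le hst'⟩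
              have hx2 : x ∉ Ico (s : ℝ) t := fun h => hx ⟨s.2.trans h.1, h.2⟩
              simp [hF, hf0 x hx, hf0' x hx1, hx, hx2]
        _ = ENNReal.ofReal (2 * (1 / 4) ^ q * √t) := by
            rw [eLpNorm_indicator_const measurableSet_Ico two_ne_zero ENNReal.ofNat_ne_top,
              Real.volume_Ico, sub_zero, ENNReal.ofReal_mul hb0, Real.sqrt_eq_rpow,
              ← ENNReal.ofReal_rpow_of_nonneg t.coe_nonneg (by norm_num), Real.enorm_of_nonneg hb0]
            simp

end WienerIntegral

/-! ### Measurability with respect to sub-σ-algebras. -/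

section Measurability

variable {Ω E : Type*} {m m0 : MeasurableSpace Ω} {μ : Measure[m0] Ω} [NormedAddCommGroup E]

theorem aestronglyMeasurable_finsetSum {ι : Type*} {f : ι → Ω → E} (s : Finset ι)
    (hf : ∀ i ∈ s, AEStronglyMeasurable[m] (f i) μ) :
    AEStronglyMeasurable[m] (fun ω => ∑ i ∈ s, f i ω) μ := by
  classical
  induction s using Finset.induction_on with
  | empty =>
    simp only [Finset.sum_empty]
    exact stronglyMeasurable_zero.aestronglyMeasurable
  | insert i s hi ih =>
    simp only [Finset.sum_insert hi]
    exact (hf i (Finset.mem_insert_self i s)).add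
      (ih fun j hj => hf j (Finset.mem_insert_of_mem hj))

variable [CompleteSpace E]

theorem stronglyMeasurable_limUnder {m : MeasurableSpace Ω} {f : ℕ → Ω → E}
    (hf : ∀ k, StronglyMeasurable (f k)) :
    StronglyMeasurable fun ω => limUnder atTop fun k => f k ω :=
  StronglyMeasurable.limUnder hf

/-- The limit is taken along `m`-measurable representatives; `limUnder` supplies a value where they
diverge, so no completeness of `m` is needed. -/
theorem aestronglyMeasurable_of_tendsto_ae_of_le {f : ℕ → Ω → E} {g : Ω → E}
    (hf : ∀ k, AEStronglyMeasurable[m] (f k) μ)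
    (h : ∀ᵐ ω ∂μ, Tendsto (fun k => f k ω) atTop (𝓝 (g ω))) : AEStronglyMeasurable[m] g μ := by
  choose f' hf' hff' using hf
  refine ⟨fun ω => limUnder atTop fun k => f' k ω, stronglyMeasurable_limUnder hf', ?_⟩
  filter_upwards [h, ae_all_iff.2 hff'] with ω hω hfω
  simp only [← hfω]
  exact hω.limUnder_eq.symm

theorem tendsto_riemannSum [NormedSpace ℝ E] {h : ℝ → E} (hh : Continuous h) {t : ℝ}
    (ht : 0 ≤ t) :
    Tendsto (fun m : ℕ => ∑ k ∈ Finset.range m, (t / m) • h (k * (t / m))) atTop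
      (𝓝 (∫ s in (0 : ℝ)..t, h s)) := by
  have huc := (isCompact_Icc (a := (0 : ℝ)) (b := t)).uniformContinuousOn_of_continuous
    hh.continuousOn
  rw [Metric.tendsto_atTop']
  intro ε hε
  -- The tolerance `ε / (t + 1)` gives total error at most `ε * t / (t + 1) < ε`, also when `t = 0`.
  obtain ⟨δ, hδ, hhδ⟩ := Metric.uniformContinuousOn_iff_le.1 huc (ε / (t + 1)) (by positivity)
  obtain ⟨m0, hm0⟩ := eventually_atTop.1
    (((tendsto_const_div_atTop_nhds_zero_nat t).eventually_lt_const hδ))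
  refine ⟨m0, fun m hm => ?_⟩
  have hmpos : (0 : ℝ) < m := by exact_mod_cast (Nat.zero_le m0).trans_lt hm
  have hd : 0 ≤ t / m := by positivity
  have hsum : ∑ k ∈ Finset.range m, ∫ s in (k * (t / m))..((k + 1 : ℕ) * (t / m)), h s =
      ∫ s in (0 : ℝ)..t, h s := by
    rw [intervalIntegral.sum_integral_adjacent_intervals (a := fun k : ℕ => (k : ℝ) * (t / m))
      fun k _ => hh.intervalIntegrable _ _]
    congr 1
    · simp
    · field_simp
  rw [dist_eq_norm, ← hsum, ← Finset.sum_sub_distrib]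
  have hterm : ∀ k ∈ Finset.range m, ‖(t / m) • h (k * (t / m)) -
      ∫ s in (k * (t / m))..((k + 1 : ℕ) * (t / m)), h s‖ ≤ ε / (t + 1) * (t / m) := by
    intro k hk
    have hk' : ((k + 1 : ℕ) : ℝ) ≤ m := by exact_mod_cast Finset.mem_range.1 hk
    have hlen : ((k + 1 : ℕ) : ℝ) * (t / m) - k * (t / m) = t / m := by push_cast; ring
    have htop : ((k + 1 : ℕ) : ℝ) * (t / m) ≤ t := by
      calc ((k + 1 : ℕ) : ℝ) * (t / m) ≤ m * (t / m) := by gcongr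
        _ = t := by field_simp
    have hk0 : 0 ≤ (k : ℝ) * (t / m) := by positivity
    have hc : (t / m) • h (k * (t / m)) =
        ∫ _ in (k * (t / m))..((k + 1 : ℕ) * (t / m)), h (k * (t / m)) := by
      rw [intervalIntegral.integral_const, hlen]
    rw [hc, ← intervalIntegral.integral_sub intervalIntegrable_const (hh.intervalIntegrable _ _)]
    refine (intervalIntegral.norm_integral_le_of_norm_le_const (C := ε / (t + 1))
      fun s hs => ?_).trans ?_
    · rw [uIoc_of_le (by linarith)] at hs
      rw [← dist_eq_norm]
      refine hhδ _ ⟨hk0, by linarith⟩ s ⟨by linarith [hs.1], by linarith [hs.2]⟩ ?_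
      rw [dist_comm, Real.dist_eq, abs_of_nonneg (by linarith [hs.1])]
      linarith [hs.2, (hm0 m hm.le)]
    · rw [hlen, abs_of_nonneg hd]
  refine (norm_sum_le_of_le _ hterm).trans_lt ?_
  rw [Finset.sum_const, Finset.card_range, nsmul_eq_mul]
  have : (m : ℝ) * (ε / (t + 1) * (t / m)) = ε * (t / (t + 1)) := by field_simp
  rw [this]
  have h1 : t / (t + 1) < 1 := by rw [div_lt_one (by linarith)]; linarith
  nlinarith

/-- For continuous paths the integral is a limit of Riemann sums, which only use times in `[0, t]`;
hence integrals of adapted processes are adapted. -/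
theorem aestronglyMeasurable_intervalIntegral [NormedSpace ℝ E] {h : ℝ → Ω → E} {t : ℝ}
    (ht : 0 ≤ t) (hm : ∀ s ∈ Icc 0 t, AEStronglyMeasurable[m] (h s) μ)
    (hc : ∀ᵐ ω ∂μ, Continuous fun s => h s ω) :
    AEStronglyMeasurable[m] (fun ω => ∫ s in (0 : ℝ)..t, h s ω) μ := by
  refine aestronglyMeasurable_of_tendsto_ae_of_le
    (f := fun k ω => ∑ j ∈ Finset.range k, (t / k) • h (j * (t / k)) ω) (fun k => ?_)
    (hc.mono fun ω hω => tendsto_riemannSum hω ht)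
  refine aestronglyMeasurable_finsetSum _ fun j hj => ?_
  refine AEStronglyMeasurable.const_smul (f := h (j * (t / k))) (hm _ ⟨by positivity, ?_⟩) (t / k)
  have hk : (0 : ℝ) < k := by exact_mod_cast (Nat.zero_le j).trans_lt (Finset.mem_range.1 hj)
  calc (j : ℝ) * (t / k) ≤ k * (t / k) := by
        gcongr
        exact_mod_cast (Finset.mem_range.1 hj).le
    _ = t := by field_simp

end Measurability

/-! ### The vector-valued Wiener integral. -/

section VectorIntegral

variable {Ω : Type*} {n : ℕ}

theorem measurable_wienerSum {m : MeasurableSpace Ω} {σ : ℝ → Fin n → ℝ} {w : ℝ≥0 → Ω → ℝ}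
    {t : ℝ≥0} (hw : ∀ s ≤ t, Measurable[m] (w s)) (k : ℕ) :
    Measurable[m] (wienerSum σ w t k) := by
  unfold wienerSum
  refine measurable_pi_iff.2 fun j => ?_
  simp only [Finset.sum_apply, Pi.smul_apply, smul_eq_mul]
  refine Finset.measurable_fun_sum _ fun i hi => ?_
  have h0 : (0 : ℝ≥0) < k := by exact_mod_cast (Nat.zero_le i).trans_lt (Finset.mem_range.1 hi)
  refine ((hw _ ?_).sub (hw _ ?_)).mul_const _ <;>
  refine mul_le_of_le_one_right zero_le ((div_le_one₀ h0).2 ?_)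
  · exact_mod_cast Finset.mem_range.1 hi
  · exact_mod_cast (Finset.mem_range.1 hi).le

theorem measurable_dotProduct_self : Measurable fun v : Fin n → ℝ => v ⬝ᵥ v := by
  unfold dotProduct
  fun_prop

variable {m : MeasurableSpace Ω} [m0 : MeasurableSpace Ω] {μ : Measure Ω}

theorem eLpNorm_two_rpow_two {α : Type*} [MeasurableSpace α] (ν : Measure α) (f : α → ℝ) :
    eLpNorm f 2 ν ^ (2 : ℝ) = ∫⁻ x, ENNReal.ofReal (f x * f x) ∂ν := by
  rw [eLpNorm_eq_lintegral_rpow_enorm_toReal two_ne_zero ENNReal.ofNat_ne_top]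
  simp only [ENNReal.toReal_ofNat, one_div]
  rw [← ENNReal.rpow_mul, inv_mul_cancel₀ two_ne_zero, ENNReal.rpow_one]
  refine lintegral_congr fun x => ?_
  rw [← abs_mul_abs_self, ENNReal.ofReal_mul (abs_nonneg _), Real.enorm_eq_ofReal_abs,
    ENNReal.rpow_ofNat, sq]

theorem eLpNorm_pi_le (F : Ω → Fin n → ℝ) (hF : ∀ j, AEStronglyMeasurable (fun ω => F ω j) μ) :
    eLpNorm F 2 μ ≤ ∑ j, eLpNorm (fun ω => F ω j) 2 μ := by
  calc eLpNorm F 2 μ ≤ eLpNorm (∑ j, fun ω => ‖F ω j‖) 2 μ := by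
        refine eLpNorm_mono_real fun ω => ?_
        rw [Finset.sum_apply, pi_norm_le_iff_of_nonneg (Finset.sum_nonneg fun _ _ => norm_nonneg _)]
        exact fun j => Finset.single_le_sum (f := fun j => ‖F ω j‖) (fun _ _ => norm_nonneg _)
          (Finset.mem_univ j)
    _ ≤ ∑ j, eLpNorm (fun ω => ‖F ω j‖) 2 μ := eLpNorm_sum_le (fun j _ => (hF j).norm) one_le_two
    _ = _ := by simp only [eLpNorm_norm]

/-- The vector valued Wiener integral has a continuous version. -/
theorem exists_isWienerIntegral {w : ℝ≥0 → Ω → ℝ} (hw : IsBrownianReal w μ)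
    (hm : ∀ t, Measurable (w t)) {σ : ℝ → Fin n → ℝ} (hσ : ContinuousOn σ (Ici 0)) :
    ∃ M : ℝ≥0 → Ω → Fin n → ℝ, (∀ t, Measurable (M t)) ∧ (∀ ω, Continuous fun t => M t ω) ∧
      (∀ ω, M 0 ω = 0) ∧ IsWienerIntegral μ σ w M ∧
      ∀ s t : ℝ≥0, s ≤ t →
        ∫⁻ ω, ENNReal.ofReal ((M t ω - M s ω) ⬝ᵥ (M t ω - M s ω)) ∂μ ≤
          ∫⁻ x in Ico (s : ℝ) t, ENNReal.ofReal (σ x ⬝ᵥ σ x) := by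
  have hφ : ∀ j, Continuous fun s : ℝ≥0 => σ s j := fun j =>
    (continuous_apply j).comp (hσ.comp_continuous NNReal.continuous_coe fun s => s.coe_nonneg)
  choose N hNm hNc hN0 hNI hNs using fun j => exists_wienerIntegral hw hm (hφ j)
  refine ⟨fun t ω j => N j t ω, fun t => measurable_pi_iff.2 fun j => hNm j t,
    fun ω => continuous_pi fun j => hNc j ω, fun ω => funext fun j => hN0 j ω, fun t => ?_,
    fun s t hst => ?_⟩
  · have hsum := tendsto_finsetSum Finset.univ fun j _ => hNI j t
    rw [Finset.sum_const_zero] at hsum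
    refine tendsto_of_tendsto_of_tendsto_of_le_of_le tendsto_const_nhds hsum (fun _ => zero_le)
      fun k => ?_
    have hcomp : ∀ j ω, (wienerSum σ w t k ω - fun j => N j t ω) j =
        ∑ i ∈ Finset.range k, σ (t * (i / k) : ℝ≥0) j *
          (w (t * ((i + 1 : ℕ) / k)) ω - w (t * ((i : ℕ) / k)) ω) - N j t ω := by
      intro j ω
      simp [wienerSum, Finset.sum_apply, mul_comm]
    refine (eLpNorm_pi_le _ fun j => ?_).trans (Finset.sum_le_sum fun j _ => ?_)
    · exact (((measurable_pi_apply j).comp (measurable_wienerSum (fun s _ => hm s) k)).sub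
        (hNm j t)).aestronglyMeasurable
    · simp only [hcomp]
      exact le_rfl
  · have hj : ∀ j, ∫⁻ ω, ENNReal.ofReal ((N j t ω - N j s ω) * (N j t ω - N j s ω)) ∂μ ≤
        ∫⁻ x in Ico (s : ℝ) t, ENNReal.ofReal (σ x j * σ x j) := by
      intro j
      have h1 := ENNReal.rpow_le_rpow (hNs j s t hst) (show (0 : ℝ) ≤ 2 by norm_num)
      rw [eLpNorm_two_rpow_two, eLpNorm_two_rpow_two] at h1
      refine h1.trans (le_of_eq ?_)
      rw [← lintegral_indicator measurableSet_Ico]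
      refine lintegral_congr fun x => ?_
      by_cases hx : x ∈ Ico (s : ℝ) t
      · rw [indicator_of_mem hx, indicator_of_mem hx, Real.coe_toNNReal x (s.coe_nonneg.trans hx.1)]
      · rw [indicator_of_notMem hx, indicator_of_notMem hx]; simp
    simp only [dotProduct]
    simp_rw [ENNReal.ofReal_sum_of_nonneg fun j _ => mul_self_nonneg _]
    rw [lintegral_finsetSum _ fun j _ => ?_, lintegral_finsetSum' _ fun j _ => ?_]
    · exact Finset.sum_le_sum fun j _ => hj j
    · have h1 : ContinuousOn (fun x => σ x j) (Ico (s : ℝ) t) :=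
        ((continuous_apply j).comp_continuousOn hσ).mono fun x hx => s.coe_nonneg.trans hx.1
      exact ((h1.mul h1).aemeasurable measurableSet_Ico).ennreal_ofReal
    · exact ((((hNm j t).sub (hNm j s)).mul ((hNm j t).sub (hNm j s)))).ennreal_ofReal

/-- A subsequence of the step sums converges almost surely, and these sums use `w` only up to time
`t`. -/
theorem IsWienerIntegral.aestronglyMeasurable {σ : ℝ → Fin n → ℝ}
    {w : ℝ≥0 → Ω → ℝ} {M : ℝ≥0 → Ω → Fin n → ℝ} (h : IsWienerIntegral μ σ w M)
    (hm : ∀ t, Measurable (w t)) (hM : ∀ t, Measurable (M t)) {t : ℝ≥0}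
    (hw : ∀ s ≤ t, Measurable[m] (w s)) : AEStronglyMeasurable[m] (M t) μ := by
  obtain ⟨ns, -, hns⟩ := (tendstoInMeasure_of_tendsto_eLpNorm two_ne_zero
    (fun k => (measurable_wienerSum (fun s _ => hm s) k).aestronglyMeasurable)
    (hM t).aestronglyMeasurable (h t)).exists_seq_tendsto_ae
  exact aestronglyMeasurable_of_tendsto_ae_of_le
    (fun k => (measurable_wienerSum hw (ns k)).stronglyMeasurable.aestronglyMeasurable) hns

theorem IsWienerIntegral.ae_eq {σ : ℝ → Fin n → ℝ} {w : ℝ≥0 → Ω → ℝ}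
    {M M' : ℝ≥0 → Ω → Fin n → ℝ} (h : IsWienerIntegral μ σ w M) (h' : IsWienerIntegral μ σ w M')
    (hw : ∀ t, Measurable (w t)) (hM : ∀ t, AEStronglyMeasurable (M t) μ)
    (hM' : ∀ t, AEStronglyMeasurable (M' t) μ) (t : ℝ≥0) : M t =ᵐ[μ] M' t :=
  tendstoInMeasure_ae_unique
    (tendstoInMeasure_of_tendsto_eLpNorm two_ne_zero
      (fun k => (measurable_wienerSum (fun s _ => hw s) k).aestronglyMeasurable) (hM t) (h t))
    (tendstoInMeasure_of_tendsto_eLpNorm two_ne_zero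
      (fun k => (measurable_wienerSum (fun s _ => hw s) k).aestronglyMeasurable) (hM' t) (h' t))

end VectorIntegral

/-! ### Pathwise uniqueness and moving averages. -/

section Pathwise

variable {n : ℕ}

theorem eq_zero_of_eq_integral {K : Matrix (Fin n) (Fin n) ℝ} {d : ℝ≥0 → Fin n → ℝ}
    (hd : Continuous d) (h : ∀ t : ℝ≥0, d t = ∫ s in (0 : ℝ)..t, K *ᵥ d s.toNNReal) (t : ℝ≥0) :
    d t = 0 := by
  have hc : Continuous fun s : ℝ => K *ᵥ d s.toNNReal :=
    (Model.mulVecCLM K).continuous.comp (hd.comp continuous_real_toNNReal)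
  have hder : ∀ s : ℝ, 0 ≤ s → HasDerivWithinAt (fun t : ℝ => ∫ s in (0 : ℝ)..t, K *ᵥ d s.toNNReal)
      (Model.mulVecCLM K (∫ s in (0 : ℝ)..s, K *ᵥ d s.toNNReal) + 0) (Ici 0) s := by
    intro s hs
    have h1 := (hc.integral_hasStrictDerivAt 0 s).hasDerivAt.hasDerivWithinAt (s := Ici 0)
    have h2 := h s.toNNReal
    rw [Real.coe_toNNReal s hs] at h2
    rw [add_zero, ← h2]
    exact h1
  have h0 : ∀ s : ℝ, 0 ≤ s → HasDerivWithinAt (fun _ : ℝ => (0 : Fin n → ℝ))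
      (Model.mulVecCLM K 0 + 0) (Ici 0) s := by
    intro s _
    rw [map_zero, add_zero]
    exact hasDerivWithinAt_const _ _ _
  rw [h t]
  exact eqOn_of_linear_ode (Model.mulVecCLM K) (F := fun _ => 0)
    (y := fun t : ℝ => ∫ s in (0 : ℝ)..t, K *ᵥ d s.toNNReal) (by simp) hder h0 t.coe_nonneg

/-- Jensen's inequality in each component, from `0 ≤ ∫ (f_j - c)²` with `c` the mean. -/
theorem dotProduct_integral_le {f : ℝ → Fin n → ℝ} (hf : Continuous f) :
    (∫ v in (0 : ℝ)..1, f v) ⬝ᵥ (∫ v in (0 : ℝ)..1, f v) ≤ ∫ v in (0 : ℝ)..1, f v ⬝ᵥ f v := by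
  have hj : ∀ j, Continuous fun v => f v j := fun j => (continuous_apply j).comp hf
  have hcomp : ∀ j, (∫ v in (0 : ℝ)..1, f v) j = ∫ v in (0 : ℝ)..1, f v j := fun j =>
    ((ContinuousLinearMap.proj (R := ℝ) (φ := fun _ : Fin n => ℝ) j).intervalIntegral_comp_comm
      (hf.intervalIntegrable 0 1)).symm
  simp only [dotProduct, hcomp]
  have hi : ∀ j, IntervalIntegrable (fun v => f v j * f v j) volume 0 1 := fun j =>
    ((hj j).mul (hj j)).intervalIntegrable 0 1
  rw [intervalIntegral.integral_finsetSum fun j _ => hi j]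
  refine Finset.sum_le_sum fun j _ => ?_
  set c := ∫ v in (0 : ℝ)..1, f v j with hc
  have h0 : 0 ≤ ∫ v in (0 : ℝ)..1, (f v j * f v j - 2 * c * f v j + c * c) :=
    intervalIntegral.integral_nonneg zero_le_one fun v _ => by nlinarith [sq_nonneg (f v j - c)]
  have i2 : IntervalIntegrable (fun v => 2 * c * f v j) volume 0 1 :=
    (continuous_const.mul (hj j)).intervalIntegrable 0 1
  rw [intervalIntegral.integral_add ((hi j).sub i2) intervalIntegrable_const,
    intervalIntegral.integral_sub (hi j) i2, intervalIntegral.integral_const_mul,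
    intervalIntegral.integral_const, ← hc] at h0
  simp at h0
  linarith

/-- A continuous path on `[0, ∞)`, extended by a constant to the left, minus its average over the
preceding unit of time. -/
noncomputable def lag (m : ℝ≥0 → Fin n → ℝ) (t : ℝ) : Fin n → ℝ :=
  (∫ s in (0 : ℝ)..t, m s.toNNReal) - ∫ s in (0 : ℝ)..(t - 1), m s.toNNReal

variable {m : ℝ≥0 → Fin n → ℝ}

/-- The moving average is differentiable although `m` need not be, and its derivative is an
increment of `m` over unit time. It therefore replaces the noise by an admissible forcing of an
ordinary equation. -/
theorem hasDerivAt_lag (hm : Continuous m) (t : ℝ) :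
    HasDerivAt (lag m) (m t.toNNReal - m (t - 1).toNNReal) t := by
  have hc : Continuous fun s : ℝ => m s.toNNReal := hm.comp continuous_real_toNNReal
  exact ((hc.integral_hasStrictDerivAt 0 t).hasDerivAt).sub
    (HasDerivAt.comp_sub_const t 1 (hc.integral_hasStrictDerivAt 0 (t - 1)).hasDerivAt)

theorem lag_zero (hm0 : m 0 = 0) : lag m 0 = 0 := by
  have : ∫ s in (0 : ℝ)..(0 - 1), m s.toNNReal = ∫ s in (0 : ℝ)..(0 - 1), (0 : Fin n → ℝ) := by
    refine intervalIntegral.integral_congr fun s hs => ?_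
    rw [uIcc_of_ge (by norm_num)] at hs
    simp only [Real.toNNReal_of_nonpos hs.2, hm0]
  rw [lag, this]
  simp

theorem sub_lag_eq (hm : Continuous m) (t : ℝ) :
    m t.toNNReal - lag m t = ∫ v in (0 : ℝ)..1, (m t.toNNReal - m (t - v).toNNReal) := by
  have hc : Continuous fun s : ℝ => m s.toNNReal := hm.comp continuous_real_toNNReal
  have hc' : Continuous fun v : ℝ => m (t - v).toNNReal := hc.comp (continuous_const.sub continuous_id)
  rw [intervalIntegral.integral_sub intervalIntegrable_const (hc'.intervalIntegrable _ _),
    intervalIntegral.integral_comp_sub_left (fun s => m s.toNNReal), lag,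
    intervalIntegral.integral_interval_sub_left (hc.intervalIntegrable _ _)
      (hc.intervalIntegrable _ _)]
  simp

theorem ofReal_dotProduct_sub_lag_le (hm : Continuous m) (t : ℝ) :
    ENNReal.ofReal ((m t.toNNReal - lag m t) ⬝ᵥ (m t.toNNReal - lag m t)) ≤
      ∫⁻ v in Ioc (0 : ℝ) 1, ENNReal.ofReal
        ((m t.toNNReal - m (t - v).toNNReal) ⬝ᵥ (m t.toNNReal - m (t - v).toNNReal)) := by
  have hc : Continuous fun s : ℝ => m s.toNNReal := hm.comp continuous_real_toNNReal
  have hd : Continuous fun v : ℝ => m t.toNNReal - m (t - v).toNNReal :=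
    continuous_const.sub (hc.comp (continuous_const.sub continuous_id))
  rw [lintegral_Ioc_ofReal zero_le_one (continuousOn_dotProduct hd.continuousOn hd.continuousOn)
    fun v => dotProduct_self_nonneg' _, sub_lag_eq hm]
  exact ENNReal.ofReal_le_ofReal (dotProduct_integral_le hd)

end Pathwise

/-! ### Discounted moments of the noise. -/

section Moments

variable {Ω : Type*} [MeasurableSpace Ω] {μ : Measure Ω} {n : ℕ}

/-- The inner expectation is at most the integral of `‖σ‖²` over a window of length at most one
before `t`. By Tonelli a given `x` is charged only for `t` in `(x, x + 1]`, where `e^{-ρ t} ≤ e^{-ρ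
x}`. -/
theorem lintegral_discounted_increment_le [SFinite μ] {M : ℝ≥0 → Ω → Fin n → ℝ}
    {σ : ℝ → Fin n → ℝ} {ρ : ℝ} (hρ : 0 < ρ) (hσ : ContinuousOn σ (Ici 0))
    (hM : ∀ t, Measurable (M t)) (hMc : ∀ ω, Continuous fun t => M t ω)
    (hinc : ∀ s t : ℝ≥0, s ≤ t → ∫⁻ ω, ENNReal.ofReal ((M t ω - M s ω) ⬝ᵥ (M t ω - M s ω)) ∂μ ≤
      ∫⁻ x in Ico (s : ℝ) t, ENNReal.ofReal (σ x ⬝ᵥ σ x)) {v : ℝ} (hv0 : 0 ≤ v) (hv1 : v ≤ 1) :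
    ∫⁻ ω, (∫⁻ t in Ioi (0 : ℝ), ENNReal.ofReal (Real.exp (-ρ * t)) * ENNReal.ofReal
        ((M t.toNNReal ω - M (t - v).toNNReal ω) ⬝ᵥ
          (M t.toNNReal ω - M (t - v).toNNReal ω))) ∂μ ≤
      ∫⁻ x in Ioi (0 : ℝ), ENNReal.ofReal (Real.exp (-ρ * x) * (σ x ⬝ᵥ σ x)) := by
  have hMu : Measurable (Function.uncurry M) := measurable_uncurry_of_continuous_of_measurable hMc hM
  have hMr : Measurable fun q : ℝ × Ω => M q.1.toNNReal q.2 :=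
    hMu.comp ((measurable_real_toNNReal.comp measurable_fst).prodMk measurable_snd)
  have hMr' : Measurable fun q : ℝ × Ω => M (q.1 - v).toNNReal q.2 :=
    hMu.comp ((measurable_real_toNNReal.comp (measurable_fst.sub_const v)).prodMk measurable_snd)
  have hE : Measurable fun t : ℝ => ENNReal.ofReal (Real.exp (-ρ * t)) := by fun_prop
  have hjoint : Measurable fun q : ℝ × Ω => ENNReal.ofReal (Real.exp (-ρ * q.1)) * ENNReal.ofReal
      ((M q.1.toNNReal q.2 - M (q.1 - v).toNNReal q.2) ⬝ᵥ
        (M q.1.toNNReal q.2 - M (q.1 - v).toNNReal q.2)) :=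
    (hE.comp measurable_fst).mul
      (measurable_dotProduct_self.comp (hMr.sub hMr')).ennreal_ofReal
  set ψ : ℝ → ℝ≥0∞ := fun x => ENNReal.ofReal (σ (max x 0) ⬝ᵥ σ (max x 0)) with hψ
  have hψm : Measurable ψ := by
    have h1 : Continuous fun x : ℝ => σ (max x 0) :=
      hσ.comp_continuous (continuous_id.max continuous_const) fun x => mem_Ici.2 (le_max_right _ _)
    exact (measurable_dotProduct_self.comp h1.measurable).ennreal_ofReal
  have hinner : ∀ t : ℝ, 0 < t → ∫⁻ ω, ENNReal.ofReal (Real.exp (-ρ * t)) * ENNReal.ofReal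
      ((M t.toNNReal ω - M (t - v).toNNReal ω) ⬝ᵥ (M t.toNNReal ω - M (t - v).toNNReal ω)) ∂μ ≤
      ∫⁻ x in Ioi (0 : ℝ), (Ioc x (x + 1)).indicator
        (fun t => ENNReal.ofReal (Real.exp (-ρ * t)) * ψ x) t := by
    intro t ht
    rw [lintegral_const_mul' _ _ ENNReal.ofReal_ne_top]
    have h1 := hinc (t - v).toNNReal t.toNNReal (Real.toNNReal_le_toNNReal (by linarith))
    refine (mul_le_mul_right h1 _).trans ?_
    rw [← lintegral_const_mul' _ _ ENNReal.ofReal_ne_top, Real.coe_toNNReal t ht.le,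
      ← lintegral_indicator measurableSet_Ico,
      setLIntegral_congr Ioi_ae_eq_Ici, ← lintegral_indicator measurableSet_Ici]
    have hsing : ∀ᵐ x : ℝ, x ≠ t - 1 := by simp [ae_iff]
    refine lintegral_mono_ae ?_
    filter_upwards [hsing] with x hx
    by_cases hxm : x ∈ Ico ((t - v).toNNReal : ℝ) t
    · have hx0 : 0 ≤ x := (NNReal.coe_nonneg _).trans hxm.1
      have hxv : t - v ≤ x := (Real.le_coe_toNNReal _).trans hxm.1
      have hxt : t ≤ x + 1 := by linarith
      rw [indicator_of_mem hxm, indicator_of_mem (mem_Ici.2 hx0),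
        indicator_of_mem (mem_Ioc.2 ⟨hxm.2, hxt⟩)]
      simp only [hψ, max_eq_left hx0, le_refl]
    · rw [indicator_of_notMem hxm]
      exact zero_le
  have hjm : Measurable fun q : ℝ × ℝ => (Ioc q.2 (q.2 + 1)).indicator
      (fun t => ENNReal.ofReal (Real.exp (-ρ * t)) * ψ q.2) q.1 := by
    have hset : MeasurableSet {q : ℝ × ℝ | q.2 < q.1 ∧ q.1 ≤ q.2 + 1} :=
      (measurableSet_lt measurable_snd measurable_fst).inter
        (measurableSet_le measurable_fst (measurable_snd.add_const 1))
    exact ((hE.comp measurable_fst).mul (hψm.comp measurable_snd)).indicator hset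
  refine (lintegral_lintegral_swap (f := fun ω t => ENNReal.ofReal (Real.exp (-ρ * t)) *
    ENNReal.ofReal ((M t.toNNReal ω - M (t - v).toNNReal ω) ⬝ᵥ
      (M t.toNNReal ω - M (t - v).toNNReal ω)))
    (hjoint.comp measurable_swap).aemeasurable).trans_le ?_
  calc _ ≤ ∫⁻ t in Ioi (0 : ℝ), ∫⁻ x in Ioi (0 : ℝ), (Ioc x (x + 1)).indicator
        (fun t => ENNReal.ofReal (Real.exp (-ρ * t)) * ψ x) t :=
        setLIntegral_mono' measurableSet_Ioi hinner
    _ = ∫⁻ x in Ioi (0 : ℝ), ∫⁻ t in Ioi (0 : ℝ), (Ioc x (x + 1)).indicator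
        (fun t => ENNReal.ofReal (Real.exp (-ρ * t)) * ψ x) t :=
        lintegral_lintegral_swap hjm.aemeasurable
    _ ≤ _ := by
        refine setLIntegral_mono' measurableSet_Ioi fun x hx => ?_
        refine (setLIntegral_le_lintegral _ _).trans ?_
        rw [lintegral_indicator measurableSet_Ioc]
        calc ∫⁻ t in Ioc x (x + 1), ENNReal.ofReal (Real.exp (-ρ * t)) * ψ x
            ≤ ∫⁻ _ in Ioc x (x + 1), ENNReal.ofReal (Real.exp (-ρ * x)) * ψ x := by
              refine setLIntegral_mono' measurableSet_Ioc fun t ht => ?_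
              refine mul_le_mul_left (ENNReal.ofReal_le_ofReal (Real.exp_le_exp.2 ?_)) _
              nlinarith [ht.1]
          _ = ENNReal.ofReal (Real.exp (-ρ * x) * (σ x ⬝ᵥ σ x)) := by
              rw [setLIntegral_const, Real.volume_Ioc, hψ]
              simp only [max_eq_left (mem_Ioi.1 hx).le]
              rw [ENNReal.ofReal_mul (Real.exp_pos _).le]
              simp

end Moments

section DiscountedSq

variable {ι κ : Type*} [Fintype ι] [Fintype κ]

/-- `∫₀^∞ e^{-ρ t} ‖f t‖² dt`. -/
noncomputable def discountedSq (ρ : ℝ) (f : ℝ → ι → ℝ) : ℝ≥0∞ :=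
  ∫⁻ t in Ioi (0 : ℝ), ENNReal.ofReal (Real.exp (-ρ * t) * (f t ⬝ᵥ f t))

theorem discountedSq_congr {ρ : ℝ} {f g : ℝ → ι → ℝ} (h : ∀ t, 0 ≤ t → f t = g t) :
    discountedSq ρ f = discountedSq ρ g :=
  setLIntegral_congr_fun measurableSet_Ioi fun t ht => by rw [h t (mem_Ioi.1 ht).le]

theorem discountedSq_add_le (ρ : ℝ) {f : ℝ → ι → ℝ} (hf : Continuous f) (g : ℝ → ι → ℝ) :
    discountedSq ρ (fun t => f t + g t) ≤ 2 * (discountedSq ρ f + discountedSq ρ g) := by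
  have hm : Measurable fun t => ENNReal.ofReal (Real.exp (-ρ * t) * (f t ⬝ᵥ f t)) := by
    have : Continuous fun t => f t ⬝ᵥ f t := hf.dotProduct hf
    fun_prop
  rw [discountedSq, discountedSq, discountedSq, ← lintegral_add_left hm,
    ← lintegral_const_mul' _ _ ENNReal.ofNat_ne_top]
  refine lintegral_mono fun t => ?_
  have he := (Real.exp_pos (-ρ * t)).le
  rw [← ENNReal.ofReal_add (mul_nonneg he (dotProduct_self_nonneg' _))
    (mul_nonneg he (dotProduct_self_nonneg' _)), ← ENNReal.ofReal_ofNat 2,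
    ← ENNReal.ofReal_mul zero_le_two]
  refine ENNReal.ofReal_le_ofReal ?_
  nlinarith [dotProduct_self_add_le (f t) (g t)]

theorem exists_discountedSq_mulVec_le {n k : ℕ} (M : Matrix (Fin k) (Fin n) ℝ) :
    ∃ C : ℝ≥0, ∀ (ρ : ℝ) (f : ℝ → Fin n → ℝ),
      discountedSq ρ (fun t => M *ᵥ f t) ≤ C * discountedSq ρ f := by
  obtain ⟨C, hC, h⟩ := exists_mulVec_dotProduct_le M
  refine ⟨C.toNNReal, fun ρ f => ?_⟩
  rw [discountedSq, discountedSq, ← lintegral_const_mul' _ _ ENNReal.coe_ne_top]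
  refine lintegral_mono fun t => ?_
  have he := (Real.exp_pos (-ρ * t)).le
  change _ ≤ ENNReal.ofReal C * _
  rw [← ENNReal.ofReal_mul hC.le]
  refine ENNReal.ofReal_le_ofReal ?_
  nlinarith [mul_le_mul_of_nonneg_left (h (f t)) he]

end DiscountedSq

section Moments

variable {Ω : Type*} [MeasurableSpace Ω] {μ : Measure Ω} {n : ℕ}

/-- The deviation from the moving average is an average of increments over lags `v` in `(0, 1]`.
Jensen's inequality and Tonelli reduce it to the increment bound, which is uniform in `v`. -/
theorem lintegral_discountedSq_sub_lag_le [SFinite μ] {M : ℝ≥0 → Ω → Fin n → ℝ}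
    {σ : ℝ → Fin n → ℝ} {ρ : ℝ} (hρ : 0 < ρ) (hσ : ContinuousOn σ (Ici 0))
    (hM : ∀ t, Measurable (M t)) (hMc : ∀ ω, Continuous fun t => M t ω)
    (hinc : ∀ s t : ℝ≥0, s ≤ t → ∫⁻ ω, ENNReal.ofReal ((M t ω - M s ω) ⬝ᵥ (M t ω - M s ω)) ∂μ ≤
      ∫⁻ x in Ico (s : ℝ) t, ENNReal.ofReal (σ x ⬝ᵥ σ x)) :
    ∫⁻ ω, discountedSq ρ (fun t => M t.toNNReal ω - lag (fun s => M s ω) t) ∂μ ≤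
      discountedSq ρ σ := by
  have hMu : Measurable (Function.uncurry M) := measurable_uncurry_of_continuous_of_measurable hMc hM
  set f : Ω → ℝ → ℝ → ℝ≥0∞ := fun ω v t => ENNReal.ofReal (Real.exp (-ρ * t)) * ENNReal.ofReal
    ((M t.toNNReal ω - M (t - v).toNNReal ω) ⬝ᵥ (M t.toNNReal ω - M (t - v).toNNReal ω)) with hf
  have hfm : Measurable fun q : (Ω × ℝ) × ℝ => f q.1.1 q.1.2 q.2 := by
    have h1 : Measurable fun q : (Ω × ℝ) × ℝ => M q.2.toNNReal q.1.1 :=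
      hMu.comp ((measurable_real_toNNReal.comp measurable_snd).prodMk
        (measurable_fst.comp measurable_fst))
    have h2 : Measurable fun q : (Ω × ℝ) × ℝ => M (q.2 - q.1.2).toNNReal q.1.1 :=
      hMu.comp ((measurable_real_toNNReal.comp
        (measurable_snd.sub (measurable_snd.comp measurable_fst))).prodMk
        (measurable_fst.comp measurable_fst))
    have hE : Measurable fun t : ℝ => ENNReal.ofReal (Real.exp (-ρ * t)) := by fun_prop
    exact (hE.comp measurable_snd).mul
      (measurable_dotProduct_self.comp (h1.sub h2)).ennreal_ofReal
  calc ∫⁻ ω, discountedSq ρ (fun t => M t.toNNReal ω - lag (fun s => M s ω) t) ∂μ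
      ≤ ∫⁻ ω, (∫⁻ v in Ioc (0 : ℝ) 1, ∫⁻ t in Ioi (0 : ℝ), f ω v t) ∂μ := by
        refine lintegral_mono fun ω => ?_
        have hswap : ∫⁻ v in Ioc (0 : ℝ) 1, ∫⁻ t in Ioi (0 : ℝ), f ω v t =
            ∫⁻ t in Ioi (0 : ℝ), ∫⁻ v in Ioc (0 : ℝ) 1, f ω v t :=
          lintegral_lintegral_swap
            (hfm.comp ((measurable_const.prodMk measurable_fst).prodMk measurable_snd)).aemeasurable
        rw [hswap]
        refine lintegral_mono fun t => ?_
        simp only [hf]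
        rw [lintegral_const_mul' _ _ ENNReal.ofReal_ne_top,
          ENNReal.ofReal_mul (Real.exp_pos _).le]
        exact mul_le_mul_right (ofReal_dotProduct_sub_lag_le (hMc ω) t) _
    _ = ∫⁻ v in Ioc (0 : ℝ) 1, ∫⁻ ω, (∫⁻ t in Ioi (0 : ℝ), f ω v t) ∂μ :=
        lintegral_lintegral_swap hfm.lintegral_prod_right'.aemeasurable
    _ ≤ ∫⁻ _ in Ioc (0 : ℝ) 1, discountedSq ρ σ :=
        setLIntegral_mono' measurableSet_Ioc fun v hv =>
          lintegral_discounted_increment_le hρ hσ hM hMc hinc hv.1.le hv.2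
    _ = discountedSq ρ σ := by simp

end Moments

/-! ### The linear equation driven by a continuous path. -/

section LinearEquation

variable {n : ℕ} (K : Matrix (Fin n) (Fin n) ℝ)

/-- A path solving `x = ξ + ∫ (K x + g) + m` with a continuous driving path `m` obeys a discounted
`L²` bound in terms of `ξ`, `g` and the increments of `m`. -/
theorem Hurwitz.exists_discountedSq_le {K : Matrix (Fin n) (Fin n) ℝ} {ρ : ℝ}
    (hK : Hurwitz (K - (ρ / 2) • 1)) :
    ∃ C : ℝ≥0, ∀ (ξ : Fin n → ℝ) (g : ℝ → Fin n → ℝ) (m x : ℝ≥0 → Fin n → ℝ), Continuous g →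
      Continuous m → m 0 = 0 → Continuous x →
      (∀ t : ℝ≥0, x t = ξ + (∫ s in (0 : ℝ)..t, (K *ᵥ x s.toNNReal + g s)) + m t) →
      discountedSq ρ (fun t => x t.toNNReal) ≤ C * (ENNReal.ofReal (ξ ⬝ᵥ ξ) +
        (discountedSq ρ g + (discountedSq ρ (fun t => m t.toNNReal - m (t - 1).toNNReal) +
          discountedSq ρ (fun t => m t.toNNReal - lag m t)))) := by
  obtain ⟨C, hC⟩ := hK.exists_lintegral_le
  obtain ⟨C', hC'⟩ := exists_discountedSq_mulVec_le K
  refine ⟨2 * (C * (1 + 2 * 2 + 2 * C') + 1), fun ξ g m x hg hm hm0 hx h => ?_⟩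
  have hmr : Continuous fun s : ℝ => m s.toNNReal := hm.comp continuous_real_toNNReal
  have hlag : Continuous (lag m) :=
    continuous_iff_continuousAt.2 fun t => (hasDerivAt_lag hm t).continuousAt
  have hxr : Continuous fun s : ℝ => x s.toNNReal := hx.comp continuous_real_toNNReal
  have hb : Continuous fun s : ℝ => m s.toNNReal - m (s - 1).toNNReal :=
    hmr.sub (hmr.comp (continuous_id.sub continuous_const))
  have hKa : Continuous fun s : ℝ => K *ᵥ (m s.toNNReal - lag m s) :=
    (Model.mulVecCLM K).continuous.comp (hmr.sub hlag)
  have hd : Continuous fun s : ℝ => K *ᵥ x s.toNNReal + g s :=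
    ((Model.mulVecCLM K).continuous.comp hxr).add hg
  set a : ℝ → Fin n → ℝ := fun t => m t.toNNReal - lag m t with ha
  set b : ℝ → Fin n → ℝ := fun t => m t.toNNReal - m (t - 1).toNNReal with hbd
  have hac : Continuous a := hmr.sub hlag
  -- Replacing `m` by its moving average makes the path differentiable: `x = z + a` and `z' = K z +
  -- K a + g + b`, with `b` the derivative of `lag m`.
  set z : ℝ → Fin n → ℝ := fun t => ξ + (∫ s in (0 : ℝ)..t, (K *ᵥ x s.toNNReal + g s)) + lag m t
    with hz
  have hxz : ∀ t, 0 ≤ t → x t.toNNReal = z t + a t := by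
    intro t ht
    rw [h, Real.coe_toNNReal t ht]
    simp only [hz, ha]
    abel
  have hzd : ∀ t, 0 ≤ t →
      HasDerivWithinAt z (K *ᵥ z t + (K *ᵥ a t + (g t + b t))) (Ici 0) t := by
    intro t ht
    have h1 := (((hd.integral_hasStrictDerivAt 0 t).hasDerivAt.const_add ξ).add
      (hasDerivAt_lag hm t)).hasDerivWithinAt (s := Ici 0)
    refine h1.congr_deriv ?_
    simp only [hxz t ht, Matrix.mulVec_add, hbd]
    abel
  have hz0 : z 0 = ξ := by simp [hz, lag_zero hm0]
  have hbound := hC _ z (hKa.add (hg.add hb)).continuousOn hzd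
  rw [hz0] at hbound
  change discountedSq ρ z ≤ C * (_ + discountedSq ρ (fun t => K *ᵥ a t + (g t + b t))) at hbound
  have hF : discountedSq ρ (fun t => K *ᵥ a t + (g t + b t)) ≤
      2 * (C' * discountedSq ρ a + 2 * (discountedSq ρ g + discountedSq ρ b)) := by
    refine (discountedSq_add_le ρ hKa _).trans ?_
    gcongr
    · exact hC' ρ a
    · exact discountedSq_add_le ρ hg _
  rw [discountedSq_congr hxz]
  have hzc : Continuous z := by
    rw [hz]
    exact (continuous_const.add (continuous_iff_continuousAt.2 fun t =>
      (hd.integral_hasStrictDerivAt 0 t).hasDerivAt.continuousAt)).add hlag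
  refine (discountedSq_add_le ρ hzc _).trans ?_
  set X := ENNReal.ofReal (ξ ⬝ᵥ ξ)
  set G := discountedSq ρ g
  set U := discountedSq ρ a
  set V := discountedSq ρ b
  have hF2 : discountedSq ρ (fun t => K *ᵥ a t + (g t + b t)) ≤
      (2 * 2 + 2 * C') * (G + (V + U)) := by
    refine hF.trans ?_
    calc 2 * (C' * U + 2 * (G + V)) = 2 * 2 * (G + V) + 2 * C' * U := by ring
      _ ≤ 2 * 2 * (G + (V + U)) + 2 * C' * (G + (V + U)) := by
        gcongr
        · exact le_self_add
        · exact le_add_self.trans le_add_self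
      _ = _ := by ring
  have hT : discountedSq ρ z ≤ C * (1 + 2 * 2 + 2 * C') * (X + (G + (V + U))) := by
    refine hbound.trans ?_
    rw [mul_assoc]
    gcongr
    calc X + discountedSq ρ (fun t => K *ᵥ a t + (g t + b t))
        ≤ (X + (G + (V + U))) + (2 * 2 + 2 * C') * (X + (G + (V + U))) := by
          gcongr
          · exact le_self_add
          · exact hF2.trans (mul_le_mul_right le_add_self _)
      _ = _ := by ring
  have hU : U ≤ X + (G + (V + U)) := le_add_self.trans (le_add_self.trans le_add_self)
  push_cast
  calc 2 * (discountedSq ρ z + U)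
      ≤ 2 * (C * (1 + 2 * 2 + 2 * C') * (X + (G + (V + U))) + (X + (G + (V + U)))) := by
        gcongr
    _ = _ := by ring

/-- The solution of `x = ξ + ∫ (K x + g) + m`. -/
noncomputable def linearSolution (g : ℝ → Fin n → ℝ) (ξ : Fin n → ℝ) (m : ℝ≥0 → Fin n → ℝ)
    (t : ℝ≥0) : Fin n → ℝ :=
  ξ + linearFlow (Model.mulVecCLM K) (fun s => K *ᵥ (ξ + m s.toNNReal) + g s) 0 t + m t

variable {K} {g : ℝ → Fin n → ℝ} {ξ : Fin n → ℝ} {m : ℝ≥0 → Fin n → ℝ}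

theorem continuous_linearSolution_source (hg : Continuous g) (hm : Continuous m) :
    Continuous fun s : ℝ => K *ᵥ (ξ + m s.toNNReal) + g s :=
  ((Model.mulVecCLM K).continuous.comp
    (continuous_const.add (hm.comp continuous_real_toNNReal))).add hg

theorem continuous_linearSolution (hg : Continuous g) (hm : Continuous m) :
    Continuous (linearSolution K g ξ m) := by
  have h : Continuous (linearFlow (Model.mulVecCLM K)
      (fun s => K *ᵥ (ξ + m s.toNNReal) + g s) 0) :=
    continuous_iff_continuousAt.2 fun t =>
      (hasDerivAt_linearFlow _ (continuous_linearSolution_source hg hm) 0 t).continuousAt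
  exact (continuous_const.add (h.comp NNReal.continuous_coe)).add hm

/-- The path `y = x - ξ - m` satisfies the ordinary equation `y' = K y + K (ξ + m) + g`, `y 0 = 0`,
so no stochastic calculus is needed. -/
theorem linearSolution_eq (hg : Continuous g) (hm : Continuous m) (t : ℝ≥0) :
    linearSolution K g ξ m t =
      ξ + (∫ s in (0 : ℝ)..t, (K *ᵥ linearSolution K g ξ m s.toNNReal + g s)) + m t := by
  have hF := continuous_linearSolution_source (K := K) (ξ := ξ) hg hm
  have hx := (continuous_linearSolution (K := K) (ξ := ξ) hg hm).comp continuous_real_toNNReal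
  have hc : Continuous fun s : ℝ => K *ᵥ linearSolution K g ξ m s.toNNReal + g s :=
    ((Model.mulVecCLM K).continuous.comp hx).add hg
  have h := intervalIntegral.integral_eq_sub_of_hasDerivAt (a := 0) (b := (t : ℝ))
    (f := linearFlow (Model.mulVecCLM K) (fun s => K *ᵥ (ξ + m s.toNNReal) + g s) 0)
    (f' := fun s => K *ᵥ linearSolution K g ξ m s.toNNReal + g s) (fun s hs => ?_)
    (hc.intervalIntegrable _ _)
  · rw [h, linearFlow_zero, sub_zero]
    rfl
  · rw [uIcc_of_le t.coe_nonneg] at hs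
    refine (hasDerivAt_linearFlow _ hF 0 s).congr_deriv ?_
    rw [linearSolution, Real.coe_toNNReal s hs.1]
    change K *ᵥ _ + _ = _
    simp only [Matrix.mulVec_add]
    abel

theorem aestronglyMeasurable_linearSolution {Ω : Type*} {m1 m0 : MeasurableSpace Ω}
    {μ : Measure[m0] Ω} (hg : Continuous g) {ξ : Ω → Fin n → ℝ} {M : ℝ≥0 → Ω → Fin n → ℝ} {t : ℝ≥0}
    (hξ : AEStronglyMeasurable[m1] ξ μ) (hM : ∀ s ≤ t, AEStronglyMeasurable[m1] (M s) μ)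
    (hMc : ∀ ω, Continuous fun s => M s ω) :
    AEStronglyMeasurable[m1] (fun ω => linearSolution K g (ξ ω) (fun s => M s ω) t) μ := by
  unfold linearSolution linearFlow
  simp only [zero_add]
  refine (hξ.add ?_).add (hM t le_rfl)
  refine (NormedSpace.exp ((t : ℝ) • Model.mulVecCLM K)).continuous.comp_aestronglyMeasurable ?_
  refine aestronglyMeasurable_intervalIntegral t.coe_nonneg (fun s hs => ?_)
    (Eventually.of_forall fun ω => continuous_exp_neg_smul_apply _
      (continuous_linearSolution_source hg (hMc ω)))
  have hs' : s.toNNReal ≤ t := Real.toNNReal_le_iff_le_coe.2 hs.2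
  have hc : Continuous fun v : Fin n → ℝ =>
      NormedSpace.exp ((-s) • Model.mulVecCLM K) (K *ᵥ v + g s) :=
    (NormedSpace.exp ((-s) • Model.mulVecCLM K)).continuous.comp
      ((Model.mulVecCLM K).continuous.add continuous_const)
  exact hc.comp_aestronglyMeasurable (hξ.add (hM _ hs'))

end LinearEquation

/-! ### Uniqueness of trajectories and the self-representation of a law. -/

namespace Model

variable {n r N : ℕ} {𝓜 : Model n r} {Ω : Type*}

theorem drift_eq (hf : 𝓜.f = 0) (hG : 𝓜.G = 0) (u : Fin N → ControlLaw Ω n r)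
    (x : Fin N → ℝ≥0 → Ω → Fin n → ℝ) (i : Fin N) (ω : Ω) (t : ℝ≥0) :
    𝓜.drift u x i ω t = 𝓜.A *ᵥ x i t ω + 𝓜.B *ᵥ u i ω t (x i t ω) := by
  simp [drift, hf, hG]

theorem drift_starLaw (hf : 𝓜.f = 0) (hG : 𝓜.G = 0) (P : Matrix (Fin n) (Fin n) ℝ)
    (s : ℝ → Fin n → ℝ) (x : Fin N → ℝ≥0 → Ω → Fin n → ℝ) (i : Fin N) (ω : Ω) (t : ℝ≥0) :
    𝓜.drift (𝓜.starLaw Ω N P s) x i ω t = 𝓜.Abar P *ᵥ x i t ω + (-𝓜.S) *ᵥ s t := by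
  rw [drift_eq hf hG, starLaw, Abar, S, Matrix.mulVec_neg, Matrix.mulVec_mulVec,
    Matrix.mulVec_add, Matrix.sub_mulVec, Matrix.neg_mulVec, Matrix.mulVec_mulVec,
    ← Matrix.mul_assoc]
  abel

variable [MeasurableSpace Ω] {μ : Measure Ω}
  {W : Fin N → ℝ≥0 → Ω → ℝ} {x0 : Fin N → Ω → Fin n → ℝ}

theorem noiseSigma_le (hW : ∀ i t, Measurable (W i t)) (hx0 : ∀ i, Measurable (x0 i)) (t : ℝ≥0) :
    noiseSigma W x0 t ≤ ‹MeasurableSpace Ω› :=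
  iSup_le fun i => sup_le (hx0 i).comap_le (iSup_le fun s => (hW i s).comap_le)

/-- Two trajectories of control laws under which each agent obeys a linear equation are
indistinguishable. -/
theorem IsTrajectory.ae_eq (hW : ∀ i t, Measurable (W i t)) (hx0 : ∀ i, Measurable (x0 i))
    {K : Matrix (Fin n) (Fin n) ℝ} {g : Fin N → Ω → ℝ≥0 → Fin n → ℝ}
    {u : Fin N → ControlLaw Ω n r} {x y : Fin N → ℝ≥0 → Ω → Fin n → ℝ}
    (hgm : ∀ i t, AEStronglyMeasurable (fun ω => g i ω t) μ)
    (hgc : ∀ i, ∀ᵐ ω ∂μ, Continuous (g i ω))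
    (hdx : ∀ i ω t, 𝓜.drift u x i ω t = K *ᵥ x i t ω + g i ω t)
    (hdy : ∀ i ω t, 𝓜.drift u y i ω t = K *ᵥ y i t ω + g i ω t)
    (hx : 𝓜.IsTrajectory μ W x0 u x) (hy : 𝓜.IsTrajectory μ W x0 u y) :
    ∀ᵐ ω ∂μ, ∀ i t, y i t ω = x i t ω := by
  -- The noise term of a trajectory is only specified as an `L²` limit. Its measurability and
  -- continuity are recovered by solving the equation for it.
  have key : ∀ {z : Fin N → ℝ≥0 → Ω → Fin n → ℝ} {L : Fin N → ℝ≥0 → Ω → Fin n → ℝ},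
      (∀ i t, AEStronglyMeasurable[noiseSigma W x0 t] (z i t) μ) →
      (∀ i, ∀ᵐ ω ∂μ, Continuous fun t => z i t ω) →
      (∀ i ω t, 𝓜.drift u z i ω t = K *ᵥ z i t ω + g i ω t) →
      (∀ i, ∀ᵐ ω ∂μ, ∀ t : ℝ≥0,
        IntervalIntegrable (fun s : ℝ => 𝓜.drift u z i ω s.toNNReal) volume 0 t ∧
        z i t ω = x0 i ω + (∫ s in (0 : ℝ)..t, 𝓜.drift u z i ω s.toNNReal) + L i t ω) →
      (∀ i t, AEStronglyMeasurable (L i t) μ) ∧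
      ∀ i, ∀ᵐ ω ∂μ, Continuous (fun s : ℝ => 𝓜.drift u z i ω s.toNNReal) ∧
        Continuous fun t => L i t ω := by
    intro z L hzm hzc hdz hz
    have hcont : ∀ i, ∀ᵐ ω ∂μ, Continuous fun s : ℝ => 𝓜.drift u z i ω s.toNNReal := fun i => by
      filter_upwards [hzc i, hgc i] with ω h1 h2
      simp only [hdz]
      exact ((mulVecCLM K).continuous.comp (h1.comp continuous_real_toNNReal)).add
        (h2.comp continuous_real_toNNReal)
    have hzm' : ∀ i t, AEStronglyMeasurable (z i t) μ := fun i t =>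
      (hzm i t).mono (noiseSigma_le hW hx0 t)
    refine ⟨fun i t => ?_, fun i => ?_⟩
    · have h1 : AEStronglyMeasurable (fun ω => ∫ s in (0 : ℝ)..t, 𝓜.drift u z i ω s.toNNReal) μ :=
        aestronglyMeasurable_intervalIntegral t.coe_nonneg (fun s _ => by
          simp only [hdz]
          exact ((mulVecCLM K).continuous.comp_aestronglyMeasurable (hzm' i _)).add (hgm i _))
          (hcont i)
      refine (((hzm' i t).sub (hx0 i).aestronglyMeasurable).sub h1).congr ?_
      filter_upwards [hz i] with ω h
      simp only [Pi.sub_apply]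
      rw [(h t).2]
      abel
    · filter_upwards [hz i, hcont i, hzc i] with ω h1 h2 h3
      refine ⟨h2, ?_⟩
      have h4 : Continuous fun t : ℝ≥0 => ∫ s in (0 : ℝ)..t, 𝓜.drift u z i ω s.toNNReal :=
        (continuous_iff_continuousAt.2 fun t =>
          (h2.integral_hasStrictDerivAt 0 t).hasDerivAt.continuousAt).comp NNReal.continuous_coe
      refine ((h3.sub (continuous_const (y := x0 i ω))).sub h4).congr fun t => ?_
      simp only [Pi.sub_apply]
      rw [(h1 t).2]
      abel
  obtain ⟨hxm, hxc, Mx, hMx, hxe⟩ := hx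
  obtain ⟨hym, hyc, My, hMy, hye⟩ := hy
  obtain ⟨hMxm, hMxc⟩ := key hxm hxc hdx hxe
  obtain ⟨hMym, hMyc⟩ := key hym hyc hdy hye
  refine ae_all_iff.2 fun i => ?_
  have hM : ∀ᵐ ω ∂μ, ∀ k : ℕ, My i (TopologicalSpace.denseSeq ℝ≥0 k) ω =
      Mx i (TopologicalSpace.denseSeq ℝ≥0 k) ω := ae_all_iff.2 fun k =>
    (hMy i).ae_eq (hMx i) (hW i) (hMym i) (hMxm i) _
  filter_upwards [hM, hxe i, hye i, hMxc i, hMyc i, hxc i, hyc i] with ω h1 h2 h3 h4 h5 h6 h7 t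
  -- The two noise terms agree almost surely on a countable dense set of times, and continuity
  -- extends this to all times at once.
  have hMt : (fun t => My i t ω) = fun t => Mx i t ω :=
    Continuous.ext_on (TopologicalSpace.denseRange_denseSeq ℝ≥0) h5.2 h4.2
      (by rintro _ ⟨k, rfl⟩; exact h1 k)
  refine sub_eq_zero.1 (eq_zero_of_eq_integral (K := K) (d := fun t => y i t ω - x i t ω)
    (h7.sub h6) (fun t => ?_) t)
  have hMt' : My i t ω = Mx i t ω := congrFun hMt t
  rw [(h3 t).2, (h2 t).2, hMt', add_sub_add_right_eq_sub, add_sub_add_left_eq_sub,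
    ← intervalIntegral.integral_sub (h5.1.intervalIntegrable _ _) (h4.1.intervalIntegrable _ _)]
  refine intervalIntegral.integral_congr fun s _ => ?_
  simp only [hdx, hdy, Matrix.mulVec_sub]
  abel

/-- A feedback law with square integrable controls along one of its trajectories represents
itself. -/
theorem IsTrajectory.represents_self (hf : 𝓜.f = 0) (hG : 𝓜.G = 0)
    (hW : ∀ i t, Measurable (W i t)) (hx0 : ∀ i, Measurable (x0 i)) {P : Matrix (Fin n) (Fin n) ℝ}
    {s : ℝ → Fin n → ℝ} (hs : ContinuousOn s (Ici 0)) {x : Fin N → ℝ≥0 → Ω → Fin n → ℝ}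
    (hx : 𝓜.IsTrajectory μ W x0 (𝓜.starLaw Ω N P s) x)
    (hint : ∀ i, ∫⁻ ω, discountedSq 𝓜.ρ
      (fun t => 𝓜.starLaw Ω N P s i ω t.toNNReal (x i t.toNNReal ω)) ∂μ < ∞) :
    𝓜.Represents μ W x0 (𝓜.starLaw Ω N P s) (𝓜.starLaw Ω N P s) := by
  have hsc : Continuous fun t : ℝ≥0 => s t :=
    hs.comp_continuous NNReal.continuous_coe fun t => mem_Ici.2 t.coe_nonneg
  have huc : ∀ (i : Fin N) (ω : Ω), Continuous fun q : ℝ≥0 × (Fin n → ℝ) =>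
      𝓜.starLaw Ω N P s i ω q.1 q.2 := fun i ω => by
    have h1 : Continuous fun q : ℝ≥0 × (Fin n → ℝ) => P *ᵥ q.2 + s q.1 :=
      ((mulVecCLM P).continuous.comp continuous_snd).add (hsc.comp continuous_fst)
    exact (continuous_const.matrix_mulVec h1).neg
  have huniq : ∀ y z, 𝓜.IsTrajectory μ W x0 (𝓜.starLaw Ω N P s) y →
      𝓜.IsTrajectory μ W x0 (𝓜.starLaw Ω N P s) z → ∀ᵐ ω ∂μ, ∀ i t, z i t ω = y i t ω :=
    fun y z hy hz => IsTrajectory.ae_eq hW hx0 (K := 𝓜.Abar P)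
      (g := fun _ _ t => (-𝓜.S) *ᵥ s t)
      (fun _ _ => aestronglyMeasurable_const)
      (fun _ => Eventually.of_forall fun _ => (mulVecCLM (-𝓜.S)).continuous.comp hsc)
      (drift_starLaw hf hG P s y) (drift_starLaw hf hG P s z) hy hz
  have hrefl : ∀ z : Fin N → ℝ≥0 → Ω → Fin n → ℝ, ∀ᵐ ω ∂μ, ∀ i t,
      𝓜.starLaw Ω N P s i ω t (z i t ω) = 𝓜.starLaw Ω N P s i ω t (z i t ω) :=
    fun z => Eventually.of_forall fun _ _ _ => rfl
  have hadm : ∀ z, 𝓜.IsTrajectory μ W x0 (𝓜.starLaw Ω N P s) z →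
      𝓜.IsAdmissible μ (𝓜.starLaw Ω N P s) z := fun z hz i => by
    refine ⟨fun t => ?_, ?_⟩
    · have h1 : Measurable[⨆ s : Iic t, MeasurableSpace.comap (z i s) inferInstance] (z i t) :=
        (comap_measurable (z i t)).mono
          (le_iSup (fun s : Iic t => MeasurableSpace.comap (z i s) inferInstance) ⟨t, mem_Iic.2 le_rfl⟩)
          le_rfl
      have h2 : Continuous fun v : Fin n → ℝ => -((𝓜.R⁻¹ * 𝓜.Bᵀ) *ᵥ (P *ᵥ v + s t)) :=
        (continuous_const.matrix_mulVec
          ((mulVecCLM P).continuous.add continuous_const)).neg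
      exact h2.measurable.comp h1
    -- By uniqueness, the integrability known along `x` passes to any other trajectory of the law.
    · refine lt_of_eq_of_lt (lintegral_congr_ae ?_) (hint i)
      filter_upwards [huniq x z hx hz] with ω h
      simp only [h, discountedSq]
  refine ⟨⟨x, ⟨hx, fun y => huniq x y hx⟩, ⟨hx, fun y => huniq x y hx⟩, hadm x hx, hadm x hx,
    hrefl x⟩, fun z hz => ?_⟩
  have hzadm := hadm z hz
  obtain ⟨hzm, hzc, M, hM, hze⟩ := id hz
  -- Along `z` the feedback and the open-loop drifts agree by definition.
  have hzo : 𝓜.IsTrajectory μ W x0 (openLoop (𝓜.starLaw Ω N P s) z) z :=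
    ⟨hzm, hzc, M, hM, hze⟩
  refine ⟨z, ⟨hzo, fun y hy => ?_⟩, ⟨hz, fun y => huniq z y hz⟩, hzadm, hzadm, hrefl z⟩
  -- With the controls frozen along `z`, the drift is `A y` plus a forcing independent of `y`.
  -- Uniqueness thus applies with `A` in place of `Ā`, and needs no stability.
  refine IsTrajectory.ae_eq hW hx0 (K := 𝓜.A) (u := openLoop (𝓜.starLaw Ω N P s) z)
    (g := fun i ω t => 𝓜.B *ᵥ 𝓜.starLaw Ω N P s i ω t (z i t ω)) (fun i t => ?_) (fun i => ?_)
    (drift_eq hf hG (openLoop (𝓜.starLaw Ω N P s) z) z)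
    (drift_eq hf hG (openLoop (𝓜.starLaw Ω N P s) z) y) hzo hy
  · have h2 : Continuous fun v : Fin n → ℝ =>
        𝓜.B *ᵥ -((𝓜.R⁻¹ * 𝓜.Bᵀ) *ᵥ (P *ᵥ v + s t)) :=
      continuous_const.matrix_mulVec (continuous_const.matrix_mulVec
        ((mulVecCLM P).continuous.add continuous_const)).neg
    exact h2.comp_aestronglyMeasurable ((hzm i t).mono (noiseSigma_le hW hx0 t))
  · filter_upwards [hzc i] with ω h
    exact continuous_const.matrix_mulVec ((huc i ω).comp (continuous_id.prodMk h))

end Model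

/-! ### Existence of square integrable trajectories. -/

namespace Model

variable {n r N : ℕ} {𝓜 : Model n r} {P : Matrix (Fin n) (Fin n) ℝ} {Ω : Type*}

/-- The decoupled and the fixed-point feedback laws coincide when the offsets correspond. -/
theorem hatLaw_eq_starLaw {Pbar : Matrix (Fin n) (Fin n) ℝ} {xbar shat s : ℝ → Fin n → ℝ}
    (h : ∀ t : ℝ, 0 ≤ t → s t - (Pbar - P) *ᵥ xbar t = shat t) :
    𝓜.hatLaw Ω N P Pbar xbar shat = 𝓜.starLaw Ω N P s := by
  funext i ω t v
  rw [hatLaw, starLaw, ← h t t.coe_nonneg, add_assoc, add_sub_cancel]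

variable [MeasurableSpace Ω] {μ : Measure Ω} {W : Fin N → ℝ≥0 → Ω → ℝ} {x0 : Fin N → Ω → Fin n → ℝ}

theorem lintegral_dotProduct_self_lt_top {ξ : Ω → Fin n → ℝ} (hξ : MemLp ξ 2 μ) :
    ∫⁻ ω, ENNReal.ofReal (ξ ω ⬝ᵥ ξ ω) ∂μ < ∞ := by
  have hj : ∀ j, Integrable (fun ω => ξ ω j * ξ ω j) μ := fun j => by
    have h : MemLp (fun ω => ξ ω j) 2 μ := memLp_pi_iff.1 hξ j
    simpa only [sq] using h.integrable_sq
  have hint : Integrable (fun ω => ξ ω ⬝ᵥ ξ ω) μ := integrable_finsetSum _ fun j _ => hj j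
  have h := hint.hasFiniteIntegral
  rwa [hasFiniteIntegral_iff_ofReal] at h
  exact Eventually.of_forall fun ω => dotProduct_self_nonneg' _

/-- The feedback law `x ↦ -R⁻¹ Bᵀ (P x + s)` generates a trajectory with square integrable
states. -/
theorem exists_isTrajectory_starLaw [IsProbabilityMeasure μ] (hnoise : IsNoiseData 𝓜.xbar0 μ W x0)
    (hρ : 0 < 𝓜.ρ) (hσ : 𝓜.InC 𝓜.σ) (hf : 𝓜.f = 0) (hG : 𝓜.G = 0)
    (hK : Hurwitz (𝓜.Abar P - (𝓜.ρ / 2) • 1)) {s : ℝ → Fin n → ℝ} (hs : 𝓜.InC s) :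
    ∃ x, 𝓜.IsTrajectory μ W x0 (𝓜.starLaw Ω N P s) x ∧
      (∀ i ω, Continuous fun t => x i t ω) ∧
      ∀ i, ∫⁻ ω, discountedSq 𝓜.ρ (fun t => x i t.toNNReal ω) ∂μ < ∞ := by
  choose M hMm hMc hM0 hMI hMs using fun i =>
    exists_isWienerIntegral (hnoise.brownian i) (hnoise.measurable_W i) hσ.1
  -- The offset is only continuous on `[0, ∞)`; `max t 0` extends it continuously to the whole line.
  set g : ℝ → Fin n → ℝ := fun t => (-𝓜.S) *ᵥ s (max t 0) with hg
  have hgc : Continuous g := (mulVecCLM (-𝓜.S)).continuous.comp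
    (hs.1.comp_continuous (continuous_id.max continuous_const) fun t => mem_Ici.2 (le_max_right _ _))
  have hgs : ∀ t : ℝ, 0 ≤ t → g t = (-𝓜.S) *ᵥ s t := fun t ht => by simp only [hg, max_eq_left ht]
  set x : Fin N → ℝ≥0 → Ω → Fin n → ℝ := fun i t ω =>
    linearSolution (𝓜.Abar P) g (x0 i ω) (fun t => M i t ω) t with hx
  have hxc : ∀ i ω, Continuous fun t => x i t ω := fun i ω =>
    continuous_linearSolution hgc (hMc i ω)
  have hxe : ∀ i ω (t : ℝ≥0), x i t ω =
      x0 i ω + (∫ v in (0 : ℝ)..t, (𝓜.Abar P *ᵥ x i v.toNNReal ω + g v)) + M i t ω :=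
    fun i ω t => linearSolution_eq hgc (hMc i ω) t
  refine ⟨x, ⟨fun i t => ?_, fun i => Eventually.of_forall (hxc i), M, hMI,
    fun i => Eventually.of_forall fun ω t => ?_⟩, hxc, fun i => ?_⟩
  · refine aestronglyMeasurable_linearSolution hgc ?_ (fun v hv => ?_) (hMc i)
    · exact ((comap_measurable (x0 i)).mono (le_sup_left.trans (le_iSup (fun i =>
        MeasurableSpace.comap (x0 i) inferInstance ⊔
          ⨆ s : Iic t, MeasurableSpace.comap (W i s) inferInstance) i))
        le_rfl).stronglyMeasurable.aestronglyMeasurable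
    · refine (hMI i).aestronglyMeasurable (hnoise.measurable_W i) (hMm i) fun v' hv' => ?_
      exact (comap_measurable (W i v')).mono ((le_iSup (fun s : Iic t =>
        MeasurableSpace.comap (W i s) inferInstance) ⟨v', mem_Iic.2 (hv'.trans hv)⟩).trans
        (le_sup_right.trans (le_iSup (fun i => MeasurableSpace.comap (x0 i) inferInstance ⊔
          ⨆ s : Iic t, MeasurableSpace.comap (W i s) inferInstance) i))) le_rfl
  · have hd : ∀ v : ℝ, 0 ≤ v → 𝓜.drift (𝓜.starLaw Ω N P s) x i ω v.toNNReal =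
        𝓜.Abar P *ᵥ x i v.toNNReal ω + g v := fun v hv => by
      rw [drift_starLaw hf hG, Real.coe_toNNReal v hv, hgs v hv]
    have hc : Continuous fun v : ℝ => 𝓜.Abar P *ᵥ x i v.toNNReal ω + g v :=
      ((mulVecCLM (𝓜.Abar P)).continuous.comp
        ((hxc i ω).comp continuous_real_toNNReal)).add hgc
    have hcongr : EqOn (fun v : ℝ => 𝓜.Abar P *ᵥ x i v.toNNReal ω + g v)
        (fun v : ℝ => 𝓜.drift (𝓜.starLaw Ω N P s) x i ω v.toNNReal) (uIcc 0 (t : ℝ)) := by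
      intro v hv
      rw [uIcc_of_le t.coe_nonneg] at hv
      exact (hd v hv.1).symm
    refine ⟨(hc.intervalIntegrable 0 t).congr (hcongr.mono uIoc_subset_uIcc), ?_⟩
    rw [← intervalIntegral.integral_congr hcongr]
    exact hxe i ω t
  · obtain ⟨C, hC⟩ := hK.exists_discountedSq_le
    obtain ⟨C', hC'⟩ := exists_discountedSq_mulVec_le (-𝓜.S)
    have hgt : discountedSq 𝓜.ρ g < ∞ := by
      rw [discountedSq_congr hgs]
      exact (hC' 𝓜.ρ s).trans_lt (ENNReal.mul_lt_top ENNReal.coe_lt_top hs.lintegral_lt_top)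
    have hMu := measurable_uncurry_of_continuous_of_measurable (hMc i) (hMm i)
    have hb : Measurable fun ω => discountedSq 𝓜.ρ
        (fun t => M i t.toNNReal ω - M i (t - 1).toNNReal ω) := by
      refine Measurable.lintegral_prod_right' (f := fun q : Ω × ℝ => ENNReal.ofReal
        (Real.exp (-𝓜.ρ * q.2) * ((M i q.2.toNNReal q.1 - M i (q.2 - 1).toNNReal q.1) ⬝ᵥ
          (M i q.2.toNNReal q.1 - M i (q.2 - 1).toNNReal q.1)))) ?_
      have h1 : Measurable fun q : Ω × ℝ => M i q.2.toNNReal q.1 :=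
        hMu.comp ((measurable_real_toNNReal.comp measurable_snd).prodMk measurable_fst)
      have h2 : Measurable fun q : Ω × ℝ => M i (q.2 - 1).toNNReal q.1 :=
        hMu.comp ((measurable_real_toNNReal.comp (measurable_snd.sub_const 1)).prodMk
          measurable_fst)
      have hE : Measurable fun q : Ω × ℝ => Real.exp (-𝓜.ρ * q.2) := by fun_prop
      exact (hE.mul (measurable_dotProduct_self.comp (h1.sub h2))).ennreal_ofReal
    have hbt : ∫⁻ ω, discountedSq 𝓜.ρ
        (fun t => M i t.toNNReal ω - M i (t - 1).toNNReal ω) ∂μ < ∞ := by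
      refine lt_of_le_of_lt ?_ hσ.lintegral_lt_top
      have h := lintegral_discounted_increment_le hρ hσ.1 (hMm i) (hMc i) (hMs i) zero_le_one le_rfl
      simp only [← ENNReal.ofReal_mul (Real.exp_pos _).le] at h
      exact h
    have hat : ∫⁻ ω, discountedSq 𝓜.ρ
        (fun t => M i t.toNNReal ω - lag (fun v => M i v ω) t) ∂μ < ∞ :=
      (lintegral_discountedSq_sub_lag_le hρ hσ.1 (hMm i) (hMc i) (hMs i)).trans_lt
        hσ.lintegral_lt_top
    refine (lintegral_mono fun ω => hC (x0 i ω) g (fun t => M i t ω) (fun t => x i t ω) hgc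
      (hMc i ω) (hM0 i ω) (hxc i ω) (hxe i ω)).trans_lt ?_
    rw [lintegral_const_mul' _ _ ENNReal.coe_ne_top]
    refine ENNReal.mul_lt_top ENNReal.coe_lt_top ?_
    have hξ : Measurable fun ω => ENNReal.ofReal (x0 i ω ⬝ᵥ x0 i ω) :=
      (measurable_dotProduct_self.comp (hnoise.measurable_x0 i)).ennreal_ofReal
    rw [lintegral_add_left hξ,
      lintegral_add_left measurable_const, lintegral_add_left hb, lintegral_const, measure_univ,
      mul_one]
    exact ENNReal.add_lt_top.2 ⟨lintegral_dotProduct_self_lt_top (hnoise.memLp_x0 i),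
      ENNReal.add_lt_top.2 ⟨hgt, ENNReal.add_lt_top.2 ⟨hbt, hat⟩⟩⟩

/-- The control is a fixed linear image of `P x + s`, and both the state and the offset are square
integrable after discounting. -/
theorem represents_starLaw [IsProbabilityMeasure μ] (hnoise : IsNoiseData 𝓜.xbar0 μ W x0)
    (hρ : 0 < 𝓜.ρ) (hσ : 𝓜.InC 𝓜.σ) (hf : 𝓜.f = 0) (hG : 𝓜.G = 0)
    (hK : Hurwitz (𝓜.Abar P - (𝓜.ρ / 2) • 1)) {s : ℝ → Fin n → ℝ} (hs : 𝓜.InC s) :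
    𝓜.Represents μ W x0 (𝓜.starLaw Ω N P s) (𝓜.starLaw Ω N P s) := by
  obtain ⟨x, hx, hxc, hxt⟩ := exists_isTrajectory_starLaw hnoise hρ hσ hf hG hK hs
  refine hx.represents_self hf hG hnoise.measurable_W hnoise.measurable_x0 hs.1 fun i => ?_
  obtain ⟨C, hC⟩ := exists_discountedSq_mulVec_le (-(𝓜.R⁻¹ * 𝓜.Bᵀ))
  obtain ⟨C', hC'⟩ := exists_discountedSq_mulVec_le P
  have hle : ∀ ω, discountedSq 𝓜.ρ
      (fun t => 𝓜.starLaw Ω N P s i ω t.toNNReal (x i t.toNNReal ω)) ≤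
      C * (2 * (C' * discountedSq 𝓜.ρ (fun t => x i t.toNNReal ω) + discountedSq 𝓜.ρ s)) := by
    intro ω
    have h1 : ∀ t : ℝ, 0 ≤ t → 𝓜.starLaw Ω N P s i ω t.toNNReal (x i t.toNNReal ω) =
        (-(𝓜.R⁻¹ * 𝓜.Bᵀ)) *ᵥ (P *ᵥ x i t.toNNReal ω + s t) := fun t ht => by
      rw [starLaw, Real.coe_toNNReal t ht, Matrix.neg_mulVec]
    rw [discountedSq_congr h1]
    refine (hC _ _).trans (mul_le_mul_right ((discountedSq_add_le _ ((mulVecCLM P).continuous.comp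
      ((hxc i ω).comp continuous_real_toNNReal)) _).trans ?_) _)
    exact mul_le_mul_right (add_le_add_left (hC' _ _) _) _
  refine (lintegral_mono hle).trans_lt ?_
  rw [lintegral_const_mul' _ _ ENNReal.coe_ne_top, lintegral_const_mul' _ _ ENNReal.ofNat_ne_top,
    lintegral_add_right _ measurable_const, lintegral_const_mul' _ _ ENNReal.coe_ne_top,
    lintegral_const, measure_univ, mul_one]
  exact ENNReal.mul_lt_top ENNReal.coe_lt_top (ENNReal.mul_lt_top ENNReal.ofNat_lt_top
    (ENNReal.add_lt_top.2 ⟨ENNReal.mul_lt_top ENNReal.coe_lt_top (hxt i), hs.lintegral_lt_top⟩))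

end Model

end MeanFieldLQ

theorem proposition4 {n r N : ℕ} (𝓜 : MeanFieldLQ.Model n r)
    {Ω : Type*} [MeasurableSpace Ω] (μ : Measure Ω) [IsProbabilityMeasure μ]
    (W : Fin N → ℝ≥0 → Ω → ℝ) (x0 : Fin N → Ω → Fin n → ℝ)
    (hnoise : MeanFieldLQ.IsNoiseData 𝓜.xbar0 μ W x0)
    (hρ : 0 < 𝓜.ρ) (hR : 𝓜.R.PosDef) (hσ : 𝓜.InC 𝓜.σ)
    (hf : 𝓜.f = 0) (hG : 𝓜.G = 0)
    (hSD : 𝓜.StabilizableDetectable)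
    (P : Matrix (Fin n) (Fin n) ℝ) (hP : P.PosSemidef) (hPeq : 𝓜.Riccati P)
    (Pbar : Matrix (Fin n) (Fin n) ℝ) (hPbar : 𝓜.IsStabilizingGameSolution Pbar) :
    -- `K* = P̄ - P` solves the Riccati equation that decouples the fixed-point equation
    (𝓜.ρ • (Pbar - P) = (Pbar - P) * 𝓜.Abar P + (𝓜.Abar P)ᵀ * (Pbar - P)
      - (Pbar - P) * 𝓜.S * (Pbar - P) - 𝓜.Q * 𝓜.Γ) ∧
    -- solutions `(x̄*, s*)` of the fixed-point equation and `(x̄*, ŝ)` of the decoupled system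
    -- correspond to each other through `s* = (P̄ - P) x̄* + ŝ`
    (∀ xstar sstar : ℝ → Fin n → ℝ, 𝓜.FixedPointSystem P xstar sstar ↔
      𝓜.DecoupledSystem Pbar xstar (fun t => sstar t - (Pbar - P) *ᵥ xstar t)) ∧
    -- corresponding solutions yield strategies that represent each other
    (∀ xbar shat xstar sstar : ℝ → Fin n → ℝ, 𝓜.DecoupledSystem Pbar xbar shat →
      𝓜.FixedPointSystem P xstar sstar →
      (∀ t : ℝ, 0 ≤ t → sstar t - (Pbar - P) *ᵥ xstar t = shat t) →
      (∀ t : ℝ, 0 ≤ t → xstar t = xbar t) ∧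
      𝓜.Represents μ W x0 (𝓜.hatLaw Ω N P Pbar xbar shat) (𝓜.starLaw Ω N P sstar)) ∧
    -- if `M₃` has `n` stable and `n` unstable eigenvalues, then both systems are uniquely
    -- solvable, hence `s* = (P̄ - P) x̄ + ŝ`, and the strategies represent each other
    (MeanFieldLQ.HasSplitSpectrum 𝓜.M3 n n →
      (∃ xbar shat, 𝓜.DecoupledSystem Pbar xbar shat) ∧
      (∃ xstar sstar, 𝓜.FixedPointSystem P xstar sstar) ∧
      ∀ xbar shat xstar sstar : ℝ → Fin n → ℝ, 𝓜.DecoupledSystem Pbar xbar shat →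
        𝓜.FixedPointSystem P xstar sstar →
        (∀ t : ℝ, 0 ≤ t → xstar t = xbar t ∧ sstar t - (Pbar - P) *ᵥ xstar t = shat t) ∧
        𝓜.Represents μ W x0 (𝓜.hatLaw Ω N P Pbar xbar shat) (𝓜.starLaw Ω N P sstar)) := by
  have hK := MeanFieldLQ.Model.hurwitz_Abar hR hSD hP hPeq
  have hiff := MeanFieldLQ.Model.decoupledSystem_iff hR hf hP hPeq hPbar.1
  have hrep : ∀ xbar shat xstar sstar : ℝ → Fin n → ℝ, 𝓜.DecoupledSystem Pbar xbar shat →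
      𝓜.FixedPointSystem P xstar sstar →
      (∀ t : ℝ, 0 ≤ t → sstar t - (Pbar - P) *ᵥ xstar t = shat t) →
      (∀ t : ℝ, 0 ≤ t → xstar t = xbar t) ∧
      𝓜.Represents μ W x0 (𝓜.hatLaw Ω N P Pbar xbar shat) (𝓜.starLaw Ω N P sstar) := by
    intro xbar shat xstar sstar h h' hs
    have hx : ∀ t : ℝ, 0 ≤ t → xstar t = xbar t := fun t ht =>
      h.eqOn_state hf ((hiff xstar sstar).1 h') hs ht
    refine ⟨hx, ?_⟩
    -- Once the states and offsets match, both strategies are the same law, so only its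
    -- self-representation is left.
    rw [MeanFieldLQ.Model.hatLaw_eq_starLaw fun t ht => by rw [← hs t ht, hx t ht]]
    exact MeanFieldLQ.Model.represents_starLaw hnoise hρ hσ hf hG hK h'.2.1
  refine ⟨MeanFieldLQ.Model.riccati_sub hR hP hPeq hPbar.1, hiff, hrep, fun hspec => ?_⟩
  have hH := MeanFieldLQ.Model.hurwitz_of_hasSplitSpectrum hPbar hspec
  have hex := MeanFieldLQ.Model.exists_decoupledSystem hρ hf hPbar hH
  refine ⟨hex, MeanFieldLQ.Model.exists_fixedPointSystem hR hf hP hPeq hPbar.1 hex,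
    fun xbar shat xstar sstar h h' => ?_⟩
  -- The transformed fixed-point solution solves the decoupled system, whose offset is unique.
  have hs : ∀ t : ℝ, 0 ≤ t → sstar t - (Pbar - P) *ᵥ xstar t = shat t := fun t ht =>
    h.eqOn_offset hH ((hiff xstar sstar).1 h') ht
  obtain ⟨hx, hr⟩ := hrep xbar shat xstar sstar h h' hs
  exact ⟨fun t ht => ⟨hx t ht, hs t ht⟩, hr⟩
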